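/- **Conventions.** Running times refer to a deterministic word-RAM: registers and a memory of words, unit cost for constants, load, store, tests and the word operations $+,-,\times,\div,\bmod$, bitwise and/or/xor and shifts; with $w$-bit words all numbers stay below $2^w$. An instance of $k$-OV consists of $k$ lists $W_0,\dots,W_{k-1}$ of $n\ge 1$ vectors in $\{0,1\}^d$, $d\ge 1$ (repetitions are allowed; in particular the $W_i$ may be sets of size $n$). A solution is a choice of $a_0\in W_0,\dots,a_{k-1}\in W_{k-1}$ with $\sum_{x=1}^d\prod_{i=0}^{k-1}a_i[x]=0$ (entries of a list are identified by their positions). Graphs are given by their edge lists, $d(u,v)\in\mathbb N\cup\{\infty\}$ is the graph distance, and $D_{S,T}=\max_{u\in S,v\in T}d(u,v)$. SETH states: for every $\varepsilon>0$ there is a $K$ such that no algorithm decides satisfiability of CNF formulas with $N$ variables and $M$ clauses of at most $K$ literals each in time $2^{(1-\varepsilon)N}\,\mathrm{poly}(N+M)$ with words of $O(N+\log M)$ bits. **Theorem.** (A) For every $k\ge 2$ there is a reduction which, given a $k$-OV instance $W_0,\dots,W_{k-1}$, constructs in time $O(kn^{k-1}d^{k-1})$, with words of $O(\log(k(nd)^{k-1}))$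 bits, an undirected unweighted graph with $O(n^{k-1}+kn^{k-2}d^{k-1})$ vertices and $O(kn^{k-1}d^{k-1})$ edges, together with two disjoint vertex sets $S,T$. All constants in $O(\cdot)$ are absolute (independent of $k,n,d$). The following hold. 1. The vertex set is a disjoint union of layers $S=L_0,L_1,\dots,L_k=T$; edges join adjacent layers only; $|S|=|T|=n^{k-1}$ and $|L_1|,\dots,|L_{k-1}|\le n^{k-2}d^{k-1}$. 2. $S$ consists of all tuples $(a_0,\dots,a_{k-2})$ with $a_i\in W_i$, and $T$ of all tuples $(b_1,\dots,b_{k-1})$ with $b_i\in W_i$. 3. If the instance has no solution, then $d(u,v)=k$ for all $u\in S$, $v\in T$; in particular $D_{S,T}\le k$. 4. If $a_0,\dots,a_{k-1}$ is a solution, then $d\big((a_0,\dots,a_{k-2}),(a_1,\dots,a_{k-1})\big)\ge 3k-2$ for these vertices of $S$ and $T$; in particular $D_{S,T}\ge 3k-2$. 5. Let $a_0,\dots,a_{k-1}$ be a solution, $t=k-2$ and $0\le s\le t$. For all $b_i\in W_i$ $(t-s+1\le i\le t)$ the vertices $(a_0,\dots,a_{t-s},b_{t-s+1},\dots,b_t)\in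 S$ and $(a_1,\dots,a_{t+1})\in T$ are at distance at least $3t-2s+4$. Symmetrically, for all $c_j\in W_j$ $(1\le j\le s)$ the vertices $(a_0,\dots,a_t)\in S$ and $(c_1,\dots,c_s,a_{s+1},\dots,a_{t+1})\in T$ are at distance at least $3t-2s+4$. 6. For $1\le i\le k-1$, every vertex of $L_i$ has a neighbour in $L_{i-1}$ and a neighbour in $L_{i+1}$. (B) Consequently, assuming SETH, for every $k\ge 2$, distinguishing $S$-$T$ Diameter $k$ from $S$-$T$ Diameter at least $3k-2$ in undirected unweighted graphs requires $n^{1+1/(k-1)-o(1)}$ time, even for sparse graphs: for no $\varepsilon>0$ is there an algorithm that, with words of $O(\log n)$ bits, does so in time $O(n^{1+1/(k-1)-\varepsilon})$ on all graphs with $n$ vertices and at most $n$ edges (with arbitrary vertex sets $S$, $T$; nothing is required of the algorithm on other inputs). -/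

import Mathlib

namespace STDiam

/-! ### The word-RAM

A machine has registers and a random-access memory, all holding natural numbers.  Programs are
written in structured form (sequencing, branching, loops) instead of with jumps; this changes
running times by constant factors only.  Every elementary operation and every test costs one step.
On a machine with `w`-bit words a program may only produce numbers smaller than `2 ^ w`. -/

/-- Arithmetical and bitwise word operations (subtraction is truncated at zero). -/
inductive Op
  | add | sub | mul | div | mod | and | or | xor | shl | shr

def Op.eval : Op → ℕ → ℕ → ℕ
  | .add, x, y => x + y
  | .sub, x, y => x - y
  | .mul, x, y => x * y
  | .div, x, y => x / y
  | .mod, x, y => x % y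
  | .and, x, y => x &&& y
  | .or, x, y => x ||| y
  | .xor, x, y => x ^^^ y
  | .shl, x, y => x <<< y
  | .shr, x, y => x >>> y

/-- Programs; the natural numbers `r`, `a`, `b` name registers. -/
inductive Prog
  | skip
  /-- `r := v` for a constant `v` -/
  | const (r v : ℕ)
  /-- `r := a ∘ b` -/
  | op (o : Op) (r a b : ℕ)
  /-- `r := mem[a]` -/
  | load (r a : ℕ)
  /-- `mem[a] := r` -/
  | store (a r : ℕ)
  | seq (p q : Prog)
  /-- run `p` if `r ≠ 0`, and `q` otherwise -/
  | ite (r : ℕ) (p q : Prog)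
  /-- run `p` as long as `r ≠ 0` -/
  | loop (r : ℕ) (p : Prog)

structure State where
  reg : ℕ → ℕ
  mem : ℕ → ℕ

def State.setReg (σ : State) (r v : ℕ) : State :=
  { σ with reg := Function.update σ.reg r v }

def State.setMem (σ : State) (a v : ℕ) : State :=
  { σ with mem := Function.update σ.mem a v }

/-- `Exec w p σ t σ'`: with `w`-bit words, the program `p` started in the state `σ` halts after
exactly `t` steps in the state `σ'`, and no number it produces exceeds the word size. -/
inductive Exec (w : ℕ) : Prog → State → ℕ → State → Prop
  | skip (σ : State) : Exec w .skip σ 1 σ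
  | const (r v : ℕ) (σ : State) (hv : v < 2 ^ w) : Exec w (.const r v) σ 1 (σ.setReg r v)
  | op (o : Op) (r a b : ℕ) (σ : State) (hv : o.eval (σ.reg a) (σ.reg b) < 2 ^ w) :
      Exec w (.op o r a b) σ 1 (σ.setReg r (o.eval (σ.reg a) (σ.reg b)))
  | load (r a : ℕ) (σ : State) : Exec w (.load r a) σ 1 (σ.setReg r (σ.mem (σ.reg a)))
  | store (a r : ℕ) (σ : State) : Exec w (.store a r) σ 1 (σ.setMem (σ.reg a) (σ.reg r))
  | seq {p q : Prog} {σ σ' σ'' : State} {t t' : ℕ} (hp : Exec w p σ t σ')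
      (hq : Exec w q σ' t' σ'') : Exec w (.seq p q) σ (t + t') σ''
  | ite_true {r : ℕ} {p q : Prog} {σ σ' : State} {t : ℕ} (hr : σ.reg r ≠ 0)
      (hp : Exec w p σ t σ') : Exec w (.ite r p q) σ (t + 1) σ'
  | ite_false {r : ℕ} {p q : Prog} {σ σ' : State} {t : ℕ} (hr : σ.reg r = 0)
      (hq : Exec w q σ t σ') : Exec w (.ite r p q) σ (t + 1) σ'
  | loop_done {r : ℕ} {p : Prog} {σ : State} (hr : σ.reg r = 0) : Exec w (.loop r p) σ 1 σ
  | loop_step {r : ℕ} {p : Prog} {σ σ' σ'' : State} {t t' : ℕ} (hr : σ.reg r ≠ 0)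
      (hp : Exec w p σ t σ') (hl : Exec w (.loop r p) σ' t' σ'') :
      Exec w (.loop r p) σ (t + t' + 1) σ''

/-- Initially the input occupies the first memory cells; everything else is zero. -/
def initState (input : List ℕ) : State where
  reg := fun _ => 0
  mem := fun i => input.getD i 0

/-- With `w`-bit words, `P` halts on `input` after at most `T` steps, and then register `0` holds
the address of a memory block that contains `output`. -/
def Computes (P : Prog) (w : ℕ) (T : ℝ) (input output : List ℕ) : Prop :=
  (∀ x ∈ input, x < 2 ^ w) ∧
    ∃ (t : ℕ) (σ : State), Exec w P (initState input) t σ ∧ (t : ℝ) ≤ T ∧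
      ∀ (i : ℕ) (hi : i < output.length), σ.mem (σ.reg 0 + i) = output[i]

/-! ### The Strong Exponential Time Hypothesis -/

/-- CNF formulas with variables `0, …, N - 1`: lists of clauses, which are lists of literals.
The literal `(v, true)` is the variable `v`, and `(v, false)` is its negation. -/
abbrev CNF (N : ℕ) : Type := List (List (Fin N × Bool))

def CNF.Satisfiable {N : ℕ} (φ : CNF N) : Prop :=
  ∃ f : Fin N → Bool, ∀ c ∈ φ, ∃ l ∈ c, f l.1 = l.2

/-- The number of variables, the number of clauses, and then for each clause its length and its
literals. -/
def CNF.encode {N : ℕ} (φ : CNF N) : List ℕ :=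
  N :: φ.length :: φ.flatMap fun c => c.length :: c.map fun l => 2 * (l.1 : ℕ) + l.2.toNat

/-- `P` solves `K`-SAT in `2 ^ ((1 - ε) * N) * poly (N + M)` steps with words of `O(N + log M)`
bits, for formulas with `N` variables and `M` clauses; `c` is the constant in both bounds. -/
def SolvesSAT (P : Prog) (K c : ℕ) (ε : ℝ) : Prop :=
  ∀ (N : ℕ) (φ : CNF N), (∀ cl ∈ φ, cl.length ≤ K) →
    ∀ b : ℕ, (b = 1 ∧ φ.Satisfiable ∨ b = 0 ∧ ¬ φ.Satisfiable) →
      Computes P (c * (N + Nat.size φ.length + 1))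
        (c * (2 : ℝ) ^ ((1 - ε) * (N : ℝ)) * ((N : ℝ) + φ.length + 1) ^ c) φ.encode [b]

/-- The Strong Exponential Time Hypothesis: for every `ε > 0` there is a `K` such that no
algorithm solves `K`-SAT on `N` variables in `2 ^ ((1 - ε) * N) * poly` time. -/
def SETH : Prop :=
  ∀ ε : ℝ, 0 < ε → ∃ K : ℕ, ¬ ∃ (P : Prog) (c : ℕ), SolvesSAT P K c ε

/-! ### Orthogonal vectors -/

/-- An instance of `k`-OV: `k` lists `W₀, …, W_{k-1}` of `n` vectors in `{0,1}^d`. -/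
abbrev OVInstance (k n d : ℕ) : Type := Fin k → Fin n → Fin d → Bool

/-- The choice of the `a i`-th vector from the `i`-th list, for every `i`, is a solution:
the generalized inner product of the chosen vectors vanishes. -/
def OVInstance.IsSolution {k n d : ℕ} (W : OVInstance k n d) (a : Fin k → Fin n) : Prop :=
  ∑ x : Fin d, ∏ i : Fin k, (W i (a i) x).toNat = 0

/-- `k`, `n`, `d`, and then the entries of all vectors, one after the other. -/
def OVInstance.encode {k n d : ℕ} (W : OVInstance k n d) : List ℕ :=
  k :: n :: d :: (List.finRange k).flatMap fun i =>
    (List.finRange n).flatMap fun j => (List.finRange d).map fun x => (W i j x).toNat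

/-- `(a₀, …, a_{k-2})` -/
def front {α : Type} {k : ℕ} (a : Fin k → α) : Fin (k - 1) → α :=
  fun i => a ⟨i, by omega⟩

/-- `(a₁, …, a_{k-1})` -/
def back {α : Type} {k : ℕ} (a : Fin k → α) : Fin (k - 1) → α :=
  fun i => a ⟨i + 1, by omega⟩

/-! ### `S`-`T` Diameter -/

/-- `D_{S,T}`, the largest distance between a vertex of `S` and a vertex of `T`
(`⊤` if some such pair is not connected by a path). -/
noncomputable def stDiam {V : Type} (G : SimpleGraph V) (S T : Finset V) : ℕ∞ :=
  ⨆ s ∈ S, ⨆ t ∈ T, G.edist s t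

/-- The number of edges. -/
noncomputable def numEdges {N : ℕ} (G : SimpleGraph (Fin N)) : ℕ := G.edgeSet.ncard

/-- `l` is an encoding of the graph `G` with the vertex sets `S` and `T`: the numbers of vertices,
of edges, of elements of `S` and of elements of `T`, then a list of all edges, a list of the
elements of `S` and a list of the elements of `T`, in any order and without repetitions. -/
def EncodesST {N : ℕ} (G : SimpleGraph (Fin N)) (S T : Finset (Fin N)) (l : List ℕ) : Prop :=
  ∃ (E : List (Fin N × Fin N)) (s t : List (Fin N)),
    (E.map fun e => s(e.1, e.2)).Nodup ∧
    (∀ e : Sym2 (Fin N), e ∈ (E.map fun e => s(e.1, e.2)) ↔ e ∈ G.edgeSet) ∧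
    s.Nodup ∧ (∀ v, v ∈ s ↔ v ∈ S) ∧ t.Nodup ∧ (∀ v, v ∈ t ↔ v ∈ T) ∧
    l = [N, E.length, s.length, t.length] ++ (E.flatMap fun e => [(e.1 : ℕ), (e.2 : ℕ)]) ++
      (s.map fun v => (v : ℕ)) ++ (t.map fun v => (v : ℕ))

/-- On graphs with `N` vertices and at most `N` edges, `A` distinguishes between `S`-`T` Diameter
`k` (answer `0`) and at least `3k - 2` (answer `1`) in at most `C * N ^ e` steps with words of at
most `c * (log₂ N + 1)` bits.  Nothing is required of `A` on other graphs. -/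
def Distinguishes (A : Prog) (k c : ℕ) (C e : ℝ) : Prop :=
  ∀ (N : ℕ) (G : SimpleGraph (Fin N)) (S T : Finset (Fin N)) (l : List ℕ),
    EncodesST G S T l → numEdges G ≤ N →
      (stDiam G S T = k → Computes A (c * Nat.size N) (C * (N : ℝ) ^ e) l [0]) ∧
      (((3 * k - 2 : ℕ) : ℕ∞) ≤ stDiam G S T →
        Computes A (c * Nat.size N) (C * (N : ℝ) ^ e) l [1])

end STDiam

open STDiam

namespace STDiam

/-! ### A small program logic for the word-RAM

Programs are written with expressions.  Registers below `32` serve as variables; those from `32` on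
hold intermediate values. -/

section States

/-! Put `K = k - 1`. If the instance has no solution, then for tuples α = (α_0, …, α_{K-1}) of `S`
and β = (β_1, …, β_K) of `T` each of the `K` mixed choices α_0, …, α_{K-1-m}, β_{K-m}, …, β_K with 0
≤ m < K has a coordinate x_m at which all its vectors are one. The array x = (x_0, …, x_{K-1})
labels a path from α to β on which the entries of α are exchanged for those of β one at a time, the
last ones first. Number the digits of a tuple backwards, so that digit r is α_{K-1-r} or β_{K-r}. An
inner vertex of layer i with label x holds β-digits for r < i - 1 and α-digits for r ≥ i; the digit
i - 1 is missing, which makes the layers as small as n^(k-2) d^(k-1). An α-digit r is admissible for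
x if its vector is one at x_0, …, x_r, and a β-digit r if its vector is one at x_r, …, x_{K-1}.
These are exactly the demands made by the mixed choices, so the direct path of length `K + 1`
exists; it is shortest because edges join adjacent layers (`exists_array_of_no_solution`,
`Tables.IsRetraction.edist_eq`).

Now let a_0, …, a_K be a solution and take a walk from (a_0, …, a_{K-1}) to (a_1, …, a_K). An
α-digit r can change only if the walk climbs to layer r + 1 and comes back down. So when the walk
leaves `S` for the last time before its first arrival in `T`, after l steps, all α-digits r ≥ u are
still those of a, for some u with 2u ≤ l. Likewise, if l' steps follow the first arrival in `T`,
then at this arrival the β-digits r < K - u' are those of a, for some u' with 2u' ≤ l'. In between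
the label is constant. If u + u' < K, then all of a_0, …, a_K would be one at the coordinate x_u of
that label, which is impossible for a solution. Hence l + l' ≥ 2K, and with the K + 1 or more steps
in between the walk has length at least 3K + 1 = 3k - 2. Changing s digits at one end raises u or u'
by at most s and costs at most 2s. This is `IsDigitLayered.le_length`.

To make the graph easy to construct, inadmissible inner vertices are not deleted. Every inner vertex
carries arbitrary digits, which are read through a retraction onto the admissible vectors; arrays
with a digit position that admits no vector are skipped. Thus the numbering of the vertices has no
holes, edges are computed by digit arithmetic, and every inner vertex has neighbours on both sides.
The program tabulates the retractions anew for each array, at a cost that for n ≥ 2 is dominated by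
the number of edge candidates; for n = 1 one coordinate common to all vectors replaces the arrays.

For the hardness, the N variables of a formula are split into k blocks of N / k + 1 variables, with
the assignments of the blocks as vectors and the clauses as coordinates. Apart from polynomial
factors the graph has size 2^(N (k-1)/k), and raising this to the power 1 + 1/(k-1) - ε gives
2^((1-ε') N). Isolated vertices make the graph sparse. Correctness and running time of the programs
are proved with a small program logic (`Run`). -/

@[simp] theorem State.setReg_reg (σ : State) (r v r' : ℕ) :
    (σ.setReg r v).reg r' = if r' = r then v else σ.reg r' := by
  simp [State.setReg, Function.update_apply]

@[simp] theorem State.setReg_mem (σ : State) (r v : ℕ) : (σ.setReg r v).mem = σ.mem := rfl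

@[simp] theorem State.setMem_reg (σ : State) (a v : ℕ) : (σ.setMem a v).reg = σ.reg := rfl

@[simp] theorem State.setMem_mem (σ : State) (a v x : ℕ) :
    (σ.setMem a v).mem x = if x = a then v else σ.mem x := by
  simp [State.setMem, Function.update_apply]

theorem Exec.mono_word {w w' : ℕ} (hw : w ≤ w') {p : Prog} {σ σ' : State} {t : ℕ}
    (h : Exec w p σ t σ') : Exec w' p σ t σ' := by
  have hp : 2 ^ w ≤ 2 ^ w' := Nat.pow_le_pow_right (by norm_num) hw
  induction h with
  | skip σ => exact .skip σ
  | const r v σ hv => exact .const r v σ (hv.trans_le hp)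
  | op o r a b σ hv => exact .op o r a b σ (hv.trans_le hp)
  | load r a σ => exact .load r a σ
  | store a r σ => exact .store a r σ
  | seq _ _ h₁ h₂ => exact .seq h₁ h₂
  | ite_true hr _ h => exact .ite_true hr h
  | ite_false hr _ h => exact .ite_false hr h
  | loop_done hr => exact .loop_done hr
  | loop_step hr _ _ h₁ h₂ => exact .loop_step hr h₁ h₂

/-- Whether a program may assign to the register `x`. -/
def Prog.writes : Prog → ℕ → Bool
  | .skip, _ => false
  | .const r _, x => x == r
  | .op _ r _ _, x => x == r
  | .load r _, x => x == r
  | .store _ _, _ => false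
  | .seq p q, x => p.writes x || q.writes x
  | .ite _ p q, x => p.writes x || q.writes x
  | .loop _ p, x => p.writes x

/-- `Prog.writes` is a syntactic over-approximation that evaluates on concrete programs, so frame
conditions across whole subprograms hold by computation. -/
theorem Exec.frame {w : ℕ} {p : Prog} {σ σ' : State} {t : ℕ} (h : Exec w p σ t σ') (x : ℕ)
    (hx : p.writes x = false) : σ'.reg x = σ.reg x := by
  induction h <;> simp_all [Prog.writes]

/-- An upper bound for the registers a program assigns to. -/
def Prog.regBound : Prog → ℕ
  | .skip => 0
  | .const r _ => r + 1
  | .op _ r _ _ => r + 1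
  | .load r _ => r + 1
  | .store _ _ => 0
  | .seq p q => max p.regBound q.regBound
  | .ite _ p q => max p.regBound q.regBound
  | .loop _ p => p.regBound

/-- Used to restore an initial state after a program has run: only the registers below the bound
have to be cleared. -/
theorem Prog.writes_of_regBound_le (p : Prog) (x : ℕ) (hx : p.regBound ≤ x) :
    p.writes x = false := by
  induction p <;> simp_all [Prog.writes, Prog.regBound] <;> omega

end States

/-! ### Compiling expressions to word-RAM code -/

section Expressions

inductive Expr
  | reg (r : ℕ)
  | lit (c : ℕ)
  | op (o : Op) (a b : Expr)
  | load (a : Expr)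

namespace Expr

instance : Add Expr := ⟨.op .add⟩
instance : Sub Expr := ⟨.op .sub⟩
instance : Mul Expr := ⟨.op .mul⟩
instance : Div Expr := ⟨.op .div⟩
instance : Mod Expr := ⟨.op .mod⟩

def eval (σ : State) : Expr → ℕ
  | .reg r => σ.reg r
  | .lit c => c
  | .op o a b => o.eval (a.eval σ) (b.eval σ)
  | .load a => σ.mem (a.eval σ)

/-- No number produced by the evaluation exceeds the word size. -/
def Fits (w : ℕ) (σ : State) : Expr → Prop
  | .reg _ => True
  | .lit c => c < 2 ^ w
  | .op o a b => a.Fits w σ ∧ b.Fits w σ ∧ o.eval (a.eval σ) (b.eval σ) < 2 ^ w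
  | .load a => a.Fits w σ

/-- The exact running time of the compiled code. A bare register counts one because it compiles to
`skip`, which takes one step. -/
def size : Expr → ℕ
  | .reg _ => 1
  | .lit _ => 1
  | .op _ a b => a.size + b.size + 1
  | .load a => a.size + 1

/-- All registers occurring in the expression are below `t`. -/
def Below (t : ℕ) : Expr → Prop
  | .reg r => r < t
  | .lit _ => True
  | .op _ a b => a.Below t ∧ b.Below t
  | .load a => a.Below t

def isReg : Expr → Bool
  | .reg _ => true
  | _ => false

/-- The register that holds the value after the evaluation into `t`. -/
def loc : Expr → ℕ → ℕ
  | .reg r, _ => r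
  | _, t => t

/-- Evaluates the expression into `x`, with intermediate values in the registers from `t` on. -/
def code : Expr → ℕ → ℕ → Prog
  | .reg _, _, _ => .skip
  | .lit c, x, _ => .const x c
  | .op o a b, x, t =>
      .seq (a.code t (t + 1)) (.seq (b.code (t + 1) (t + 2)) (.op o x (a.loc t) (b.loc (t + 1))))
  | .load a, x, t => .seq (a.code t (t + 1)) (.load x (a.loc t))

@[simp] theorem eval_reg (σ r) : (Expr.reg r).eval σ = σ.reg r := rfl
@[simp] theorem eval_lit (σ c) : (Expr.lit c).eval σ = c := rfl
@[simp] theorem eval_load (σ a) : (Expr.load a).eval σ = σ.mem (a.eval σ) := rfl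
@[simp] theorem eval_add (σ a b) : (a + b : Expr).eval σ = a.eval σ + b.eval σ := rfl
@[simp] theorem eval_sub (σ a b) : (a - b : Expr).eval σ = a.eval σ - b.eval σ := rfl
@[simp] theorem eval_mul (σ a b) : (a * b : Expr).eval σ = a.eval σ * b.eval σ := rfl
@[simp] theorem eval_div (σ a b) : (a / b : Expr).eval σ = a.eval σ / b.eval σ := rfl
@[simp] theorem eval_mod (σ a b) : (a % b : Expr).eval σ = a.eval σ % b.eval σ := rfl
@[simp] theorem eval_shl (σ a b) :
    (Expr.op .shl a b).eval σ = a.eval σ <<< b.eval σ := rfl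

@[simp] theorem fits_reg (w σ r) : (Expr.reg r).Fits w σ := trivial
@[simp] theorem fits_lit (w σ c) : (Expr.lit c).Fits w σ ↔ c < 2 ^ w := Iff.rfl
@[simp] theorem fits_load (w σ a) : (Expr.load a).Fits w σ ↔ a.Fits w σ := Iff.rfl
@[simp] theorem fits_add (w σ a b) : (a + b : Expr).Fits w σ ↔
    a.Fits w σ ∧ b.Fits w σ ∧ a.eval σ + b.eval σ < 2 ^ w := Iff.rfl
@[simp] theorem fits_sub (w σ a b) : (a - b : Expr).Fits w σ ↔
    a.Fits w σ ∧ b.Fits w σ ∧ a.eval σ - b.eval σ < 2 ^ w := Iff.rfl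
@[simp] theorem fits_mul (w σ a b) : (a * b : Expr).Fits w σ ↔
    a.Fits w σ ∧ b.Fits w σ ∧ a.eval σ * b.eval σ < 2 ^ w := Iff.rfl
@[simp] theorem fits_div (w σ a b) : (a / b : Expr).Fits w σ ↔
    a.Fits w σ ∧ b.Fits w σ ∧ a.eval σ / b.eval σ < 2 ^ w := Iff.rfl
@[simp] theorem fits_mod (w σ a b) : (a % b : Expr).Fits w σ ↔
    a.Fits w σ ∧ b.Fits w σ ∧ a.eval σ % b.eval σ < 2 ^ w := Iff.rfl
@[simp] theorem fits_shl (w σ a b) : (Expr.op .shl a b).Fits w σ ↔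
    a.Fits w σ ∧ b.Fits w σ ∧ a.eval σ <<< b.eval σ < 2 ^ w := Iff.rfl

@[simp] theorem size_reg (r) : (Expr.reg r).size = 1 := rfl
@[simp] theorem size_lit (c) : (Expr.lit c).size = 1 := rfl
@[simp] theorem size_load (a) : (Expr.load a).size = a.size + 1 := rfl
@[simp] theorem size_op (o a b) : (Expr.op o a b).size = a.size + b.size + 1 := rfl
@[simp] theorem size_add (a b : Expr) : (a + b).size = a.size + b.size + 1 := rfl
@[simp] theorem size_sub (a b : Expr) : (a - b).size = a.size + b.size + 1 := rfl
@[simp] theorem size_mul (a b : Expr) : (a * b).size = a.size + b.size + 1 := rfl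
@[simp] theorem size_div (a b : Expr) : (a / b).size = a.size + b.size + 1 := rfl
@[simp] theorem size_mod (a b : Expr) : (a % b).size = a.size + b.size + 1 := rfl

@[simp] theorem below_reg (t r) : (Expr.reg r).Below t ↔ r < t := Iff.rfl
@[simp] theorem below_lit (t c) : (Expr.lit c).Below t := trivial
@[simp] theorem below_load (t a) : (Expr.load a).Below t ↔ a.Below t := Iff.rfl
@[simp] theorem below_op (t o a b) : (Expr.op o a b).Below t ↔ a.Below t ∧ b.Below t := Iff.rfl
@[simp] theorem below_add (t) (a b : Expr) : (a + b).Below t ↔ a.Below t ∧ b.Below t := Iff.rfl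
@[simp] theorem below_sub (t) (a b : Expr) : (a - b).Below t ↔ a.Below t ∧ b.Below t := Iff.rfl
@[simp] theorem below_mul (t) (a b : Expr) : (a * b).Below t ↔ a.Below t ∧ b.Below t := Iff.rfl
@[simp] theorem below_div (t) (a b : Expr) : (a / b).Below t ↔ a.Below t ∧ b.Below t := Iff.rfl
@[simp] theorem below_mod (t) (a b : Expr) : (a % b).Below t ↔ a.Below t ∧ b.Below t := Iff.rfl

theorem Below.mono {t t' : ℕ} (h : t ≤ t') : ∀ {e : Expr}, e.Below t → e.Below t'
  | .reg _, he => lt_of_lt_of_le he h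
  | .lit _, _ => trivial
  | .op _ _ _, he => ⟨Below.mono h he.1, Below.mono h he.2⟩
  | .load a, he => Below.mono (e := a) h he

theorem eval_congr {σ σ' : State} {t : ℕ} (hm : σ'.mem = σ.mem)
    (hr : ∀ r < t, σ'.reg r = σ.reg r) : ∀ {e : Expr}, e.Below t → e.eval σ' = e.eval σ
  | .reg r, he => hr r he
  | .lit _, _ => rfl
  | .op o a b, he => by
      simp only [eval, eval_congr hm hr he.1, eval_congr hm hr he.2]
  | .load a, he => by
      simp only [eval, hm, eval_congr (e := a) hm hr he]

theorem fits_congr {w : ℕ} {σ σ' : State} {t : ℕ} (hm : σ'.mem = σ.mem)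
    (hr : ∀ r < t, σ'.reg r = σ.reg r) : ∀ {e : Expr}, e.Below t → (e.Fits w σ' ↔ e.Fits w σ)
  | .reg r, he => Iff.rfl
  | .lit _, _ => Iff.rfl
  | .op o a b, he => by
      simp only [Fits, fits_congr hm hr he.1, fits_congr hm hr he.2, eval_congr hm hr he.1,
        eval_congr hm hr he.2]
  | .load a, he => by
      simp only [Fits, fits_congr (e := a) hm hr he]

/-- Temporaries are handed out in increasing order, so the second operand cannot overwrite the value
of the first; the target `x` is written last and may therefore occur in the expression itself. The
value is found at `loc`, not always at `x`, since a bare register is left where it is. -/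
theorem exec_code {w : ℕ} : ∀ (e : Expr) (x t : ℕ) (σ : State), e.Below t → e.Fits w σ →
    ∃ σ', Exec w (e.code x t) σ e.size σ' ∧ σ'.mem = σ.mem ∧
      (∀ r < t, r ≠ x → σ'.reg r = σ.reg r) ∧ σ'.reg (e.loc x) = e.eval σ
  | .reg r, x, t, σ, _, _ => ⟨σ, .skip σ, rfl, fun _ _ _ => rfl, rfl⟩
  | .lit c, x, t, σ, _, hf => ⟨_, .const x c σ hf, rfl, fun r _ h => by simp [h], by
      simp [loc, eval]⟩
  | .op o a b, x, t, σ, hb, hf => by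
      obtain ⟨σ₁, h₁, m₁, r₁, v₁⟩ := exec_code a t (t + 1) σ (hb.1.mono (by omega)) hf.1
      have r₁' : ∀ r < t, σ₁.reg r = σ.reg r := fun r hr => r₁ r (by omega) (by omega)
      obtain ⟨σ₂, h₂, m₂, r₂, v₂⟩ := exec_code b (t + 1) (t + 2) σ₁ (hb.2.mono (by omega))
        ((fits_congr m₁ r₁' hb.2).2 hf.2.1)
      rw [eval_congr m₁ r₁' hb.2] at v₂
      -- Whether the first operand stays in its own register below `t` or was put into `t`, the code
      -- of the second one preserves it.
      have hla : a.loc t < t + 1 := by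
        cases a
        case reg r => exact lt_trans hb.1 (Nat.lt_succ_self t)
        all_goals exact Nat.lt_succ_self t
      have v₁' : σ₂.reg (a.loc t) = a.eval σ := by
        rw [r₂ _ (by omega) (by omega), v₁]
      refine ⟨σ₂.setReg x (o.eval (a.eval σ) (b.eval σ)), ?_, ?_, ?_, ?_⟩
      · have h₃ := Exec.op (w := w) o x (a.loc t) (b.loc (t + 1)) σ₂ (by rw [v₁', v₂]; exact hf.2.2)
        rw [v₁', v₂] at h₃
        have := h₁.seq (h₂.seq h₃)
        rwa [← add_assoc] at this
      · simp [m₁, m₂]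
      · intro r hr hx
        simp only [State.setReg_reg, hx, if_false]
        rw [r₂ r (by omega) (by omega), r₁ r (by omega) (by omega)]
      · simp [loc, eval]
  | .load a, x, t, σ, hb, hf => by
      obtain ⟨σ₁, h₁, m₁, r₁, v₁⟩ := exec_code a t (t + 1) σ (Below.mono (e := a) (by omega) hb) hf
      refine ⟨σ₁.setReg x (σ₁.mem (σ₁.reg (a.loc t))), h₁.seq (.load x (a.loc t) σ₁), ?_, ?_, ?_⟩
      · simp [m₁]
      · intro r hr hx
        simp only [State.setReg_reg, hx, if_false]
        exact r₁ r (by omega) (by omega)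
      · simp [show (Expr.load a).loc x = x from rfl, eval, m₁, v₁]

end Expr

end Expressions

/-! ### Total correctness with time bounds -/

section Logic

/-- `x := e` -/
def assign (x : ℕ) (e : Expr) : Prog := e.code x 32

/-- `mem[a] := e` -/
def put (a e : Expr) : Prog :=
  .seq (a.code 32 33) (.seq (e.code 33 34) (.store (a.loc 32) (e.loc 33)))

/-- run `p` if the value of `e` is nonzero, and `q` otherwise -/
def cond (e : Expr) (p q : Prog) : Prog := .seq (e.code 32 33) (.ite (e.loc 32) p q)

/-- `for i = 0, …, n - 1 do p`, where `n` is a register -/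
def forUpTo (i n : ℕ) (p : Prog) : Prog :=
  .seq (.const i 0) (.seq (.op .sub 32 n i) (.loop 32
    (.seq p (.seq (assign i (.reg i + .lit 1)) (.op .sub 32 n i)))))

/-- The states agree on memory and variables. -/
def State.Sim (σ τ : State) : Prop := σ.mem = τ.mem ∧ ∀ r < 32, σ.reg r = τ.reg r

/-- Started in any state that agrees with `τ` on memory and variables, the program halts after at
most `T` steps, in a state that agrees with one satisfying `Q`. -/
def Run (w : ℕ) (p : Prog) (τ : State) (T : ℕ) (Q : State → Prop) : Prop :=
  ∀ σ : State, σ.Sim τ → ∃ (t : ℕ) (σ' τ' : State), Exec w p σ t σ' ∧ t ≤ T ∧ σ'.Sim τ' ∧ Q τ'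

variable {w : ℕ} {p q : Prog} {τ : State} {T T' T₁ T₂ : ℕ} {Q Q' : State → Prop}

theorem Run.mono (h : Run w p τ T Q) (hT : T ≤ T') (hQ : ∀ τ', Q τ' → Q' τ') :
    Run w p τ T' Q' := by
  intro σ hσ
  obtain ⟨t, σ', τ', h₁, h₂, h₃, h₄⟩ := h σ hσ
  exact ⟨t, σ', τ', h₁, h₂.trans hT, h₃, hQ _ h₄⟩

theorem Run.time (h : Run w p τ T Q) (hT : T ≤ T') : Run w p τ T' Q := h.mono hT fun _ h => h

theorem Run.post (h : Run w p τ T Q) (hQ : ∀ τ', Q τ' → Q' τ') : Run w p τ T Q' :=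
  h.mono le_rfl hQ

/-- Variables that the program does not assign to keep their values. -/
theorem Run.framed (h : Run w p τ T Q) :
    Run w p τ T fun τ' => Q τ' ∧ ∀ r < 32, p.writes r = false → τ'.reg r = τ.reg r := by
  intro σ hσ
  obtain ⟨t, σ', τ', h₁, h₂, h₃, h₄⟩ := h σ hσ
  exact ⟨t, σ', τ', h₁, h₂, h₃, h₄, fun r hr hp => by
    rw [← h₃.2 r hr, h₁.frame r hp, hσ.2 r hr]⟩

/-- The postcondition of the first program is the correctness of the second one with the remaining
time, so that a proof follows the text of the program while the budget shrinks. -/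
theorem Run.seq (T₁ : ℕ) (h : Run w p τ T₁ fun τ' => Run w q τ' (T - T₁) Q)
    (hT : T₁ ≤ T := by first | omega | (simp; done) | (simp; omega) | (simp; ring_nf; omega)) : Run w (.seq p q) τ T Q := by
  intro σ hσ
  obtain ⟨t₁, σ₁, τ₁, h₁, h₂, h₃, h₄⟩ := h σ hσ
  obtain ⟨t₂, σ₂, τ₂, h₅, h₆, h₇, h₈⟩ := h₄ σ₁ h₃
  exact ⟨t₁ + t₂, σ₂, τ₂, h₁.seq h₅, by omega, h₇, h₈⟩

/-- For subprograms with a specification of their own: it need not mention the variables that stay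
unchanged, because the frame condition is supplied here. -/
theorem Run.call (T₁ : ℕ) {Q₁ : State → Prop} (h : Run w p τ T₁ Q₁)
    (hq : ∀ τ', Q₁ τ' → (∀ r < 32, p.writes r = false → τ'.reg r = τ.reg r) →
      Run w q τ' (T - T₁) Q)
    (hT : T₁ ≤ T := by first | omega | (simp; done) | (simp; omega) | (simp; ring_nf; omega)) : Run w (.seq p q) τ T Q :=
  .seq T₁ (h.framed.post fun τ' hτ' => hq τ' hτ'.1 hτ'.2) hT

theorem Run.conseq (T₁ : ℕ) {Q₁ : State → Prop} (h : Run w p τ T₁ Q₁)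
    (hQ : ∀ τ', Q₁ τ' → (∀ r < 32, p.writes r = false → τ'.reg r = τ.reg r) → Q τ')
    (hT : T₁ ≤ T := by first | omega | (simp; done) | (simp; omega) | (simp; ring_nf; omega)) : Run w p τ T Q :=
  h.framed.mono hT fun τ' hτ' => hQ τ' hτ'.1 hτ'.2

theorem Run.skip (h : Q τ) (hT : 1 ≤ T := by first | omega | (simp; done) | (simp; omega) | (simp; ring_nf; omega)) : Run w .skip τ T Q :=
  fun σ hσ => ⟨1, σ, τ, .skip σ, hT, hσ, h⟩

/-- Bare registers are excluded, since no code is generated for them; this is why copies between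
registers appear as sums with `.lit 0` in the programs. -/
theorem Run.assign {x : ℕ} {e : Expr} (v : ℕ) (hv : e.eval τ = v) (hf : e.Fits w τ)
    (h : Q (τ.setReg x v)) (he : e.isReg = false := by rfl)
    (hb : e.Below 32 := by simp)
    (hT : e.size ≤ T := by first | omega | (simp; done) | (simp; omega) | (simp; ring_nf; omega)) :
    Run w (assign x e) τ T Q := by
  intro σ hσ
  obtain ⟨σ', h₁, h₂, h₃, h₄⟩ := Expr.exec_code e x 32 σ hb
    ((Expr.fits_congr hσ.1 hσ.2 hb).2 hf)
  refine ⟨e.size, σ', τ.setReg x v, h₁, hT, ⟨by simp [h₂, hσ.1], fun r hr => ?_⟩, h⟩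
  by_cases hx : r = x
  · subst hx
    have : e.loc r = r := by cases e <;> first | rfl | cases he
    rw [this] at h₄
    simp [h₄, Expr.eval_congr hσ.1 hσ.2 hb, hv]
  · simp [hx, h₃ r hr hx, hσ.2 r hr]

theorem Run.assign_seq {x : ℕ} {e : Expr} (v : ℕ) (hv : e.eval τ = v) (hf : e.Fits w τ)
    (h : Run w q (τ.setReg x v) (T - e.size) Q) (he : e.isReg = false := by rfl)
    (hb : e.Below 32 := by simp)
    (hT : e.size ≤ T := by first | omega | (simp; done) | (simp; omega) | (simp; ring_nf; omega)) :
    Run w (.seq (STDiam.assign x e) q) τ T Q :=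
  .seq e.size (.assign v hv hf h he hb le_rfl) hT

theorem Run.put {a e : Expr} (x v : ℕ) (hx : a.eval τ = x) (hv : e.eval τ = v)
    (hfa : a.Fits w τ) (hfe : e.Fits w τ) (h : Q (τ.setMem x v))
    (hba : a.Below 32 := by simp)
    (hbe : e.Below 32 := by simp) (hT : a.size + e.size + 1 ≤ T := by first | omega | (simp; done) | (simp; omega) | (simp; ring_nf; omega)) :
    Run w (put a e) τ T Q := by
  intro σ hσ
  obtain ⟨σ₁, h₁, m₁, r₁, v₁⟩ := Expr.exec_code a 32 33 σ (hba.mono (by norm_num))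
    ((Expr.fits_congr hσ.1 hσ.2 hba).2 hfa)
  have r₁' : ∀ r < 32, σ₁.reg r = τ.reg r := fun r hr => by
    rw [r₁ r (by omega) (by omega), hσ.2 r hr]
  have m₁' : σ₁.mem = τ.mem := m₁.trans hσ.1
  obtain ⟨σ₂, h₂, m₂, r₂, v₂⟩ := Expr.exec_code e 33 34 σ₁ (hbe.mono (by norm_num))
    ((Expr.fits_congr m₁' r₁' hbe).2 hfe)
  have hla : a.loc 32 < 33 := by
    cases a
    case reg r => exact lt_trans hba (by norm_num)
    all_goals exact Nat.lt_succ_self 32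
  have e₁ : σ₂.reg (a.loc 32) = x := by
    rw [r₂ _ (by omega) (by omega), v₁, Expr.eval_congr hσ.1 hσ.2 hba, hx]
  have e₂ : σ₂.reg (e.loc 33) = v := by
    rw [v₂, Expr.eval_congr m₁' r₁' hbe, hv]
  have h₃ := Exec.store (w := w) (a.loc 32) (e.loc 33) σ₂
  rw [e₁, e₂] at h₃
  refine ⟨_, _, τ.setMem x v, h₁.seq (h₂.seq h₃), by omega, ⟨?_, fun r hr => ?_⟩, h⟩
  · funext y
    simp [m₂, m₁']
  · simp [r₂ r (by omega) (by omega), r₁' r hr]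

theorem Run.put_seq {a e : Expr} (x v : ℕ) (hx : a.eval τ = x) (hv : e.eval τ = v)
    (hfa : a.Fits w τ) (hfe : e.Fits w τ)
    (h : Run w q (τ.setMem x v) (T - (a.size + e.size + 1)) Q)
    (hba : a.Below 32 := by simp)
    (hbe : e.Below 32 := by simp) (hT : a.size + e.size + 1 ≤ T := by first | omega | (simp; done) | (simp; omega) | (simp; ring_nf; omega)) :
    Run w (.seq (STDiam.put a e) q) τ T Q :=
  .seq (a.size + e.size + 1) (.put x v hx hv hfa hfe h hba hbe le_rfl) hT

theorem Run.cond {e : Expr} (hf : e.Fits w τ)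
    (hp : e.eval τ ≠ 0 → Run w p τ (T - (e.size + 1)) Q)
    (hq : e.eval τ = 0 → Run w q τ (T - (e.size + 1)) Q) (hb : e.Below 32 := by simp)
   
    (hT : e.size + 1 ≤ T := by first | omega | (simp; done) | (simp; omega) | (simp; ring_nf; omega)) :
    Run w (cond e p q) τ T Q := by
  intro σ hσ
  obtain ⟨σ₁, h₁, m₁, r₁, v₁⟩ := Expr.exec_code e 32 33 σ (hb.mono (by norm_num))
    ((Expr.fits_congr hσ.1 hσ.2 hb).2 hf)
  rw [Expr.eval_congr hσ.1 hσ.2 hb] at v₁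
  have hs : σ₁.Sim τ := ⟨m₁.trans hσ.1, fun r hr => by
    rw [r₁ r (by omega) (by omega), hσ.2 r hr]⟩
  by_cases h0 : e.eval τ = 0
  · obtain ⟨t, σ', τ', h₂, h₃, h₄, h₅⟩ := hq h0 σ₁ hs
    exact ⟨_, σ', τ', h₁.seq (.ite_false (v₁.trans h0) h₂), by omega, h₄, h₅⟩
  · obtain ⟨t, σ', τ', h₂, h₃, h₄, h₅⟩ := hp h0 σ₁ hs
    exact ⟨_, σ', τ', h₁.seq (.ite_true (by rwa [v₁]) h₂), by omega, h₄, h₅⟩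

/-- The invariant rule for `for`-loops. -/
theorem Run.forUpTo {i n : ℕ} (I : ℕ → State → Prop) (m T : ℕ) (hm : τ.reg n = m) (hmw : m < 2 ^ w)
    (h0 : I 0 (τ.setReg i 0))
    (hs : ∀ j < m, ∀ σ : State, I j σ → σ.reg i = j →
      (∀ r < 32, r ≠ i → p.writes r = false → σ.reg r = τ.reg r) →
      Run w p σ T fun σ' => I (j + 1) (σ'.setReg i (j + 1)))
    (hQ : ∀ σ : State, I m σ → σ.reg i = m →
      (∀ r < 32, r ≠ i → p.writes r = false → σ.reg r = τ.reg r) → Q σ)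
    (hi : i < 32 := by norm_num) (hn : n < 32 := by norm_num) (hin : n ≠ i := by norm_num)
    (hpi : p.writes i = false := by rfl) (hpn : p.writes n = false := by rfl)
    (hT : m * (T + 5) + 3 ≤ T' := by first | omega | (simp; done) | (simp; omega) | (simp; ring_nf; omega)) :
    Run w (forUpTo i n p) τ T' Q := by
  -- Induction on the number `c` of remaining rounds. Register `32` holds `m - j` and serves as loop
  -- test; each round costs five steps besides the body: three for the increment, one for the
  -- subtraction, one for the test.
  have key : ∀ c j : ℕ, j + c = m → ∀ σ τ' : State, σ.Sim τ' → I j τ' → τ'.reg i = j →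
      (∀ r < 32, r ≠ i → p.writes r = false → τ'.reg r = τ.reg r) → σ.reg 32 = m - j →
      ∃ (t : ℕ) (σ' τ'' : State), Exec w (.loop 32 (.seq p (.seq (STDiam.assign i
        (.reg i + .lit 1)) (.op .sub 32 n i)))) σ t σ' ∧ t ≤ c * (T + 5) + 1 ∧ σ'.Sim τ'' ∧ Q τ'' := by
    intro c
    induction c with
    | zero =>
      intro j hj σ τ' hσ hI hτi hfr h32
      obtain rfl : j = m := by omega
      exact ⟨1, σ, τ', .loop_done (by omega), by omega, hσ, hQ _ hI hτi hfr⟩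
    | succ c ih =>
      intro j hj σ τ' hσ hI hτi hfr h32
      obtain ⟨t₁, σ₁, τ₁, e₁, b₁, s₁, I₁, f₁⟩ :=
        (hs j (by omega) τ' hI hτi hfr).framed σ hσ
      have hone : 1 < 2 ^ w := by omega
      have hj1 : j + 1 < 2 ^ w := by omega
      have hi₁ : τ₁.reg i = j := by rw [f₁ i hi hpi, hτi]
      obtain ⟨t₂, σ₂, τ₂, e₂, b₂, s₂, rfl⟩ := Run.assign (w := w) (τ := τ₁) (x := i)
        (e := .reg i + .lit 1) (Q := fun τ' => τ' = τ₁.setReg i (j + 1)) (j + 1) (by simp [hi₁])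
        (by simp [hi₁, hone, hj1]) rfl rfl ⟨hi, trivial⟩ le_rfl σ₁ s₁
      have hn₂ : (τ₁.setReg i (j + 1)).reg n = m := by
        simp only [State.setReg_reg, hin, if_false]
        rw [f₁ n hn hpn, hfr n hn hin hpn, hm]
      have hi₂ : (τ₁.setReg i (j + 1)).reg i = j + 1 := by simp
      have v₃ : (Op.sub).eval (σ₂.reg n) (σ₂.reg i) = m - (j + 1) := by
        simp only [Op.eval, s₂.2 n hn, s₂.2 i hi, hn₂, hi₂]
      have e₃ := Exec.op (w := w) .sub 32 n i σ₂ (by rw [v₃]; omega)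
      rw [v₃] at e₃
      obtain ⟨t₄, σ₄, τ₄, e₄, b₄, s₄, q₄⟩ := ih (j + 1) (by omega)
        (σ₂.setReg 32 (m - (j + 1))) (τ₁.setReg i (j + 1))
        ⟨by simp [s₂.1], fun r hr => by
          have : r ≠ 32 := by omega
          rw [State.setReg_reg, if_neg this, s₂.2 r hr]⟩ I₁ hi₂
        (fun r hr hri hp => by
          rw [State.setReg_reg, if_neg hri, f₁ r hr hp, hfr r hr hri hp])
        (by simp)
      refine ⟨_, σ₄, τ₄, .loop_step (by omega) (e₁.seq (e₂.seq e₃)) e₄, ?_, s₄, q₄⟩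
      have : (Expr.reg i + Expr.lit 1).size = 3 := rfl
      rw [this] at b₂
      have : (c + 1) * (T + 5) = c * (T + 5) + (T + 5) := by ring
      omega
  intro σ hσ
  have hw0 : 0 < 2 ^ w := by positivity
  have e₁ := Exec.const (w := w) i 0 σ hw0
  have v₂ : (Op.sub).eval ((σ.setReg i 0).reg n) ((σ.setReg i 0).reg i) = m := by
    simp [Op.eval, hin, hσ.2 n hn, hm]
  have e₂ := Exec.op (w := w) .sub 32 n i (σ.setReg i 0) (by rw [v₂]; exact hmw)
  rw [v₂] at e₂
  obtain ⟨t, σ', τ', e₃, b₃, s₃, q₃⟩ := key m 0 (by omega) ((σ.setReg i 0).setReg 32 m)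
    (τ.setReg i 0) ⟨by simp [hσ.1], fun r hr => by
      have : r ≠ 32 := by omega
      simp [this, hσ.2 r hr]⟩ h0 (by simp) (fun r _ hri _ => by simp [hri]) (by simp)
  exact ⟨_, σ', τ', e₁.seq (e₂.seq e₃), by omega, s₃, q₃⟩

end Logic

end STDiam

namespace STDiam

/-! ### Distances in layered graphs -/

section Distance

variable {V : Type*} {G : SimpleGraph V}

/-- A potential that rises by at most one along each edge bounds distances from below; this is the
lower half of `Tables.IsRetraction.edist_eq`. -/
theorem le_add_edist_of_layer {layer : V → ℕ} (h : ∀ u v, G.Adj u v → layer v ≤ layer u + 1)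
    (u v : V) : (layer v : ℕ∞) ≤ layer u + G.edist u v := by
  by_cases hr : G.edist u v = ⊤
  · simp [hr]
  · obtain ⟨p, hp⟩ := SimpleGraph.exists_walk_of_edist_ne_top hr
    rw [← hp]
    clear hp hr
    induction p with
    | nil => simp
    | cons hadj p ih =>
      have := h _ _ hadj
      rw [SimpleGraph.Walk.length_cons]
      norm_cast at ih ⊢
      omega

theorem edist_le_of_adj_chain (f : ℕ → V) (m : ℕ) (h : ∀ i < m, G.Adj (f i) (f (i + 1))) :
    G.edist (f 0) (f m) ≤ m := by
  induction m with
  | zero => simp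
  | succ m ih =>
    have h₁ := ih fun i hi => h i (by omega)
    have h₂ : G.edist (f m) (f (m + 1)) = 1 := SimpleGraph.edist_eq_one_iff_adj.2 (h m (by omega))
    calc _ ≤ G.edist (f 0) (f m) + G.edist (f m) (f (m + 1)) := G.edist_triangle
      _ ≤ m + 1 := by rw [h₂]; gcongr
      _ = _ := by norm_cast

/-- A graph with layers `0, …, K + 1`.  Vertices carry digits of two kinds; a vertex in layer `i` has
the `aD`-digits `r` with `i ≤ r < K` and the `bD`-digits `r` with `r + 2 ≤ i`, which are preserved
along edges as far as both ends have them.  The label `X` is constant on the inner layers, and the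
digits of the ends of an inner segment satisfy the constraints given by its label. -/
structure IsDigitLayered {ι : Type*} (G : SimpleGraph V) (K : ℕ) (layer : V → ℕ)
    (aD bD : V → ℕ → ℕ) (X : V → ι) (one : ι → ℕ → ℕ → ℕ → Prop) (E : V → V → Prop) : Prop where
  adj : ∀ u v, G.Adj u v → E u v ∨ E v u
  layer_le : ∀ v, layer v ≤ K + 1
  layer_succ : ∀ u v, E u v → layer v = layer u + 1
  aD_eq : ∀ u v, E u v → ∀ r < K, layer v ≤ r → aD u r = aD v r
  bD_eq : ∀ u v, E u v → ∀ r, r + 2 ≤ layer u → bD u r = bD v r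
  X_eq : ∀ u v, E u v → 1 ≤ layer u → layer v ≤ K → X u = X v
  one_aD : ∀ u v, E u v → layer u = 0 → ∀ r < K, ∀ m ≤ r, one (X v) m (K - 1 - r) (aD u r)
  one_bD : ∀ u v, E u v → layer v = K + 1 → ∀ r m, r ≤ m → m < K → one (X u) m (K - r) (bD v r)

variable {ι : Type*} {K : ℕ} {layer : V → ℕ} {aD bD : V → ℕ → ℕ} {X : V → ι}
  {one : ι → ℕ → ℕ → ℕ → Prop} {E : V → V → Prop}

/-- A condition that holds at the end of all walks of length `l` from a vertex of the first layer
whose digits from `s` on are those of `a`. -/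
def NearSource (K : ℕ) (layer : V → ℕ) (aD : V → ℕ → ℕ) (a : ℕ → ℕ) (s : ℕ) (v : V) (l : ℕ) : Prop :=
  layer v ≤ l ∧ ∃ u, 2 * u ≤ l + layer v + 2 * s ∧
    ∀ r < K, u ≤ r → layer v ≤ r → aD v r = a (K - 1 - r)

/-- A condition that holds at the start of all walks of length `l` to a vertex of the last layer
whose digits `r` with `r + s < K` are those of `a`. -/
def NearTarget (K : ℕ) (layer : V → ℕ) (bD : V → ℕ → ℕ) (a : ℕ → ℕ) (s : ℕ) (v : V) (l : ℕ) : Prop :=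
  K + 1 ≤ l + layer v ∧ ∃ u, 2 * u + layer v ≤ l + (K + 1) + 2 * s ∧
    ∀ r, r + u < K → r + 2 ≤ layer v → bD v r = a (K - r)

/-- The threshold `u` records the highest layer from which the walk has come back down. Reaching
layer M takes M steps and returning from it M - `layer v` more, so 2M is at most `l + layer v`; the
term `2 * s` allows for the `s` digits that were arbitrary from the beginning. -/
theorem IsDigitLayered.nearSource_step (h : IsDigitLayered G K layer aD bD X one E)
    {a : ℕ → ℕ} {s : ℕ} {v w : V} {l : ℕ} (hv : NearSource K layer aD a s v l)
    (hvw : G.Adj v w) : NearSource K layer aD a s w (l + 1) := by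
  obtain ⟨h₁, u, h₂, h₃⟩ := hv
  rcases h.adj v w hvw with hE | hE
  · have hl := h.layer_succ _ _ hE
    refine ⟨by omega, u, by omega, fun r hr hu hrl => ?_⟩
    rw [← h.aD_eq _ _ hE r hr hrl]
    exact h₃ r hr hu (by omega)
  · have hl := h.layer_succ _ _ hE
    -- Stepping down brings back the digit `r = layer w`, which may be a new one; the threshold
    -- moves above it, and `layer v ≤ l` pays for that.
    refine ⟨by omega, max u (layer v), by omega, fun r hr hu hrl => ?_⟩
    rw [h.aD_eq _ _ hE r hr (by omega)]
    exact h₃ r hr (by omega) (by omega)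

/-- The mirror image, with layers counted down from `K + 1`; the walk is extended at its start. -/
theorem IsDigitLayered.nearTarget_step (h : IsDigitLayered G K layer aD bD X one E)
    {a : ℕ → ℕ} {s : ℕ} {v w : V} {l : ℕ} (hw : NearTarget K layer bD a s w l)
    (hvw : G.Adj v w) : NearTarget K layer bD a s v (l + 1) := by
  obtain ⟨h₁, u, h₂, h₃⟩ := hw
  rcases h.adj v w hvw with hE | hE
  · have hl := h.layer_succ _ _ hE
    refine ⟨by omega, u, by omega, fun r hr hrl => ?_⟩
    rw [h.bD_eq _ _ hE r hrl]
    exact h₃ r hr (by omega)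
  · have hl := h.layer_succ _ _ hE
    have := h.layer_le v
    refine ⟨by omega, max u (K + 1 - layer w), by omega, fun r hr hrl => ?_⟩
    rw [← h.bD_eq _ _ hE r (by omega)]
    exact h₃ r (by omega) (by omega)

theorem IsDigitLayered.nearTarget_walk (h : IsDigitLayered G K layer aD bD X one E)
    {a : ℕ → ℕ} {s : ℕ} {v w : V} (p : G.Walk v w) (hw : layer w = K + 1)
    (ha : ∀ r, r + s < K → bD w r = a (K - r)) : NearTarget K layer bD a s v p.length := by
  induction p with
  | nil => exact ⟨by omega, s, by simp [hw, add_comm, add_left_comm], fun r hr _ => ha r hr⟩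
  | cons hadj p ih => exact h.nearTarget_step (ih hw ha) hadj

/-- The walk `p` is the rest of a walk that has already made `l` steps, and it is followed up to its
first arrival in layer `K + 1`. The hypothesis `hseg` remembers the last departure from layer 0:
from then on the label is fixed, the digits `r ≥ u` of `a` meet its constraints, and at least `layer
w` further steps have been made. The rest after the arrival is controlled by `nearTarget_walk`. -/
theorem IsDigitLayered.le_length (h : IsDigitLayered G K layer aD bD X one E)
    {a : ℕ → ℕ} (hsol : ∀ (x : ι), ∀ m < K, ∃ j ≤ K, ¬ one x m j (a j)) {s₁ s₂ : ℕ} {w z : V}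
    (p : G.Walk w z) (hz : layer z = K + 1) (hz' : ∀ r, r + s₂ < K → bD z r = a (K - r))
    (l : ℕ) (hw : layer w ≤ K) (hl : NearSource K layer aD a s₁ w l)
    (hseg : 1 ≤ layer w → ∃ u, 2 * u + layer w ≤ l + 2 * s₁ ∧
      ∀ r < K, u ≤ r → ∀ m ≤ r, one (X w) m (K - 1 - r) (a (K - 1 - r))) :
    3 * K + 1 ≤ l + p.length + 2 * s₁ + 2 * s₂ := by
  induction p generalizing l with
  | nil => omega
  | @cons w v z hadj p ih =>
    rw [SimpleGraph.Walk.length_cons]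
    have hl' := h.nearSource_step hl hadj
    have hstart : layer w = 0 → E w v → ∃ u, 2 * u ≤ l + 2 * s₁ ∧
        ∀ r < K, u ≤ r → ∀ m ≤ r, one (X v) m (K - 1 - r) (a (K - 1 - r)) := by
      intro h0 hE
      obtain ⟨-, u, h₂, h₃⟩ := hl
      refine ⟨u, by omega, fun r hr hu m hm => ?_⟩
      rw [← h₃ r hr hu (by omega)]
      exact h.one_aD _ _ hE h0 r hr m hm
    by_cases hv : layer v ≤ K
    · have := ih hz hz' (l + 1) hv hl' fun h1 => by
        rcases h.adj w v hadj with hE | hE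
        · have hs := h.layer_succ _ _ hE
          by_cases h0 : layer w = 0
          · obtain ⟨u, h₂, h₃⟩ := hstart h0 hE
            exact ⟨u, by omega, h₃⟩
          · obtain ⟨u, h₂, h₃⟩ := hseg (by omega)
            rw [← h.X_eq _ _ hE (by omega) hv]
            exact ⟨u, by omega, h₃⟩
        · have hs := h.layer_succ _ _ hE
          obtain ⟨u, h₂, h₃⟩ := hseg (by omega)
          rw [h.X_eq _ _ hE (by omega) (by omega)]
          exact ⟨u, by omega, h₃⟩
      omega
    · have hvK : layer v = K + 1 := le_antisymm (h.layer_le v) (by omega)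
      obtain ⟨-, u₂, h₅, h₆⟩ := h.nearTarget_walk p hz hz'
      rcases h.adj w v hadj with hE | hE
      · have hs := h.layer_succ _ _ hE
        by_cases hK : K = 0
        · subst hK
          omega
        · obtain ⟨u, h₂, h₃⟩ := hseg (by omega)
          -- Otherwise the entry number `u` of the label is met by all of `a`: by the lists `j < K -
          -- u` because of the digits seen when the first layer was left, and by the lists `j ≥ K -
          -- u` because of the digits seen on arrival. With `layer w = K` the thresholds then give
          -- the count: 2K for the outer parts, K + 1 for the segment.
          have : K ≤ u + u₂ := by
            by_contra hlt
            obtain ⟨j, hj, hj'⟩ := hsol (X w) u (by omega)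
            apply hj'
            by_cases hju : j + u + 1 ≤ K
            · have := h₃ (K - 1 - j) (by omega) (by omega) u (by omega)
              rwa [show K - 1 - (K - 1 - j) = j by omega] at this
            · have := h.one_bD _ _ hE hvK (K - j) u (by omega) (by omega)
              rw [h₆ (K - j) (by omega) (by omega)] at this
              rwa [show K - (K - j) = j by omega] at this
          omega
      · have hs := h.layer_succ _ _ hE
        omega

theorem IsDigitLayered.le_edist (h : IsDigitLayered G K layer aD bD X one E)
    {a : ℕ → ℕ} (hsol : ∀ (x : ι), ∀ m < K, ∃ j ≤ K, ¬ one x m j (a j)) {s₁ s₂ : ℕ} {w z : V}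
    (hw : layer w = 0) (hw' : ∀ r < K, s₁ ≤ r → aD w r = a (K - 1 - r))
    (hz : layer z = K + 1) (hz' : ∀ r, r + s₂ < K → bD z r = a (K - r)) :
    ((3 * K + 1 - 2 * s₁ - 2 * s₂ : ℕ) : ℕ∞) ≤ G.edist w z := by
  by_cases hr : G.edist w z = ⊤
  · simp [hr]
  · obtain ⟨p, hp⟩ := SimpleGraph.exists_walk_of_edist_ne_top hr
    rw [← hp]
    have := h.le_length (s₁ := s₁) hsol p hz hz' 0 (by omega) ⟨by omega, s₁, by omega,
      fun r hr hu _ => hw' r hr hu⟩ (fun h1 => by omega)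
    norm_cast
    omega

end Distance

/-! ### Digits -/

section Digits

variable {n : ℕ}

/-- The `r`-th digit of `e` in base `n`. -/
def dig (n r e : ℕ) : ℕ := e / n ^ r % n

/-- Removes the `r`-th digit. -/
def drop (n r e : ℕ) : ℕ := e / n ^ (r + 1) * n ^ r + e % n ^ r

/-- Inserts `c` as the `r`-th digit. -/
def insertDig (n r c e : ℕ) : ℕ := (e / n ^ r * n + c) * n ^ r + e % n ^ r

/-- Applies `f r` to the `r`-th digit, for all `r < K`. -/
def mapDig (n K : ℕ) (f : ℕ → ℕ → ℕ) (e : ℕ) : ℕ := ∑ r ∈ Finset.range K, f r (dig n r e) * n ^ r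

theorem mul_add_lt_mul {a b c m : ℕ} (ha : a < c) (hb : b < m) : a * m + b < c * m := by
  have : (a + 1) * m ≤ c * m := Nat.mul_le_mul_right _ ha
  rw [add_mul] at this
  omega

theorem dig_lt (hn : 0 < n) (r e : ℕ) : dig n r e < n := Nat.mod_lt _ hn

theorem dig_mod_pow {r j : ℕ} (h : j < r) (e : ℕ) : dig n j (e % n ^ r) = dig n j e := by
  obtain ⟨c, rfl⟩ : ∃ c, r = j + 1 + c := ⟨r - (j + 1), by omega⟩
  rw [dig, dig, pow_add, pow_succ, mul_assoc, Nat.mod_mul_right_div_self, Nat.mod_mul_right_mod]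

theorem dig_add_left {r j : ℕ} (h : j < r) (x y : ℕ) : dig n j (x * n ^ r + y) = dig n j y := by
  rw [← dig_mod_pow h, Nat.mul_add_mod_self_right, dig_mod_pow h]

theorem mul_pow_add_div (hn : 0 < n) (r x y : ℕ) (hy : y < n ^ r) : (x * n ^ r + y) / n ^ r = x := by
  rw [add_comm, Nat.add_mul_div_right _ _ (by positivity), Nat.div_eq_of_lt hy, zero_add]

theorem mul_pow_add_mod (r x y : ℕ) (hy : y < n ^ r) : (x * n ^ r + y) % n ^ r = y := by
  rw [Nat.mul_add_mod_self_right, Nat.mod_eq_of_lt hy]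

theorem dig_of_le {r j : ℕ} (h : r ≤ j) (e : ℕ) : dig n j e = dig n (j - r) (e / n ^ r) := by
  rw [dig, dig, Nat.div_div_eq_div_mul, ← pow_add, Nat.add_sub_cancel' h]

theorem drop_div (hn : 0 < n) (r e : ℕ) : drop n r e / n ^ r = e / n ^ (r + 1) :=
  mul_pow_add_div hn _ _ _ (Nat.mod_lt _ (by positivity))

theorem dig_drop_of_lt {r j : ℕ} (h : j < r) (e : ℕ) : dig n j (drop n r e) = dig n j e := by
  rw [drop, dig_add_left h, dig_mod_pow h]

theorem dig_drop_of_le (hn : 0 < n) {r j : ℕ} (h : r ≤ j) (e : ℕ) :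
    dig n j (drop n r e) = dig n (j + 1) e := by
  rw [dig_of_le h, drop_div hn, dig_of_le (show r + 1 ≤ j + 1 by omega)]
  congr 1
  omega

theorem drop_lt (hn : 0 < n) {K r e : ℕ} (hr : r < K) (he : e < n ^ K) :
    drop n r e < n ^ (K - 1) := by
  have h₁ : e / n ^ (r + 1) < n ^ (K - 1 - r) := by
    rw [Nat.div_lt_iff_lt_mul (by positivity), ← pow_add]
    rwa [show K - 1 - r + (r + 1) = K by omega]
  have h₂ : e % n ^ r < n ^ r := Nat.mod_lt _ (by positivity)
  have h₃ : n ^ (K - 1) = n ^ (K - 1 - r) * n ^ r := by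
    rw [← pow_add]; congr 1; omega
  rw [drop, h₃]
  exact mul_add_lt_mul h₁ h₂

theorem insertDig_div (hn : 0 < n) (r c e : ℕ) :
    insertDig n r c e / n ^ r = e / n ^ r * n + c :=
  mul_pow_add_div hn _ _ _ (Nat.mod_lt _ (by positivity))

theorem drop_insertDig (hn : 0 < n) {r c : ℕ} (hc : c < n) (e : ℕ) :
    drop n r (insertDig n r c e) = e := by
  have h₁ : insertDig n r c e / n ^ (r + 1) = e / n ^ r := by
    rw [pow_succ, ← Nat.div_div_eq_div_mul, insertDig_div hn, add_comm,
      Nat.add_mul_div_right _ _ hn, Nat.div_eq_of_lt hc, zero_add]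
  have h₂ : insertDig n r c e % n ^ r = e % n ^ r :=
    mul_pow_add_mod _ _ _ (Nat.mod_lt _ (by positivity))
  rw [drop, h₁, h₂]
  exact Nat.div_add_mod' e (n ^ r)

theorem dig_insertDig (hn : 0 < n) {r c : ℕ} (hc : c < n) (e : ℕ) :
    dig n r (insertDig n r c e) = c := by
  rw [dig, insertDig_div hn, Nat.mul_add_mod_self_right, Nat.mod_eq_of_lt hc]

theorem insertDig_lt (hn : 0 < n) {K r c e : ℕ} (hr : r < K) (hc : c < n) (he : e < n ^ (K - 1)) :
    insertDig n r c e < n ^ K := by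
  have h₁ : e / n ^ r < n ^ (K - 1 - r) := by
    rw [Nat.div_lt_iff_lt_mul (by positivity), ← pow_add]
    rwa [show K - 1 - r + r = K - 1 by omega]
  have h₂ : e % n ^ r < n ^ r := Nat.mod_lt _ (by positivity)
  have h₃ : n ^ K = n ^ (K - 1 - r) * n * n ^ r := by
    rw [← pow_succ, ← pow_add]; congr 1; omega
  have h₄ : e / n ^ r * n + c + 1 ≤ n ^ (K - 1 - r) * n := by nlinarith
  rw [insertDig, h₃]
  exact mul_add_lt_mul h₄ h₂

theorem sum_digits_lt {K : ℕ} {c : ℕ → ℕ} (hc : ∀ r < K, c r < n) :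
    ∑ r ∈ Finset.range K, c r * n ^ r < n ^ K := by
  induction K with
  | zero => simp
  | succ K ih =>
    rw [Finset.sum_range_succ, pow_succ]
    have h₁ := ih fun r hr => hc r (by omega)
    have h₂ : (c K + 1) * n ^ K ≤ n * n ^ K := Nat.mul_le_mul_right _ (hc K (by omega))
    nlinarith

theorem dig_sum {K : ℕ} {c : ℕ → ℕ} (hc : ∀ r < K, c r < n) {j : ℕ} (hj : j < K) :
    dig n j (∑ r ∈ Finset.range K, c r * n ^ r) = c j := by
  induction K with
  | zero => omega
  | succ K ih =>
    have hn : 0 < n := (Nat.zero_le _).trans_lt (hc K (by omega))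
    rw [Finset.sum_range_succ, add_comm]
    by_cases h : j = K
    · subst h
      rw [dig, mul_pow_add_div hn _ _ _ (sum_digits_lt fun r hr => hc r (by omega)),
        Nat.mod_eq_of_lt (hc _ (by omega))]
    · rw [dig_add_left (by omega)]
      exact ih (fun r hr => hc r (by omega)) (by omega)

theorem sum_dig {K e : ℕ} (he : e < n ^ K) :
    ∑ r ∈ Finset.range K, dig n r e * n ^ r = e := by
  have key : ∀ K, ∑ r ∈ Finset.range K, dig n r e * n ^ r = e % n ^ K := by
    intro K
    induction K with
    | zero => simp [Nat.mod_one]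
    | succ K ih =>
      rw [Finset.sum_range_succ, ih, dig, pow_succ, Nat.mod_mul]
      ring
  rw [key, Nat.mod_eq_of_lt he]

theorem eq_of_dig_eq {K e e' : ℕ} (he : e < n ^ K) (he' : e' < n ^ K)
    (h : ∀ r < K, dig n r e = dig n r e') : e = e' := by
  rw [← sum_dig he, ← sum_dig he']
  exact Finset.sum_congr rfl fun r hr => by rw [h r (Finset.mem_range.1 hr)]

theorem dig_top (hn : 0 < n) {K e : ℕ} (hK : 0 < K) (he : e < n ^ K) :
    dig n (K - 1) e = e / n ^ (K - 1) := by
  rw [dig, Nat.mod_eq_of_lt]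
  rw [Nat.div_lt_iff_lt_mul (by positivity), ← pow_succ']
  rwa [show K - 1 + 1 = K by omega]

end Digits

end STDiam

namespace STDiam

/-! ### The graph of the reduction -/

/-- The data from which the graph is built: the side length `n`, the number `K` of entries of a
tuple, the number `g` of coordinate arrays in use, and for each of them and each digit position a
map of the vectors to those satisfying the constraints, for both kinds of tuples. -/
structure Tables where
  n : ℕ
  K : ℕ
  g : ℕ
  A : ℕ → ℕ → ℕ → ℕ
  B : ℕ → ℕ → ℕ → ℕ

namespace Tables

variable (D : Tables)

/-- The number of vertices. -/
def order : ℕ := 2 * D.n ^ D.K + D.g * D.K * D.n ^ (D.K - 1)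

/-- The numbers below `2 * n ^ K` are the tuples of `S` and `T`; then come the inner vertices,
sorted by label, layer and entry. Every entry with `K - 1` digits is used, admissible or not. -/
def innerId (X i e : ℕ) : ℕ := 2 * D.n ^ D.K + (X * D.K + (i - 1)) * D.n ^ (D.K - 1) + e

/-- Avoids repeated edges. At the lowest level the upper end forgets digit 0 while the lower end
sees it only through the retraction, so numbers that differ in digit 0 may give the same edge; only
a fixed point is kept. The top level is treated likewise with digit `K - 1`. -/
def EdgeCond (X i e : ℕ) : Prop :=
  (i = 0 → D.A X 0 (e % D.n) = e % D.n) ∧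
    (i = D.K → D.B X (D.K - 1) (e / D.n ^ (D.K - 1)) = e / D.n ^ (D.K - 1))

instance (X i e : ℕ) : Decidable (D.EdgeCond X i e) := by unfold EdgeCond; infer_instance

/-- The edges of a level are named by numbers `e` with all `K` digits. An end in an inner layer
forgets the one digit that is missing there, and an end in `S` or `T` has all its digits retracted.
-/
def lowEnd (X i e : ℕ) : ℕ :=
  if i = 0 then mapDig D.n D.K (D.A X) e else D.innerId X i (drop D.n (i - 1) e)

def highEnd (X i e : ℕ) : ℕ :=
  if i = D.K then D.n ^ D.K + mapDig D.n D.K (D.B X) e else D.innerId X (i + 1) (drop D.n i e)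

def edgeAt (X i e : ℕ) : List (ℕ × ℕ) :=
  if D.EdgeCond X i e then [(D.lowEnd X i e, D.highEnd X i e)] else []

/-- The edges between the layers `i` and `i + 1` for a given coordinate array. -/
def levelEdges (X i : ℕ) : List (ℕ × ℕ) := (List.range (D.n ^ D.K)).flatMap (D.edgeAt X i)

def blockEdges (X : ℕ) : List (ℕ × ℕ) := (List.range (D.K + 1)).flatMap (D.levelEdges X)

def edges : List (ℕ × ℕ) := (List.range D.g).flatMap D.blockEdges

def layer (v : ℕ) : ℕ :=
  if v < D.n ^ D.K then 0 else if v < 2 * D.n ^ D.K then D.K + 1 else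
    (v - 2 * D.n ^ D.K) / D.n ^ (D.K - 1) % D.K + 1

def label (v : ℕ) : ℕ := (v - 2 * D.n ^ D.K) / D.n ^ (D.K - 1) / D.K

def entry (v : ℕ) : ℕ := (v - 2 * D.n ^ D.K) % D.n ^ (D.K - 1)

/-- In layer `i ≤ r` the digit `i - 1` has been removed, so the digit `r` is stored at position `r -
1`. The retraction is applied only on reading. -/
def digA (v r : ℕ) : ℕ :=
  if v < D.n ^ D.K then dig D.n r v else D.A (D.label v) r (dig D.n (r - 1) (D.entry v))

def digB (v r : ℕ) : ℕ :=
  if v < 2 * D.n ^ D.K then dig D.n r (v - D.n ^ D.K) else D.B (D.label v) r (dig D.n r (D.entry v))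

/-- The graph on `N` vertices; if `N` exceeds the order of the construction, then the additional
vertices are isolated. -/
def graph (N : ℕ) : SimpleGraph (Fin N) :=
  (SimpleGraph.fromRel fun u v : ℕ => (u, v) ∈ D.edges).comap Fin.val

/-- The maps in the tables are idempotent, and their values satisfy the constraints `one`. -/
structure IsRetraction (one : ℕ → ℕ → ℕ → ℕ → Prop) : Prop where
  n_pos : 0 < D.n
  K_pos : 0 < D.K
  A_lt : ∀ X < D.g, ∀ r < D.K, ∀ a < D.n, D.A X r a < D.n
  B_lt : ∀ X < D.g, ∀ r < D.K, ∀ a < D.n, D.B X r a < D.n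
  A_idem : ∀ X < D.g, ∀ r < D.K, ∀ a < D.n, D.A X r (D.A X r a) = D.A X r a
  B_idem : ∀ X < D.g, ∀ r < D.K, ∀ a < D.n, D.B X r (D.B X r a) = D.B X r a
  A_one : ∀ X < D.g, ∀ r < D.K, ∀ a < D.n, ∀ m ≤ r, one X m (D.K - 1 - r) (D.A X r a)
  B_one : ∀ X < D.g, ∀ r < D.K, ∀ a < D.n, ∀ m, r ≤ m → m < D.K → one X m (D.K - r) (D.B X r a)

variable {D}

theorem mem_edges {u v : ℕ} : (u, v) ∈ D.edges ↔ ∃ X < D.g, ∃ i ≤ D.K, ∃ e < D.n ^ D.K,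
    D.EdgeCond X i e ∧ u = D.lowEnd X i e ∧ v = D.highEnd X i e := by
  simp only [edges, blockEdges, levelEdges, edgeAt, List.mem_flatMap, List.mem_range,
    List.mem_ite_nil_right, List.mem_singleton, Prod.mk.injEq, Nat.lt_succ_iff]

theorem graph_adj {N : ℕ} {u v : Fin N} : (D.graph N).Adj u v ↔
    (u : ℕ) ≠ v ∧ (((u : ℕ), (v : ℕ)) ∈ D.edges ∨ ((v : ℕ), (u : ℕ)) ∈ D.edges) := by
  simp [graph]

namespace IsRetraction

variable {one : ℕ → ℕ → ℕ → ℕ → Prop} (h : D.IsRetraction one)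

include h

theorem pow_pos (j : ℕ) : 0 < D.n ^ j := Nat.pow_pos h.n_pos

theorem innerId_ge (X i e : ℕ) : 2 * D.n ^ D.K ≤ D.innerId X i e := by
  unfold innerId
  omega

theorem innerId_sub_div {X i e : ℕ} (he : e < D.n ^ (D.K - 1)) :
    (D.innerId X i e - 2 * D.n ^ D.K) / D.n ^ (D.K - 1) = X * D.K + (i - 1) := by
  rw [innerId, add_assoc, Nat.add_sub_cancel_left]
  exact mul_pow_add_div h.n_pos _ _ _ he

theorem layer_innerId {X i e : ℕ} (hi : 1 ≤ i) (hi' : i ≤ D.K) (he : e < D.n ^ (D.K - 1)) :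
    D.layer (D.innerId X i e) = i := by
  have := h.innerId_ge X i e
  have := h.pow_pos D.K
  rw [layer, if_neg (by omega), if_neg (by omega), h.innerId_sub_div he,
    Nat.mul_add_mod_self_right, Nat.mod_eq_of_lt (by omega)]
  omega

theorem label_innerId {X i e : ℕ} (hi : 1 ≤ i) (hi' : i ≤ D.K) (he : e < D.n ^ (D.K - 1)) :
    D.label (D.innerId X i e) = X := by
  rw [label, h.innerId_sub_div he, add_comm, Nat.add_mul_div_right _ _ h.K_pos,
    Nat.div_eq_of_lt (by omega), zero_add]

theorem entry_innerId {X i e : ℕ} (he : e < D.n ^ (D.K - 1)) :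
    D.entry (D.innerId X i e) = e := by
  rw [entry, innerId, add_assoc, Nat.add_sub_cancel_left]
  exact mul_pow_add_mod _ _ _ he

theorem innerId_lt {X i e : ℕ} (hX : X < D.g) (hi : 1 ≤ i) (hi' : i ≤ D.K)
    (he : e < D.n ^ (D.K - 1)) : D.innerId X i e < D.order := by
  have h₁ : X * D.K + (i - 1) < D.g * D.K := mul_add_lt_mul hX (by omega)
  have := mul_add_lt_mul h₁ he
  rw [innerId, order]
  omega

theorem exists_innerId {v : ℕ} (hv : v < D.order) (h₁ : 1 ≤ D.layer v) (h₂ : D.layer v ≤ D.K) :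
    ∃ X < D.g, ∃ e < D.n ^ (D.K - 1), v = D.innerId X (D.layer v) e := by
  have hp := h.pow_pos (D.K - 1)
  have hge : 2 * D.n ^ D.K ≤ v := by
    by_contra hlt
    unfold layer at h₁ h₂
    split_ifs at h₁ h₂ <;> omega
  have hl : D.layer v - 1 = (v - 2 * D.n ^ D.K) / D.n ^ (D.K - 1) % D.K := by
    rw [layer, if_neg (by have := h.pow_pos D.K; omega), if_neg (by omega)]
    omega
  refine ⟨D.label v, ?_, D.entry v, Nat.mod_lt _ hp, ?_⟩
  · rw [label, Nat.div_div_eq_div_mul, Nat.div_lt_iff_lt_mul (Nat.mul_pos hp h.K_pos)]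
    rw [order, mul_assoc] at hv
    rw [mul_comm (D.n ^ _)]
    omega
  · rw [innerId, hl, label, entry, Nat.div_add_mod', add_assoc, Nat.div_add_mod']
    omega

theorem mapDig_A_lt {X : ℕ} (hX : X < D.g) (e : ℕ) : mapDig D.n D.K (D.A X) e < D.n ^ D.K :=
  sum_digits_lt fun r hr => h.A_lt X hX r hr _ (dig_lt h.n_pos r e)

theorem mapDig_B_lt {X : ℕ} (hX : X < D.g) (e : ℕ) : mapDig D.n D.K (D.B X) e < D.n ^ D.K :=
  sum_digits_lt fun r hr => h.B_lt X hX r hr _ (dig_lt h.n_pos r e)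

theorem dig_mapDig_A {X r : ℕ} (hX : X < D.g) (hr : r < D.K) (e : ℕ) :
    dig D.n r (mapDig D.n D.K (D.A X) e) = D.A X r (dig D.n r e) :=
  dig_sum (fun r hr => h.A_lt X hX r hr _ (dig_lt h.n_pos r e)) hr

theorem dig_mapDig_B {X r : ℕ} (hX : X < D.g) (hr : r < D.K) (e : ℕ) :
    dig D.n r (mapDig D.n D.K (D.B X) e) = D.B X r (dig D.n r e) :=
  dig_sum (fun r hr => h.B_lt X hX r hr _ (dig_lt h.n_pos r e)) hr

variable {X i e : ℕ} (hX : X < D.g) (hi : i ≤ D.K) (he : e < D.n ^ D.K)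

include hX hi he

theorem layer_lowEnd : D.layer (D.lowEnd X i e) = i := by
  unfold lowEnd
  split_ifs with h0
  · rw [layer, if_pos (h.mapDig_A_lt hX e), h0]
  · exact h.layer_innerId (by omega) hi (drop_lt h.n_pos (by omega) he)

theorem layer_highEnd : D.layer (D.highEnd X i e) = i + 1 := by
  unfold highEnd
  split_ifs with h0
  · have := h.mapDig_B_lt hX e
    rw [layer, if_neg (by omega), if_pos (by omega), h0]
  · exact h.layer_innerId (by omega) (by omega) (drop_lt h.n_pos (by omega) he)

theorem label_lowEnd (h0 : 1 ≤ i) : D.label (D.lowEnd X i e) = X := by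
  rw [lowEnd, if_neg (by omega)]
  exact h.label_innerId h0 hi (drop_lt h.n_pos (by omega) he)

theorem label_highEnd (h0 : i < D.K) : D.label (D.highEnd X i e) = X := by
  rw [highEnd, if_neg (by omega)]
  exact h.label_innerId (by omega) (by omega) (drop_lt h.n_pos (by omega) he)

theorem lowEnd_lt : D.lowEnd X i e < D.order := by
  unfold lowEnd
  split_ifs with h0
  · have := h.mapDig_A_lt hX e
    unfold order
    omega
  · exact h.innerId_lt hX (by omega) hi (drop_lt h.n_pos (by omega) he)

theorem highEnd_lt : D.highEnd X i e < D.order := by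
  unfold highEnd
  split_ifs with h0
  · have := h.mapDig_B_lt hX e
    unfold order
    omega
  · exact h.innerId_lt hX (by omega) (by omega) (drop_lt h.n_pos (by omega) he)

theorem digA_lowEnd {r : ℕ} (hr : r < D.K) (hir : i ≤ r) :
    D.digA (D.lowEnd X i e) r = D.A X r (dig D.n r e) := by
  unfold lowEnd
  split_ifs with h0
  · rw [digA, if_pos (h.mapDig_A_lt hX e), h.dig_mapDig_A hX hr]
  · have hd := drop_lt h.n_pos (show i - 1 < D.K by omega) he
    have := h.innerId_ge X i (drop D.n (i - 1) e)
    have := h.pow_pos D.K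
    rw [digA, if_neg (by omega), h.label_innerId (by omega) hi hd, h.entry_innerId hd,
      dig_drop_of_le h.n_pos (by omega), show r - 1 + 1 = r by omega]

theorem digA_highEnd {r : ℕ} (hr : r < D.K) (hir : i + 1 ≤ r) :
    D.digA (D.highEnd X i e) r = D.A X r (dig D.n r e) := by
  have hd := drop_lt h.n_pos (show i < D.K by omega) he
  have := h.innerId_ge X (i + 1) (drop D.n i e)
  have := h.pow_pos D.K
  rw [highEnd, if_neg (by omega), digA, if_neg (by omega),
    h.label_innerId (by omega) (by omega) hd, h.entry_innerId hd,
    dig_drop_of_le h.n_pos (by omega), show r - 1 + 1 = r by omega]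

theorem digB_lowEnd {r : ℕ} (hir : r + 2 ≤ i) :
    D.digB (D.lowEnd X i e) r = D.B X r (dig D.n r e) := by
  have hd := drop_lt h.n_pos (show i - 1 < D.K by omega) he
  have := h.innerId_ge X i (drop D.n (i - 1) e)
  rw [lowEnd, if_neg (by omega), digB, if_neg (by omega), h.label_innerId (by omega) hi hd,
    h.entry_innerId hd, dig_drop_of_lt (by omega)]

theorem digB_highEnd {r : ℕ} (hr : r < D.K) (hir : r + 1 ≤ i) :
    D.digB (D.highEnd X i e) r = D.B X r (dig D.n r e) := by
  unfold highEnd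
  split_ifs with h0
  · have := h.mapDig_B_lt hX e
    rw [digB, if_pos (by omega), Nat.add_sub_cancel_left, h.dig_mapDig_B hX hr]
  · have hd := drop_lt h.n_pos (show i < D.K by omega) he
    have := h.innerId_ge X (i + 1) (drop D.n i e)
    rw [digB, if_neg (by omega), h.label_innerId (by omega) (by omega) hd,
      h.entry_innerId hd, dig_drop_of_lt (by omega)]

end IsRetraction

/-! ### Layer structure, distances and edge list of the graph -/

section

variable {one : ℕ → ℕ → ℕ → ℕ → Prop} (h : D.IsRetraction one)

include h

theorem IsRetraction.layer_of_mem_edges {u v : ℕ} (huv : (u, v) ∈ D.edges) :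
    D.layer v = D.layer u + 1 := by
  obtain ⟨X, hX, i, hi, e, he, -, rfl, rfl⟩ := mem_edges.1 huv
  rw [h.layer_lowEnd hX hi he, h.layer_highEnd hX hi he]

/-- Both ends of an edge read the digits of one number `e` through the same rows of the tables, so
common digits agree. A tuple of `S` or `T` with an inner neighbour has digits in the image of the
tables of that neighbour's label, and hence these meet its constraints. -/
theorem IsRetraction.isDigitLayered (N : ℕ) :
    IsDigitLayered (D.graph N) D.K (fun v => D.layer v) (fun v => D.digA v) (fun v => D.digB v)
      (fun v => D.label v) one (fun u v => ((u : ℕ), (v : ℕ)) ∈ D.edges) where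
  adj u v huv := (graph_adj.1 huv).2
  layer_le v := by
    have := Nat.mod_lt ((v - 2 * D.n ^ D.K) / D.n ^ (D.K - 1)) h.K_pos
    unfold layer
    split_ifs <;> omega
  layer_succ u v huv := h.layer_of_mem_edges huv
  aD_eq u v huv r hr hl := by
    obtain ⟨X, hX, i, hi, e, he, -, h₁, h₂⟩ := mem_edges.1 huv
    rw [h₂, h.layer_highEnd hX hi he] at hl
    rw [h₁, h₂, h.digA_lowEnd hX hi he hr (by omega), h.digA_highEnd hX hi he hr hl]
  bD_eq u v huv r hl := by
    obtain ⟨X, hX, i, hi, e, he, -, h₁, h₂⟩ := mem_edges.1 huv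
    rw [h₁, h.layer_lowEnd hX hi he] at hl
    rw [h₁, h₂, h.digB_lowEnd hX hi he hl, h.digB_highEnd hX hi he (by omega) (by omega)]
  X_eq u v huv hl hl' := by
    obtain ⟨X, hX, i, hi, e, he, -, h₁, h₂⟩ := mem_edges.1 huv
    rw [h₁, h.layer_lowEnd hX hi he] at hl
    rw [h₂, h.layer_highEnd hX hi he] at hl'
    rw [h₁, h₂, h.label_lowEnd hX hi he hl, h.label_highEnd hX hi he (by omega)]
  one_aD u v huv hl r hr m hm := by
    obtain ⟨X, hX, i, hi, e, he, -, h₁, h₂⟩ := mem_edges.1 huv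
    have := h.K_pos
    rw [h₁, h.layer_lowEnd hX hi he] at hl
    rw [h₁, h₂, h.digA_lowEnd hX hi he hr (by omega), h.label_highEnd hX hi he (by omega)]
    exact h.A_one X hX r hr _ (dig_lt h.n_pos _ _) m hm
  one_bD u v huv hl r m hr hm := by
    obtain ⟨X, hX, i, hi, e, he, -, h₁, h₂⟩ := mem_edges.1 huv
    have := h.K_pos
    rw [h₂, h.layer_highEnd hX hi he] at hl
    rw [h₁, h₂, h.digB_highEnd hX hi he (by omega) (by omega), h.label_lowEnd hX hi he (by omega)]
    exact h.B_one X hX r (by omega) _ (dig_lt h.n_pos _ _) m hr hm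

theorem IsRetraction.graph_adj_of_mem {N : ℕ} {u v : Fin N} (huv : ((u : ℕ), (v : ℕ)) ∈ D.edges) :
    (D.graph N).Adj u v := by
  have := h.layer_of_mem_edges huv
  exact graph_adj.2 ⟨fun he => by rw [he] at this; omega, .inl huv⟩

theorem IsRetraction.layer_of_adj {N : ℕ} {u v : Fin N} (huv : (D.graph N).Adj u v) :
    D.layer u + 1 = D.layer v ∨ D.layer v + 1 = D.layer u := by
  rcases (graph_adj.1 huv).2 with h' | h'
  · exact .inl (h.layer_of_mem_edges h').symm
  · exact .inr (h.layer_of_mem_edges h').symm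

theorem IsRetraction.le_edist {N : ℕ} {a : ℕ → ℕ}
    (hsol : ∀ x, ∀ m < D.K, ∃ j ≤ D.K, ¬ one x m j (a j)) {s₁ s₂ : ℕ} {u v : Fin N} {α β : ℕ}
    (hα : α < D.n ^ D.K) (hβ : β < D.n ^ D.K) (hu : (u : ℕ) = α) (hv : (v : ℕ) = D.n ^ D.K + β)
    (hα' : ∀ r < D.K, s₁ ≤ r → dig D.n r α = a (D.K - 1 - r))
    (hβ' : ∀ r, r + s₂ < D.K → dig D.n r β = a (D.K - r)) :
    ((3 * D.K + 1 - 2 * s₁ - 2 * s₂ : ℕ) : ℕ∞) ≤ (D.graph N).edist u v := by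
  refine (h.isDigitLayered N).le_edist hsol ?_ (fun r hr hs => ?_) ?_ fun r hr => ?_
  · simp only [layer, hu, if_pos hα]
  · simp only [digA, hu, if_pos hα]
    exact hα' r hr hs
  · simp only [layer, hv]
    rw [if_neg (by omega), if_pos (by omega)]
  · simp only [digB, hv]
    rw [if_pos (by omega), Nat.add_sub_cancel_left]
    exact hβ' r hr

/-- The edges of the direct path from `α` to `β`. -/
theorem IsRetraction.edist_eq {N : ℕ} (hN : D.order ≤ N) {u v : Fin N} {α β X : ℕ}
    (hα : α < D.n ^ D.K) (hβ : β < D.n ^ D.K) (hu : (u : ℕ) = α) (hv : (v : ℕ) = D.n ^ D.K + β)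
    (hX : X < D.g) (hA : ∀ r < D.K, D.A X r (dig D.n r α) = dig D.n r α)
    (hB : ∀ r < D.K, D.B X r (dig D.n r β) = dig D.n r β) :
    (D.graph N).edist u v = (D.K + 1 : ℕ) := by
  have hn := h.n_pos
  have hK := h.K_pos
  apply le_antisymm
  -- The edge at level `i` of the direct path: the digits below `i` come from `β`, the others from
  -- `α`.
  · let t : ℕ → ℕ := fun i => α / D.n ^ i * D.n ^ i + β % D.n ^ i
    have ht : ∀ i, t i < D.n ^ D.K ∨ D.K < i := by
      intro i
      by_cases hi : D.K < i
      · exact .inr hi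
      left
      have h₁ : α / D.n ^ i < D.n ^ (D.K - i) := by
        rw [Nat.div_lt_iff_lt_mul (by positivity), ← pow_add]
        rwa [show D.K - i + i = D.K by omega]
      have := mul_add_lt_mul h₁ (Nat.mod_lt β (h.pow_pos i))
      rwa [← pow_add, show D.K - i + i = D.K by omega] at this
    have hdiv : ∀ i, t i / D.n ^ i = α / D.n ^ i := fun i =>
      mul_pow_add_div hn _ _ _ (Nat.mod_lt _ (h.pow_pos i))
    have hmod : ∀ i, t i % D.n ^ i = β % D.n ^ i := fun i =>
      mul_pow_add_mod _ _ _ (Nat.mod_lt _ (h.pow_pos i))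
    have ht0 : t 0 = α := by simp [t, Nat.mod_one]
    have htK : t D.K = β := by
      simp [t, Nat.div_eq_of_lt hα, Nat.mod_eq_of_lt hβ]
    let f : ℕ → Fin N := fun i =>
      if hi : i ≤ D.K then ⟨D.lowEnd X i (t i),
        (h.lowEnd_lt hX hi ((ht i).resolve_right (by omega))).trans_le hN⟩ else v
    have hmapA : mapDig D.n D.K (D.A X) α = α := by
      conv_rhs => rw [← sum_dig hα]
      exact Finset.sum_congr rfl fun r hr => by rw [hA r (Finset.mem_range.1 hr)]
    have hmapB : mapDig D.n D.K (D.B X) β = β := by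
      conv_rhs => rw [← sum_dig hβ]
      exact Finset.sum_congr rfl fun r hr => by rw [hB r (Finset.mem_range.1 hr)]
    have hf0 : f 0 = u := by
      simp only [f, Nat.zero_le, dif_pos]
      apply Fin.ext
      simp [lowEnd, ht0, hmapA, hu]
    have hfK : f (D.K + 1) = v := by simp [f]
    have hadj : ∀ i < D.K + 1, (D.graph N).Adj (f i) (f (i + 1)) := by
      intro i hi
      apply h.graph_adj_of_mem
      have hiK : i ≤ D.K := by omega
      rw [mem_edges]
      refine ⟨X, hX, i, hiK, t i, (ht i).resolve_right (by omega), ⟨?_, ?_⟩, ?_, ?_⟩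
      · rintro rfl
        rw [ht0]
        simpa [dig] using hA 0 hK
      · rintro rfl
        rw [htK, ← dig_top hn hK hβ]
        exact hB _ (by omega)
      · simp [f, hiK]
      · by_cases hi' : i = D.K
        · subst hi'
          simp [f, highEnd, htK, hmapB, hv]
        · have hi'' : i + 1 ≤ D.K := by omega
          simp only [f, hi'', dif_pos, highEnd, if_neg hi', lowEnd, Nat.add_sub_cancel,
            if_neg (Nat.succ_ne_zero i)]
          congr 1
          -- Consecutive edges differ only in digit `i`, which their common vertex in layer `i + 1`
          -- forgets.
          have h₁ : t i / D.n ^ (i + 1) = t (i + 1) / D.n ^ (i + 1) := by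
            rw [hdiv, pow_succ, ← Nat.div_div_eq_div_mul, hdiv, Nat.div_div_eq_div_mul]
          have h₂ : t i % D.n ^ i = t (i + 1) % D.n ^ i := by
            rw [hmod, ← Nat.mod_mod_of_dvd (t (i + 1)) (Dvd.intro _ (pow_succ D.n i).symm), hmod,
              Nat.mod_mod_of_dvd _ (Dvd.intro _ (pow_succ D.n i).symm)]
          rw [drop, drop, h₁, h₂]
    have := edist_le_of_adj_chain f (D.K + 1) hadj
    rwa [hf0, hfK] at this
  · have h₁ := le_add_edist_of_layer (G := D.graph N) (layer := fun v => D.layer v)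
      (fun u v huv => by
        have := h.layer_of_adj huv
        omega) u v
    have h₂ : D.layer u = 0 := by rw [layer, hu, if_pos hα]
    have h₃ : D.layer v = D.K + 1 := by
      rw [layer, hv, if_neg (by omega), if_pos (by omega)]
    simp only [h₂, h₃] at h₁
    simpa using h₁

/-- The missing digit may be filled in at will, except that at the lowest level `EdgeCond` demands a
fixed point of `D.A X 0`; a value of this idempotent map serves in all layers. -/
theorem IsRetraction.exists_adj_lower {N : ℕ} (hN : D.order ≤ N) {v : Fin N} (hvN : v < D.order)
    (h₁ : 1 ≤ D.layer v) (h₂ : D.layer v ≤ D.K) :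
    ∃ u, (D.graph N).Adj u v ∧ D.layer u + 1 = D.layer v := by
  obtain ⟨X, hX, e, he, hv⟩ := h.exists_innerId hvN h₁ h₂
  set i := D.layer v with hi
  have hc : D.A X 0 0 < D.n := h.A_lt X hX 0 h.K_pos 0 h.n_pos
  have hlt := insertDig_lt h.n_pos (show i - 1 < D.K by omega) hc he
  have hmem : (D.lowEnd X (i - 1) (insertDig D.n (i - 1) (D.A X 0 0) e), (v : ℕ)) ∈ D.edges := by
    refine mem_edges.2 ⟨X, hX, i - 1, by omega, _, hlt, ⟨fun h0 => ?_, fun h0 => by omega⟩, rfl, ?_⟩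
    · have := dig_insertDig h.n_pos hc (r := 0) e
      simp only [dig, pow_zero, Nat.div_one] at this
      rw [h0, this, h.A_idem X hX 0 h.K_pos 0 h.n_pos]
    · rw [highEnd, if_neg (by omega), drop_insertDig h.n_pos hc, Nat.sub_add_cancel h₁]
      exact hv
  have := h.layer_of_mem_edges hmem
  exact ⟨⟨_, (h.lowEnd_lt hX (by omega) hlt).trans_le hN⟩, h.graph_adj_of_mem hmem, this.symm⟩

theorem IsRetraction.exists_adj_upper {N : ℕ} (hN : D.order ≤ N) {v : Fin N} (hvN : v < D.order)
    (h₁ : 1 ≤ D.layer v) (h₂ : D.layer v ≤ D.K) :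
    ∃ u, (D.graph N).Adj v u ∧ D.layer u = D.layer v + 1 := by
  obtain ⟨X, hX, e, he, hv⟩ := h.exists_innerId hvN h₁ h₂
  set i := D.layer v with hi
  have hc : D.B X (D.K - 1) 0 < D.n := h.B_lt X hX _ (by omega) 0 h.n_pos
  have hlt := insertDig_lt h.n_pos (show i - 1 < D.K by omega) hc he
  have hmem : ((v : ℕ), D.highEnd X i (insertDig D.n (i - 1) (D.B X (D.K - 1) 0) e)) ∈ D.edges := by
    refine mem_edges.2 ⟨X, hX, i, by omega, _, hlt, ⟨fun h0 => by omega, fun h0 => ?_⟩, ?_, rfl⟩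
    · rw [← dig_top h.n_pos h.K_pos hlt, h0, dig_insertDig h.n_pos hc,
        h.B_idem X hX _ (by omega) 0 h.n_pos]
    · rw [lowEnd, if_neg (by omega), drop_insertDig h.n_pos hc]
      exact hv
  have := h.layer_of_mem_edges hmem
  exact ⟨⟨_, (h.highEnd_lt hX (by omega) hlt).trans_le hN⟩, h.graph_adj_of_mem hmem, this⟩

/-- At an inner level the two ends forget different digits and together determine `e`. At the lowest
and the top level the digit forgotten by the inner end is read off the retracted tuple, being a
fixed point by `EdgeCond`. -/
theorem IsRetraction.edge_inj {X i e X' i' e' : ℕ} (hX : X < D.g) (hi : i ≤ D.K)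
    (he : e < D.n ^ D.K) (hX' : X' < D.g) (hi' : i' ≤ D.K) (he' : e' < D.n ^ D.K)
    (hc : D.EdgeCond X i e) (hc' : D.EdgeCond X' i' e')
    (h₁ : D.lowEnd X i e = D.lowEnd X' i' e') (h₂ : D.highEnd X i e = D.highEnd X' i' e') :
    X = X' ∧ i = i' ∧ e = e' := by
  have hn := h.n_pos
  have hK := h.K_pos
  obtain rfl : i = i' := by
    rw [← h.layer_lowEnd hX hi he, h₁, h.layer_lowEnd hX' hi' he']
  obtain rfl : X = X' := by
    by_cases h0 : i < D.K
    · rw [← h.label_highEnd hX hi he h0, h₂, h.label_highEnd hX' hi' he' h0]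
    · rw [← h.label_lowEnd hX hi he (by omega), h₁, h.label_lowEnd hX' hi' he' (by omega)]
  refine ⟨rfl, rfl, ?_⟩
  have hhi : i < D.K → drop D.n i e = drop D.n i e' := by
    intro h0
    rw [highEnd, highEnd, if_neg (by omega), if_neg (by omega)] at h₂
    exact Nat.add_left_cancel h₂
  have hlo : 1 ≤ i → drop D.n (i - 1) e = drop D.n (i - 1) e' := by
    intro h0
    rw [lowEnd, lowEnd, if_neg (by omega), if_neg (by omega)] at h₁
    exact Nat.add_left_cancel h₁
  by_cases h0 : i = 0
  · subst h0
    have hm : dig D.n 0 e = dig D.n 0 e' := by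
      have e₁ := hc.1 rfl
      have e₂ := hc'.1 rfl
      have e₃ : dig D.n 0 (mapDig D.n D.K (D.A X) e) = dig D.n 0 (mapDig D.n D.K (D.A X) e') := by
        simp only [lowEnd, if_true] at h₁
        rw [h₁]
      rw [h.dig_mapDig_A hX hK, h.dig_mapDig_A hX hK] at e₃
      simp only [dig, pow_zero, Nat.div_one] at e₃ ⊢
      rwa [e₁, e₂] at e₃
    refine eq_of_dig_eq he he' fun r hr => ?_
    rcases Nat.eq_zero_or_pos r with rfl | hr0
    · exact hm
    · have := congrArg (dig D.n (r - 1)) (hhi hK)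
      rwa [dig_drop_of_le hn (by omega), dig_drop_of_le hn (by omega),
        show r - 1 + 1 = r by omega] at this
  · refine eq_of_dig_eq he he' fun r hr => ?_
    by_cases hri : r < i - 1
    · have := congrArg (dig D.n r) (hlo (by omega))
      rwa [dig_drop_of_lt hri, dig_drop_of_lt hri] at this
    by_cases hri' : i ≤ r
    · have := congrArg (dig D.n (r - 1)) (hlo (by omega))
      rwa [dig_drop_of_le hn (by omega), dig_drop_of_le hn (by omega),
        show r - 1 + 1 = r by omega] at this
    obtain rfl : r = i - 1 := by omega
    by_cases hiK : i < D.K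
    · have := congrArg (dig D.n (i - 1)) (hhi hiK)
      rwa [dig_drop_of_lt (by omega), dig_drop_of_lt (by omega)] at this
    · obtain rfl : i = D.K := by omega
      have e₁ := hc.2 rfl
      have e₂ := hc'.2 rfl
      rw [← dig_top hn hK he] at e₁
      rw [← dig_top hn hK he'] at e₂
      rw [← e₁, ← e₂, ← h.dig_mapDig_B hX hr, ← h.dig_mapDig_B hX hr]
      simp only [highEnd, if_true] at h₂
      rw [Nat.add_left_cancel h₂]

theorem IsRetraction.nodup_edges : D.edges.Nodup := by
  have mem_at : ∀ {X i e : ℕ} {p : ℕ × ℕ}, p ∈ D.edgeAt X i e ↔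
      D.EdgeCond X i e ∧ p = (D.lowEnd X i e, D.highEnd X i e) := by
    intro X i e p
    simp [edgeAt]
  rw [edges, List.nodup_flatMap]
  refine ⟨fun X hX => ?_, ?_⟩
  · rw [List.mem_range] at hX
    rw [blockEdges, List.nodup_flatMap]
    refine ⟨fun i hi => ?_, ?_⟩
    · rw [List.mem_range] at hi
      rw [levelEdges, List.nodup_flatMap]
      refine ⟨fun e _ => ?_, ?_⟩
      · rw [edgeAt]; split_ifs <;> simp
      · refine List.nodup_range.pairwise_of_forall_ne fun e he e' he' hne p hp hp' => hne ?_
        rw [List.mem_range] at he he'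
        obtain ⟨c, rfl⟩ := mem_at.1 hp
        obtain ⟨c', hpp⟩ := mem_at.1 hp'
        exact (h.edge_inj hX (by omega) he hX (by omega) he' c c' (Prod.ext_iff.1 hpp).1
          (Prod.ext_iff.1 hpp).2).2.2
    · refine List.nodup_range.pairwise_of_forall_ne fun i hi i' hi' hne p hp hp' => hne ?_
      simp only [levelEdges, List.mem_flatMap, List.mem_range] at hi hi' hp hp'
      obtain ⟨e, he, hp⟩ := hp
      obtain ⟨e', he', hp'⟩ := hp'
      obtain ⟨c, rfl⟩ := mem_at.1 hp
      obtain ⟨c', hpp⟩ := mem_at.1 hp'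
      exact (h.edge_inj hX (by omega) he hX (by omega) he' c c' (Prod.ext_iff.1 hpp).1
        (Prod.ext_iff.1 hpp).2).2.1
  · refine List.nodup_range.pairwise_of_forall_ne fun X hX X' hX' hne p hp hp' => hne ?_
    simp only [blockEdges, levelEdges, List.mem_flatMap, List.mem_range] at hX hX' hp hp'
    obtain ⟨i, hi, e, he, hp⟩ := hp
    obtain ⟨i', hi', e', he', hp'⟩ := hp'
    obtain ⟨c, rfl⟩ := mem_at.1 hp
    obtain ⟨c', hpp⟩ := mem_at.1 hp'
    exact (h.edge_inj hX (by omega) he hX' (by omega) he' c c' (Prod.ext_iff.1 hpp).1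
      (Prod.ext_iff.1 hpp).2).1

omit h in
theorem length_levelEdges_le (X i : ℕ) : (D.levelEdges X i).length ≤ D.n ^ D.K := by
  rw [levelEdges, List.length_flatMap]
  refine (List.sum_le_card_nsmul _ 1 ?_).trans (by simp)
  intro x hx
  obtain ⟨e, -, rfl⟩ := List.mem_map.1 hx
  rw [edgeAt]
  split_ifs <;> simp

omit h in
theorem length_blockEdges_le (X : ℕ) : (D.blockEdges X).length ≤ (D.K + 1) * D.n ^ D.K := by
  rw [blockEdges, List.length_flatMap]
  refine (List.sum_le_card_nsmul _ (D.n ^ D.K) ?_).trans (by simp)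
  intro x hx
  obtain ⟨i, -, rfl⟩ := List.mem_map.1 hx
  exact length_levelEdges_le X i

omit h in
theorem length_edges_le : D.edges.length ≤ D.g * ((D.K + 1) * D.n ^ D.K) := by
  rw [edges, List.length_flatMap]
  refine (List.sum_le_card_nsmul _ ((D.K + 1) * D.n ^ D.K) ?_).trans (by simp)
  intro x hx
  obtain ⟨X, -, rfl⟩ := List.mem_map.1 hx
  exact length_blockEdges_le X

theorem IsRetraction.ncard_layer_le {i : ℕ} (h₁ : 1 ≤ i) (h₂ : i ≤ D.K) :
    {v : Fin D.order | D.layer v = i}.ncard ≤ D.n ^ (D.K - 1) * D.g := by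
  have hsub : (Fin.val '' {v : Fin D.order | D.layer v = i}) ⊆
      ((Finset.range D.g ×ˢ Finset.range (D.n ^ (D.K - 1))).image
        fun x => D.innerId x.1 i x.2 : Finset ℕ) := by
    rintro _ ⟨v, hv, rfl⟩
    simp only [Set.mem_ofPred_eq] at hv
    obtain ⟨X, hX, e, he, hve⟩ := h.exists_innerId v.2 (by omega) (by omega)
    rw [hv] at hve
    simp only [Finset.coe_image, Set.mem_image, Finset.mem_coe, Finset.mem_product,
      Finset.mem_range]
    exact ⟨(X, e), ⟨hX, he⟩, hve.symm⟩
  rw [← Set.ncard_image_of_injective _ Fin.val_injective]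
  refine (Set.ncard_le_ncard hsub (Finset.finite_toSet _)).trans ?_
  rw [Set.ncard_coe_finset]
  refine Finset.card_image_le.trans ?_
  rw [Finset.card_product, Finset.card_range, Finset.card_range, mul_comm]

end

end Tables

end STDiam

namespace STDiam

/-! ### Constructing the graph on the word-RAM: the retraction tables -/

section Retraction

/-- The largest number below `n` with the property `v` (`0` if there is none). -/
def lastOf (v : ℕ → Prop) [DecidablePred v] : ℕ → ℕ
  | 0 => 0
  | a + 1 => if v a then a else lastOf v a

/-- Maps the numbers below `n` to such with the property `v`, if there are any. -/
def retract (v : ℕ → Prop) [DecidablePred v] (n a : ℕ) : ℕ := if v a then a else lastOf v n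

variable {v : ℕ → Prop} [DecidablePred v]

theorem lastOf_le (n : ℕ) : lastOf v n ≤ n := by
  induction n with
  | zero => simp [lastOf]
  | succ n ih => rw [lastOf]; split_ifs <;> omega

theorem lastOf_lt {n : ℕ} (hn : 0 < n) : lastOf v n < n := by
  obtain ⟨n, rfl⟩ : ∃ m, n = m + 1 := ⟨n - 1, by omega⟩
  have := lastOf_le (v := v) n
  rw [lastOf]; split_ifs <;> omega

theorem lastOf_spec {n : ℕ} (h : ∃ a < n, v a) : v (lastOf v n) := by
  induction n with
  | zero => simp at h
  | succ n ih =>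
    rw [lastOf]
    split_ifs with hv
    · exact hv
    · obtain ⟨a, ha, hva⟩ := h
      refine ih ⟨a, ?_, hva⟩
      rcases Nat.lt_succ_iff_lt_or_eq.1 ha with h | rfl
      · exact h
      · exact absurd hva hv

theorem retract_lt {n a : ℕ} (ha : a < n) : retract v n a < n := by
  rw [retract]
  split_ifs
  · exact ha
  · exact lastOf_lt (by omega)

theorem retract_spec {n : ℕ} (h : ∃ a < n, v a) (a : ℕ) : v (retract v n a) := by
  rw [retract]
  split_ifs with hv
  · exact hv
  · exact lastOf_spec h

theorem retract_of_mem {n a : ℕ} (h : v a) : retract v n a = a := if_pos h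

end Retraction

/-! ### Tabulating a single retraction -/

section Rows

/-- The vector `a` has ones at the coordinates given by the last `c` digits of `y` in base `d`. -/
def DigitsOne (bit : ℕ → ℕ → ℕ) (d y c a : ℕ) : Prop := ∀ m < c, bit a (y / d ^ m % d) = 1

instance (bit : ℕ → ℕ → ℕ) (d y c : ℕ) : DecidablePred (DigitsOne bit d y c) := fun a => by
  unfold DigitsOne; infer_instance

theorem digitsOne_succ {bit : ℕ → ℕ → ℕ} {d y c a : ℕ} :
    DigitsOne bit d y (c + 1) a ↔ DigitsOne bit d y c a ∧ bit a (y / d ^ c % d) = 1 := by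
  simp only [DigitsOne, Nat.lt_succ_iff_lt_or_eq, or_imp, forall_and, forall_eq]

/-- Tests whether the vector at the address in register `22` has ones at the first coordinates given
by the digits in register `14`; register `15` holds the number of these digits. -/
def testDigits : Prog :=
  .seq (assign 20 (.reg 14 + .lit 0)) <| .seq (assign 21 (.lit 1)) <|
  forUpTo 23 15 <|
    .seq (assign 21 (.reg 21 * .load (.reg 22 + .reg 20 % .reg 3))) <|
    assign 20 (.reg 20 / .reg 3)

theorem run_testDigits {w : ℕ} {τ : State} {bit : ℕ → ℕ → ℕ} {d y c a L : ℕ} (hL : L < 2 ^ w)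
    (hd : τ.reg 3 = d) (hy : τ.reg 14 = y) (hc : τ.reg 15 = c) (hd0 : 0 < d) (hdL : d ≤ L)
    (hyL : y ≤ L) (hcL : c ≤ L) (hm : ∀ x < d, τ.mem (τ.reg 22 + x) = bit a x)
    (haL : τ.reg 22 + d ≤ L) (hbit : ∀ x, bit a x ≤ 1) :
    Run w testDigits τ (c * 16 + 7) fun τ' => τ'.mem = τ.mem ∧
      τ'.reg 21 = if DigitsOne bit d y c a then 1 else 0 := by
  have hw0 : w ≠ 0 := by rintro rfl; simp at hL; omega
  refine Run.assign_seq y (by simp [hy]) (by simp [hy]; omega) ?_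
  refine Run.assign_seq 1 (by simp) (by simp; omega) ?_
  refine Run.forUpTo (fun j σ => σ.mem = τ.mem ∧ σ.reg 20 = y / d ^ j ∧
    σ.reg 21 = if DigitsOne bit d y j a then 1 else 0) c 11 (by simp [hc]) (by omega)
    (by simp [DigitsOne]) ?_ ?_
  · rintro j hj σ ⟨hσm, hσ20, hσ21⟩ hσj hf
    have h3 : σ.reg 3 = d := by rw [hf 3 (by decide) (by decide) rfl]; simp [hd]
    have h22 : σ.reg 22 = τ.reg 22 := by rw [hf 22 (by decide) (by decide) rfl]; simp
    have hmod : y / d ^ j % d < d := Nat.mod_lt _ hd0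
    have hdiv : y / d ^ j ≤ y := Nat.div_le_self _ _
    have hdiv' : y / d ^ j / d ≤ y / d ^ j := Nat.div_le_self _ _
    have hb := hbit (y / d ^ j % d)
    have hval : (Expr.reg 21 * .load (.reg 22 + .reg 20 % .reg 3)).eval σ =
        if DigitsOne bit d y (j + 1) a then 1 else 0 := by
      simp only [Expr.eval_mul, Expr.eval_reg, Expr.eval_load, Expr.eval_add, Expr.eval_mod, hσm,
        hσ20, hσ21, h3, h22, hm _ hmod, digitsOne_succ]
      interval_cases hbv : bit a (y / d ^ j % d) <;> simp
    refine Run.assign_seq _ hval ?_ ?_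
    · have : (if DigitsOne bit d y (j + 1) a then 1 else 0) ≤ 1 := by split_ifs <;> omega
      rw [← hval] at this
      simp only [Expr.fits_mul, Expr.fits_reg, Expr.fits_load, Expr.fits_add, Expr.fits_mod,
        Expr.eval_reg, Expr.eval_mod, true_and, h3, hσ20, h22]
      exact ⟨⟨by omega, by omega⟩, lt_of_le_of_lt this (by omega)⟩
    · refine Run.assign (y / d ^ (j + 1)) ?_ ?_ ?_
      · simp [hσ20, h3, pow_succ, Nat.div_div_eq_div_mul]
      · simp [hσ20, h3]
        omega
      · simp [hσm]
  · rintro σ ⟨h1, h2, h3⟩ - -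
    exact ⟨h1, h3⟩

/-- Tabulates, in the `n` cells from the address in register `16` on, the retraction of the vectors in
the list number `reg 13` to those passing the test of `testDigits`.  If there are none, then
register `12` is cleared. -/
def fillRow : Prog :=
  .seq (assign 17 (.lit 0)) <| .seq (assign 18 (.lit 0)) <|
  .seq (forUpTo 19 2 <|
    .seq (assign 22 (.lit 3 + (.reg 13 * .reg 2 + .reg 19) * .reg 3)) <|
    .seq testDigits <|
    .seq (put (.reg 16 + .reg 19) (.reg 21)) <|
    cond (.reg 21) (.seq (assign 17 (.lit 1)) (assign 18 (.reg 19 + .lit 0))) .skip) <|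
  .seq (forUpTo 19 2 <|
    cond (.load (.reg 16 + .reg 19)) (put (.reg 16 + .reg 19) (.reg 19))
      (put (.reg 16 + .reg 19) (.reg 18))) <|
  assign 12 (.reg 12 * .reg 17)

/-- Two passes over the same cells. The first stores truth values and remembers the last admissible
vector in register `18`; the second replaces the truth values in place by the images. Register `12`
accumulates the conjunction over all rows. -/
theorem run_fillRow {w : ℕ} {τ : State} {bit : ℕ → ℕ → ℕ} {n d j y c ra L : ℕ} (hL : L < 2 ^ w)
    (hn : τ.reg 2 = n) (hd : τ.reg 3 = d) (hj : τ.reg 13 = j) (hy : τ.reg 14 = y)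
    (hc : τ.reg 15 = c) (hra : τ.reg 16 = ra) (hd0 : 0 < d) (hn0 : 0 < n)
    (hyL : y ≤ L) (hcL : c ≤ L) (hbit : ∀ a x, bit a x ≤ 1)
    (hm : ∀ a < n, ∀ x < d, τ.mem (3 + (j * n + a) * d + x) = bit a x)
    (haL : 3 + (j * n + n) * d ≤ ra) (hraL : ra + n ≤ L) (h12 : τ.reg 12 ≤ 1) :
    Run w fillRow τ (n * (c * 16 + 60) + 20) fun τ' =>
      (∀ x, x < ra ∨ ra + n ≤ x → τ'.mem x = τ.mem x) ∧
      (∀ a < n, τ'.mem (ra + a) = retract (DigitsOne bit d y c) n a) ∧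
      τ'.reg 12 = if ∃ a < n, DigitsOne bit d y c a then τ.reg 12 else 0 := by
  have hw0 : w ≠ 0 := by rintro rfl; simp at hL; omega
  have h1L : 1 < 2 ^ w := by omega
  set v := DigitsOne bit d y c
  refine Run.assign_seq 0 (by simp) (by simp) ?_
  refine Run.assign_seq 0 (by simp) (by simp) ?_
  refine Run.seq (n * (c * 16 + 7 + 26 + 5) + 3) (Run.forUpTo (fun i σ =>
    (∀ x, x < ra ∨ ra + n ≤ x → σ.mem x = τ.mem x) ∧
    (∀ a < i, σ.mem (ra + a) = if v a then 1 else 0) ∧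
    σ.reg 17 = (if ∃ a < i, v a then 1 else 0) ∧ σ.reg 18 = lastOf v i) n (c * 16 + 7 + 26)
    (by simp [hn]) (by omega) (by simp [lastOf]) ?_ ?_)
  · rintro i hi σ ⟨hm₁, hm₂, h17, h18⟩ hσi hf
    have h2 : σ.reg 2 = n := by rw [hf 2 (by decide) (by decide) rfl]; simp [hn]
    have h3 : σ.reg 3 = d := by rw [hf 3 (by decide) (by decide) rfl]; simp [hd]
    have h13 : σ.reg 13 = j := by rw [hf 13 (by decide) (by decide) rfl]; simp [hj]
    have h14 : σ.reg 14 = y := by rw [hf 14 (by decide) (by decide) rfl]; simp [hy]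
    have h15 : σ.reg 15 = c := by rw [hf 15 (by decide) (by decide) rfl]; simp [hc]
    have h16 : σ.reg 16 = ra := by rw [hf 16 (by decide) (by decide) rfl]; simp [hra]
    have hle : (j * n + i) * d + d ≤ (j * n + n) * d := by
      have := Nat.mul_le_mul_right d (show j * n + i + 1 ≤ j * n + n by omega)
      rwa [add_mul, one_mul] at this
    have hle1 : j * n + i ≤ (j * n + i) * d := Nat.le_mul_of_pos_right _ hd0
    refine Run.assign_seq (3 + (j * n + i) * d) (by simp [h2, h3, h13, hσi]) ?_ ?_
    · simp only [Expr.fits_add, Expr.fits_mul, Expr.fits_lit, Expr.fits_reg, Expr.eval_reg,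
        Expr.eval_mul, Expr.eval_add, Expr.eval_lit, true_and, h2, h3, h13, hσi]
      omega
    refine Run.call (c * 16 + 7) (run_testDigits (L := L) (bit := bit) (a := i) hL (by simp [h3])
      (by simp [h14]) (by simp [h15]) hd0 (by omega) hyL hcL (fun x hx => ?_) ?_
      (hbit i)) ?_
    · simp only [State.setReg_mem, State.setReg_reg, if_true]
      rw [hm₁ _ (by left; omega)]
      exact hm i hi x hx
    · simp only [State.setReg_reg, if_true]
      omega
    rintro σ₁ ⟨hσ₁m, h21⟩ hf₁
    have h16' : σ₁.reg 16 = ra := by rw [hf₁ 16 (by decide) rfl]; simp [h16]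
    have h19' : σ₁.reg 19 = i := by rw [hf₁ 19 (by decide) rfl]; simp [hσi]
    have h17' : σ₁.reg 17 = (if ∃ a < i, v a then 1 else 0) := by
      rw [hf₁ 17 (by decide) rfl]; simp [h17]
    have h18' : σ₁.reg 18 = lastOf v i := by rw [hf₁ 18 (by decide) rfl]; simp [h18]
    refine Run.put_seq (ra + i) (if v i then 1 else 0) (by simp [h16', h19']) (by simp [h21, v])
      (by simp [h16', h19']; omega) (by simp) ?_
    have hmem : ∀ x, x < ra ∨ ra + n ≤ x →
        (σ₁.setMem (ra + i) (if v i then 1 else 0)).mem x = τ.mem x := by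
      intro x hx
      simp only [State.setMem_mem, hσ₁m]
      rw [if_neg (by omega)]
      exact hm₁ x hx
    have hmem' : ∀ a < i + 1, (σ₁.setMem (ra + i) (if v i then 1 else 0)).mem (ra + a) =
        if v a then 1 else 0 := by
      intro a ha
      by_cases hai : a = i
      · simp [hai]
      · simp only [State.setMem_mem, hσ₁m]
        rw [if_neg (by omega)]
        exact hm₂ a (by omega)
    refine Run.cond (by simp) (fun h => ?_) (fun h => ?_)
    · have hv : v i := by
        by_contra hv
        simp [h21, v, hv] at h
      refine Run.assign_seq 1 (by simp) (by simpa using hw0) ?_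
      refine Run.assign i (by simp [h19']) (by simp [h19']; omega) ?_
      refine ⟨by simpa using hmem, by simpa using hmem', ?_, by simp [lastOf, hv]⟩
      have : ∃ a < i + 1, v a := ⟨i, by omega, hv⟩
      rw [if_pos this]
      simp
    · have hv : ¬ v i := by
        intro hv
        simp [h21] at h
        exact h hv
      refine Run.skip ⟨by simpa using hmem, by simpa using hmem', ?_, ?_⟩
      · have : (∃ a < i + 1, v a) ↔ ∃ a < i, v a := by
          constructor
          · rintro ⟨a, ha, hva⟩
            refine ⟨a, ?_, hva⟩
            rcases Nat.lt_succ_iff_lt_or_eq.1 ha with h | rfl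
            · exact h
            · exact absurd hva hv
          · rintro ⟨a, ha, hva⟩
            exact ⟨a, by omega, hva⟩
        simp only [this]
        simp [h17']
      · simp [h18', lastOf, hv]
  · rintro σ ⟨hm₁, hm₂, h17, h18⟩ hσi hf
    have h2 : σ.reg 2 = n := by rw [hf 2 (by decide) (by decide) rfl]; simp [hn]
    have h16 : σ.reg 16 = ra := by rw [hf 16 (by decide) (by decide) rfl]; simp [hra]
    have h12' : σ.reg 12 = τ.reg 12 := by rw [hf 12 (by decide) (by decide) rfl]; simp
    refine Run.seq (n * (10 + 5) + 3) (Run.forUpTo (fun i σ =>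
      (∀ x, x < ra ∨ ra + n ≤ x → σ.mem x = τ.mem x) ∧
      (∀ a < i, σ.mem (ra + a) = retract v n a) ∧
      (∀ a < n, i ≤ a → σ.mem (ra + a) = if v a then 1 else 0)) n 10 h2 (by omega)
      (by simpa using ⟨hm₁, hm₂⟩) ?_ ?_)
    · rintro i hi σ' ⟨hm₁', hm₂', hm₃'⟩ hσi' hf'
      have h16' : σ'.reg 16 = ra := by rw [hf' 16 (by decide) (by decide) rfl]; simp [h16]
      have h18' : σ'.reg 18 = lastOf v n := by rw [hf' 18 (by decide) (by decide) rfl]; simp [h18]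
      have hend : ∀ u, u = retract v n i →
          (∀ x, x < ra ∨ ra + n ≤ x → ((σ'.setMem (ra + i) u).setReg 19 (i + 1)).mem x = τ.mem x) ∧
          (∀ a < i + 1, ((σ'.setMem (ra + i) u).setReg 19 (i + 1)).mem (ra + a) = retract v n a) ∧
          (∀ a < n, i + 1 ≤ a → ((σ'.setMem (ra + i) u).setReg 19 (i + 1)).mem (ra + a) =
            if v a then 1 else 0) := by
        rintro u rfl
        simp only [State.setReg_mem, State.setMem_mem]
        refine ⟨fun x hx => ?_, fun a ha => ?_, fun a ha hia => ?_⟩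
        · rw [if_neg (by omega)]
          exact hm₁' x hx
        · by_cases hai : a = i
          · simp [hai]
          · rw [if_neg (by omega)]
            exact hm₂' a (by omega)
        · rw [if_neg (by omega)]
          exact hm₃' a ha (by omega)
      have hval : (Expr.load (.reg 16 + .reg 19)).eval σ' = if v i then 1 else 0 := by
        simpa [h16', hσi'] using hm₃' i hi le_rfl
      refine Run.cond (by simp [h16', hσi']; omega) (fun h => ?_) (fun h => ?_)
      · have hv : v i := by
          by_contra hv
          simp [hval, hv] at h
        refine Run.put (ra + i) i (by simp [h16', hσi']) (by simp [hσi'])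
          (by simp [h16', hσi']; omega) (by simp) (hend i (retract_of_mem hv).symm)
      · have hv : ¬ v i := by
          intro hv
          simp [hval, hv] at h
        refine Run.put (ra + i) (lastOf v n) (by simp [h16', hσi']) (by simp [h18'])
          (by simp [h16', hσi']; omega) (by simp) (hend _ (by simp [retract, hv]))
    · rintro σ' ⟨hm₁', hm₂', -⟩ - hf'
      have h17' : σ'.reg 17 = (if ∃ a < n, v a then 1 else 0) := by
        rw [hf' 17 (by decide) (by decide) rfl]; simp [h17]
      have h12'' : σ'.reg 12 = τ.reg 12 := by
        rw [hf' 12 (by decide) (by decide) rfl]; simp [h12']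
      refine Run.assign (if ∃ a < n, v a then τ.reg 12 else 0) (by simp [h12'', h17', v]) ?_
        ⟨by simpa using hm₁', by simpa using hm₂', by simp [v]⟩ rfl
      simp only [Expr.fits_mul, Expr.fits_reg, Expr.eval_reg, true_and, h12'', h17']
      split_ifs <;> omega

end Rows

end STDiam

namespace STDiam

/-! ### The tables of one coordinate array -/

section Tables

/-- The address of the tables, just after the input. -/
def tableBase (K n d : ℕ) : ℕ := 3 + (K + 1) * n * d

/-- The address of the output, just after the tables. -/
def outBase (K n d : ℕ) : ℕ := tableBase K n d + K * n + K * n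

/-- The contents of the registers that stay constant during the main part of the program. -/
structure Setup (K n d : ℕ) (τ : State) : Prop where
  r0 : τ.reg 0 = outBase K n d
  r1 : τ.reg 1 = K
  r2 : τ.reg 2 = n
  r3 : τ.reg 3 = d
  r4 : τ.reg 4 = tableBase K n d
  r5 : τ.reg 5 = tableBase K n d + K * n
  r6 : τ.reg 6 = n ^ (K - 1)
  r7 : τ.reg 7 = n ^ K

theorem Setup.congr {K n d : ℕ} {σ τ : State} (h : Setup K n d τ)
    (hr : ∀ r < 8, σ.reg r = τ.reg r) : Setup K n d σ :=
  ⟨(hr 0 (by decide)).trans h.r0, (hr 1 (by decide)).trans h.r1, (hr 2 (by decide)).trans h.r2,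
    (hr 3 (by decide)).trans h.r3, (hr 4 (by decide)).trans h.r4, (hr 5 (by decide)).trans h.r5,
    (hr 6 (by decide)).trans h.r6, (hr 7 (by decide)).trans h.r7⟩

/-- The vectors in list number `K - 1 - r` that satisfy the constraints for the digit `r` of a tuple
of the first kind. -/
def RowA (bit : ℕ → ℕ → ℕ → ℕ) (K d y r : ℕ) : ℕ → Prop :=
  DigitsOne (bit (K - 1 - r)) d y (r + 1)

/-- The vectors in list number `K - r` that satisfy the constraints for the digit `r` of a tuple of
the second kind. -/
def RowB (bit : ℕ → ℕ → ℕ → ℕ) (K d y r : ℕ) : ℕ → Prop :=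
  DigitsOne (bit (K - r)) d (y / d ^ r) (K - r)

instance (bit : ℕ → ℕ → ℕ → ℕ) (K d y r : ℕ) : DecidablePred (RowA bit K d y r) := by
  unfold RowA; infer_instance

instance (bit : ℕ → ℕ → ℕ → ℕ) (K d y r : ℕ) : DecidablePred (RowB bit K d y r) := by
  unfold RowB; infer_instance

/-- The constraints given by the coordinate array `y` can all be satisfied, for the digits below
`c`. -/
def GoodArray (bit : ℕ → ℕ → ℕ → ℕ) (K n d c y : ℕ) : Prop :=
  ∀ r < c, (∃ a < n, RowA bit K d y r a) ∧ ∃ a < n, RowB bit K d y r a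

instance (bit : ℕ → ℕ → ℕ → ℕ) (K n d c : ℕ) : DecidablePred (GoodArray bit K n d c) := by
  unfold GoodArray; infer_instance

theorem goodArray_succ {bit : ℕ → ℕ → ℕ → ℕ} {K n d c y : ℕ} : GoodArray bit K n d (c + 1) y ↔
    GoodArray bit K n d c y ∧ (∃ a < n, RowA bit K d y c a) ∧ ∃ a < n, RowB bit K d y c a := by
  simp only [GoodArray, Nat.lt_succ_iff_lt_or_eq, or_imp, forall_and, forall_eq]
  tauto

/-- The tables in the memory are those of the maps `fA` and `fB`. -/
def HasTables (K n d : ℕ) (fA fB : ℕ → ℕ → ℕ) (mem : ℕ → ℕ) : Prop :=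
  (∀ r < K, ∀ a < n, mem (tableBase K n d + r * n + a) = fA r a) ∧
    ∀ r < K, ∀ a < n, mem (tableBase K n d + K * n + r * n + a) = fB r a

/-- The input is stored in the memory. -/
def HasInput (K n d : ℕ) (bit : ℕ → ℕ → ℕ → ℕ) (mem : ℕ → ℕ) : Prop :=
  ∀ j ≤ K, ∀ a < n, ∀ x < d, mem (3 + (j * n + a) * d + x) = bit j a x

theorem lt_tableBase {K n d j a x : ℕ} (hj : j ≤ K) (ha : a < n) (hx : x < d) :
    3 + (j * n + a) * d + x < tableBase K n d := by
  have h₁ := mul_add_lt_mul (c := K + 1) (show j < K + 1 by omega) ha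
  have h₂ := mul_add_lt_mul h₁ hx
  rw [tableBase]
  omega

theorem HasInput.congr {K n d : ℕ} {bit : ℕ → ℕ → ℕ → ℕ} {mem mem' : ℕ → ℕ}
    (h : HasInput K n d bit mem) (hm : ∀ x < tableBase K n d, mem' x = mem x) :
    HasInput K n d bit mem' := fun j hj a ha x hx => by
  rw [hm _ (lt_tableBase hj ha hx)]
  exact h j hj a ha x hx

/-- Computes the tables for the coordinate array in register `11`; register `12` tells whether it is
good. -/
def fillTables : Prog :=
  .seq (assign 12 (.lit 1)) <| .seq (assign 25 (.reg 11 + .lit 0)) <|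
  forUpTo 24 1 <|
    .seq (assign 13 (.reg 1 - .lit 1 - .reg 24)) <| .seq (assign 14 (.reg 11 + .lit 0)) <|
    .seq (assign 15 (.reg 24 + .lit 1)) <| .seq (assign 16 (.reg 4 + .reg 24 * .reg 2)) <|
    .seq fillRow <|
    .seq (assign 13 (.reg 1 - .reg 24)) <| .seq (assign 14 (.reg 25 + .lit 0)) <|
    .seq (assign 15 (.reg 1 - .reg 24)) <| .seq (assign 16 (.reg 5 + .reg 24 * .reg 2)) <|
    .seq fillRow <|
    assign 25 (.reg 25 / .reg 3)

/-- The rows of the first kind use the entries `0, …, c` of the array, those of the second kind the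
entries `c, …, K - 1`. Register `25` carries `y / d ^ c`, so the latter are also leading entries,
and one test routine serves both kinds. -/
theorem run_fillTables {w : ℕ} {τ : State} {bit : ℕ → ℕ → ℕ → ℕ} {K n d y L : ℕ} (hL : L < 2 ^ w)
    (hs : Setup K n d τ) (hy : τ.reg 11 = y) (hd0 : 0 < d) (hn0 : 0 < n) (hyL : y ≤ L)
    (hbit : ∀ j a x, bit j a x ≤ 1) (hin : HasInput K n d bit τ.mem) (hLo : outBase K n d ≤ L) :
    Run w fillTables τ (K * (n * (K * 32 + 120) + 100) + 10) fun τ' =>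
      (∀ x, x < tableBase K n d ∨ outBase K n d ≤ x → τ'.mem x = τ.mem x) ∧
      HasTables K n d (fun r => retract (RowA bit K d y r) n) (fun r => retract (RowB bit K d y r) n)
        τ'.mem ∧
      τ'.reg 12 = if GoodArray bit K n d K y then 1 else 0 := by
  have hKn : K ≤ K * n := Nat.le_mul_of_pos_right _ hn0
  have hob : outBase K n d = tableBase K n d + K * n + K * n := rfl
  have htb : 3 ≤ tableBase K n d := by unfold tableBase; omega
  have hw0 : w ≠ 0 := by rintro rfl; simp at hL; omega
  refine Run.assign_seq 1 (by simp) (by simpa using hw0) ?_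
  refine Run.assign_seq y (by simp [hy]) (by simp [hy]; omega) ?_
  refine Run.forUpTo (fun c σ => (∀ x, x < tableBase K n d ∨ outBase K n d ≤ x → σ.mem x = τ.mem x) ∧
    (∀ r < c, ∀ a < n, σ.mem (tableBase K n d + r * n + a) = retract (RowA bit K d y r) n a) ∧
    (∀ r < c, ∀ a < n, σ.mem (tableBase K n d + K * n + r * n + a) =
      retract (RowB bit K d y r) n a) ∧ σ.reg 25 = y / d ^ c ∧
    σ.reg 12 = if GoodArray bit K n d c y then 1 else 0) K (n * (K * 32 + 120) + 90)
    (by simp [hs.r1]) (by omega) (by simp [GoodArray]) ?_ ?_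
  · rintro c hc σ ⟨hm, hA, hB, h25, h12⟩ hσi hf
    have hs' : Setup K n d σ := hs.congr fun r hr => by
      interval_cases r <;> (rw [hf _ (by decide) (by decide) rfl]; simp)
    have h11 : σ.reg 11 = y := by rw [hf 11 (by decide) (by decide) rfl]; simp [hy]
    have hcn : c * n + n ≤ K * n := by
      have := Nat.mul_le_mul_right n (show c + 1 ≤ K by omega)
      rwa [add_mul, one_mul] at this
    have hcK : (c + 1) * 16 ≤ K * 16 := by omega
    have hJ : ∀ j ≤ K, 3 + (j * n + n) * d ≤ tableBase K n d := by
      intro j hj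
      have : (j * n + n) * d ≤ (K + 1) * n * d := by
        apply Nat.mul_le_mul_right
        rw [add_mul, one_mul]
        exact Nat.add_le_add_right (Nat.mul_le_mul_right _ hj) _
      rw [tableBase]
      omega
    have hin₁ : HasInput K n d bit σ.mem := hin.congr fun x hx => hm x (.inl hx)
    have hdiv : y / d ^ c ≤ y := Nat.div_le_self _ _
    have hT₁ : n * ((c + 1) * 16 + 60) ≤ n * (K * 16 + 60) := by gcongr
    have hT₂ : n * ((K - c) * 16 + 60) ≤ n * (K * 16 + 60) := by gcongr; omega
    have hT₃ : n * (K * 32 + 120) = n * (K * 16 + 60) + n * (K * 16 + 60) := by ring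
    refine Run.assign_seq (K - 1 - c) (by simp [hs'.r1, hσi]) (by simp [hs'.r1, hσi, hw0]; omega) ?_
    refine Run.assign_seq y (by simp [h11]) (by simp [h11]; omega) ?_
    refine Run.assign_seq (c + 1) (by simp [hσi]) (by simp [hσi, hw0]; omega) ?_
    refine Run.assign_seq (tableBase K n d + c * n) (by simp [hs'.r4, hσi, hs'.r2])
      (by simp [hs'.r4, hσi, hs'.r2]; omega) ?_
    refine Run.call (n * ((c + 1) * 16 + 60) + 20) (run_fillRow (L := L) (bit := bit (K - 1 - c))
      (n := n) (d := d) (j := K - 1 - c) (y := y) (c := c + 1) (ra := tableBase K n d + c * n) hL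
      (by simp [hs'.r2]) (by simp [hs'.r3]) (by simp) (by simp) (by simp) (by simp)
      hd0 hn0 hyL (by omega) (hbit _) (fun a ha x hx => hin₁ _ (by omega) a ha x hx)
      ((hJ _ (by omega)).trans (by omega)) (by omega) (by simp [h12]; split_ifs <;> omega)) ?_
    rintro σ₁ ⟨hm₁, hA₁, h12₁⟩ hf₁
    have hs₁ : Setup K n d σ₁ := hs'.congr fun r hr => by
      interval_cases r <;> (rw [hf₁ _ (by decide) rfl]; simp)
    have h11₁ : σ₁.reg 11 = y := by rw [hf₁ 11 (by decide) rfl]; simp [h11]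
    have h24₁ : σ₁.reg 24 = c := by rw [hf₁ 24 (by decide) rfl]; simp [hσi]
    have h25₁ : σ₁.reg 25 = y / d ^ c := by rw [hf₁ 25 (by decide) rfl]; simp [h25]
    simp only [State.setReg_mem] at hm₁
    have hin₂ : HasInput K n d bit σ₁.mem := hin₁.congr fun x hx => hm₁ x (by omega)
    refine Run.assign_seq (K - c) (by simp [hs₁.r1, h24₁]) (by simp [hs₁.r1, h24₁]; omega) ?_
    refine Run.assign_seq (y / d ^ c) (by simp [h25₁]) (by simp [h25₁]; omega) ?_
    refine Run.assign_seq (K - c) (by simp [hs₁.r1, h24₁]) (by simp [hs₁.r1, h24₁]; omega) ?_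
    refine Run.assign_seq (tableBase K n d + K * n + c * n) (by simp [hs₁.r5, h24₁, hs₁.r2])
      (by simp [hs₁.r5, h24₁, hs₁.r2]; omega) ?_
    refine Run.call (n * ((K - c) * 16 + 60) + 20) (run_fillRow (L := L) (bit := bit (K - c))
      (n := n) (d := d) (j := K - c) (y := y / d ^ c) (c := K - c)
      (ra := tableBase K n d + K * n + c * n) hL
      (by simp [hs₁.r2]) (by simp [hs₁.r3]) (by simp) (by simp) (by simp) (by simp)
      hd0 hn0 (by omega) (by omega) (hbit _) (fun a ha x hx => hin₂ _ (by omega) a ha x hx)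
      ((hJ _ (by omega)).trans (by omega)) (by omega)
      (by simp [h12₁, h12]; split_ifs <;> omega)) ?_
    rintro σ₂ ⟨hm₂, hB₂, h12₂⟩ hf₂
    have h3₂ : σ₂.reg 3 = d := by rw [hf₂ 3 (by decide) rfl]; simp [hs₁.r3]
    have h25₂ : σ₂.reg 25 = y / d ^ c := by rw [hf₂ 25 (by decide) rfl]; simp [h25₁]
    simp only [State.setReg_mem] at hm₂
    have hle : y / d ^ c / d ≤ y / d ^ c := Nat.div_le_self _ _
    refine Run.assign (y / d ^ (c + 1)) ?_ (by simp [h3₂, h25₂]; omega) ?_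
    · simp [h25₂, h3₂, pow_succ, Nat.div_div_eq_div_mul]
    · simp only [State.setReg_mem, State.setReg_reg, if_true]
      refine ⟨fun x hx => ?_, fun r hr a ha => ?_, fun r hr a ha => ?_, by simp, ?_⟩
      · rw [hm₂ x (by omega), hm₁ x (by omega), hm x hx]
      · by_cases hrc : r = c
        · rw [hrc, hm₂ _ (by omega)]
          exact hA₁ a ha
        · have hrn : r * n + n ≤ c * n := by
            have := Nat.mul_le_mul_right n (show r + 1 ≤ c by omega)
            rwa [add_mul, one_mul] at this
          rw [hm₂ _ (by omega), hm₁ _ (by omega)]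
          exact hA r (by omega) a ha
      · by_cases hrc : r = c
        · rw [hrc]
          exact hB₂ a ha
        · have hrn : r * n + n ≤ c * n := by
            have := Nat.mul_le_mul_right n (show r + 1 ≤ c by omega)
            rwa [add_mul, one_mul] at this
          rw [hm₂ _ (by omega), hm₁ _ (by omega)]
          exact hB r (by omega) a ha
      · simp only [show (12 : ℕ) ≠ 25 by decide, show (12 : ℕ) ≠ 24 by decide, if_false, h12₂]
        simp only [State.setReg_reg, show (12 : ℕ) ≠ 13 by decide, show (12 : ℕ) ≠ 14 by decide,
          show (12 : ℕ) ≠ 15 by decide, show (12 : ℕ) ≠ 16 by decide, if_false, h12₁, h12]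
        simp only [goodArray_succ]
        by_cases h₁ : GoodArray bit K n d c y <;>
        by_cases h₂ : ∃ a < n, RowA bit K d y c a <;>
        by_cases h₃ : ∃ a < n, RowB bit K d y c a <;>
        simp only [h₁, h₂, h₃, RowA, RowB] at * <;> simp [*]
  · rintro σ ⟨hm, hA, hB, -, h12⟩ - -
    exact ⟨hm, ⟨hA, hB⟩, h12⟩

end Tables

end STDiam

namespace STDiam

/-! ### Constructing the graph on the word-RAM: the edges -/

section Output

/-- The memory `m` up to the address `b`, followed by the list `l`, followed by zeros. -/
def withList (b : ℕ) (m : ℕ → ℕ) (l : List ℕ) : ℕ → ℕ :=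
  fun x => if x < b then m x else l.getD (x - b) 0

theorem withList_of_lt {b : ℕ} {m : ℕ → ℕ} {l : List ℕ} {x : ℕ} (h : x < b) :
    withList b m l x = m x := if_pos h

theorem withList_add {b : ℕ} {m : ℕ → ℕ} {l : List ℕ} (i : ℕ) :
    withList b m l (b + i) = l.getD i 0 := by
  rw [withList, if_neg (by omega), Nat.add_sub_cancel_left]

theorem withList_of_ge {b : ℕ} {m : ℕ → ℕ} {l : List ℕ} {x : ℕ} (h : b + l.length ≤ x) :
    withList b m l x = 0 := by
  rw [withList, if_neg (by omega), List.getD_eq_default _ _ (by omega)]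

theorem withList_append_singleton (b : ℕ) (m : ℕ → ℕ) (l : List ℕ) (v : ℕ) :
    (fun x => if x = b + l.length then v else withList b m l x) = withList b m (l ++ [v]) := by
  funext x
  unfold withList
  rcases lt_trichotomy x (b + l.length) with h | h | h
  · rw [if_neg (by omega)]
    split_ifs with hb
    · rfl
    · rw [List.getD_append _ _ _ _ (by omega)]
  · subst h
    rw [if_pos rfl, if_neg (by omega), Nat.add_sub_cancel_left, List.getD_append_right _ _ _ _ le_rfl]
    simp
  · rw [if_neg (by omega), if_neg (by omega), if_neg (by omega),
      List.getD_eq_default _ _ (by omega),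
      List.getD_eq_default _ _ (by rw [List.length_append, List.length_singleton]; omega)]

theorem State.setMem_withList {σ : State} {b : ℕ} {m : ℕ → ℕ} {l : List ℕ}
    (h : σ.mem = withList b m l) {a : ℕ} (ha : a = b + l.length) (v : ℕ) :
    (σ.setMem a v).mem = withList b m (l ++ [v]) := by
  rw [← withList_append_singleton]
  funext x
  rw [State.setMem_mem, h, ha]

/-- Appends the value of `e` to the output; register `9` holds the next free address. -/
def emit (e : Expr) : Prog := .seq (put (.reg 9) e) (assign 9 (.reg 9 + .lit 1))

theorem run_emit {w T : ℕ} {τ : State} {e : Expr} {b : ℕ} {m : ℕ → ℕ} {l : List ℕ} (v : ℕ)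
    {Q : State → Prop} (hw : b + l.length + 1 < 2 ^ w) (hm : τ.mem = withList b m l)
    (h9 : τ.reg 9 = b + l.length) (hv : e.eval τ = v) (hf : e.Fits w τ)
    (hQ : ∀ τ', τ'.mem = withList b m (l ++ [v]) → τ'.reg 9 = b + (l ++ [v]).length →
      (∀ r, r ≠ 9 → τ'.reg r = τ.reg r) → Q τ')
    (he : e.Below 32 := by simp) (hT : e.size + 5 ≤ T := by
      first | omega | (simp; done) | (simp; omega) | (simp; ring_nf; omega)) :
    Run w (emit e) τ T Q := by
  have hw0 : w ≠ 0 := by rintro rfl; simp at hw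
  refine Run.put_seq (b + l.length) v (by simp [h9]) hv (by simp) hf ?_ (hbe := he)
    (hT := by simp; omega)
  refine Run.assign (b + l.length + 1) (by simp [h9]) (by simp [h9, hw0]; omega) (hQ _ ?_ ?_ ?_)
    (hT := by simp; omega)
  · rw [State.setReg_mem]
    exact State.setMem_withList hm rfl v
  · simp [add_assoc]
  · intro r hr
    simp [hr]

/-- Appends the values of `a` and `e` to the output. -/
def emitEdge (a e : Expr) : Prog := .seq (emit a) (emit e)

theorem run_emitEdge {w T : ℕ} {τ : State} {a e : Expr} {b : ℕ} {m : ℕ → ℕ} {l : List ℕ} (u v : ℕ)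
    {Q : State → Prop} (hw : b + l.length + 2 < 2 ^ w) (hm : τ.mem = withList b m l)
    (h9 : τ.reg 9 = b + l.length) (hu : a.eval τ = u) (hfa : a.Fits w τ)
    (hv : ∀ τ' : State, (∀ r, r ≠ 9 → τ'.reg r = τ.reg r) → e.eval τ' = v ∧ e.Fits w τ')
    (hQ : ∀ τ', τ'.mem = withList b m (l ++ [u, v]) → τ'.reg 9 = b + (l ++ [u, v]).length → Q τ')
    (ha : a.Below 32 := by simp) (he : e.Below 32 := by simp)
    (hT : a.size + e.size + 10 ≤ T := by
      first | omega | (simp; done) | (simp; omega) | (simp; ring_nf; omega)) :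
    Run w (emitEdge a e) τ T Q := by
  refine Run.seq (a.size + 5) ?_ (by omega)
  refine run_emit u (by omega) hm h9 hu hfa (fun τ' hm' h9' hr => ?_) ha le_rfl
  refine run_emit v (by rw [List.length_append, List.length_singleton]; omega) hm' h9'
    (hv τ' hr).1 (hv τ' hr).2 (fun τ'' hm'' h9'' _ => hQ τ'' ?_ ?_) he (by omega)
  · rw [hm'', List.append_assoc]; rfl
  · rw [h9'', List.append_assoc]; rfl

/-- The list of the ends of the edges. -/
def flatten (E : List (ℕ × ℕ)) : List ℕ := E.flatMap fun e => [e.1, e.2]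

theorem flatten_append (E F : List (ℕ × ℕ)) : flatten (E ++ F) = flatten E ++ flatten F := by
  simp [flatten]

theorem length_flatten (E : List (ℕ × ℕ)) : (flatten E).length = 2 * E.length := by
  induction E with
  | nil => rfl
  | cons e E ih =>
    rw [flatten, List.flatMap_cons, List.length_append, ← flatten, ih]
    simp
    ring

theorem Tables.length_edgeAt_le (D : Tables) (X i e : ℕ) : (D.edgeAt X i e).length ≤ 1 := by
  rw [Tables.edgeAt]
  split_ifs <;> simp

end Output

/-! ### Writing the edges of one level -/

section Emission

/-- Applies the table at the address in register `14` to the digits of the number in register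
`13`. -/
def evalRows : Prog :=
  .seq (assign 15 (.lit 0)) <| .seq (assign 16 (.reg 13 + .lit 0)) <| .seq (assign 17 (.lit 1)) <|
  .seq (assign 18 (.reg 14 + .lit 0)) <|
  forUpTo 19 1 <|
    .seq (assign 15 (.reg 15 + .load (.reg 18 + .reg 16 % .reg 2) * .reg 17)) <|
    .seq (assign 17 (.reg 17 * .reg 2)) <| .seq (assign 16 (.reg 16 / .reg 2)) <|
    assign 18 (.reg 18 + .reg 2)

theorem run_evalRows {w : ℕ} {τ : State} {K n e rb L : ℕ} {f : ℕ → ℕ → ℕ} (hL : L < 2 ^ w)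
    (hn0 : 0 < n) (h1 : τ.reg 1 = K) (h2 : τ.reg 2 = n) (h13 : τ.reg 13 = e) (h14 : τ.reg 14 = rb)
    (hf : ∀ r < K, ∀ a < n, f r a < n) (hm : ∀ r < K, ∀ a < n, τ.mem (rb + r * n + a) = f r a)
    (hrb : rb + K * n ≤ L) (hp : n ^ K ≤ L) (he : e ≤ L) (h1L : 1 ≤ L) :
    Run w evalRows τ (K * 30 + 15) fun τ' => τ'.mem = τ.mem ∧ τ'.reg 15 = mapDig n K f e := by
  have hw0 : w ≠ 0 := by rintro rfl; simp at hL; omega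
  have hKn : K ≤ K * n := Nat.le_mul_of_pos_right _ hn0
  refine Run.assign_seq 0 (by simp) (by simp) ?_
  refine Run.assign_seq e (by simp [h13]) (by simp [h13]; omega) ?_
  refine Run.assign_seq 1 (by simp) (by simp [hw0]) ?_
  refine Run.assign_seq rb (by simp [h14]) (by simp [h14]; omega) ?_
  refine Run.forUpTo (fun c σ => σ.mem = τ.mem ∧ σ.reg 15 = mapDig n c f e ∧ σ.reg 16 = e / n ^ c ∧
    σ.reg 17 = n ^ c ∧ σ.reg 18 = rb + c * n) K 19
    (by simp [h1]) (by omega) (by simp [mapDig]) ?_ ?_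
  · rintro c hc σ ⟨hσm, h15, h16, h17, h18⟩ - hfr
    have h2' : σ.reg 2 = n := by rw [hfr 2 (by decide) (by decide) rfl]; simp [h2]
    have hmod : e / n ^ c % n < n := Nat.mod_lt _ hn0
    have hval : τ.mem (rb + c * n + e / n ^ c % n) = f c (dig n c e) := hm c hc _ hmod
    have hfl : f c (dig n c e) < n := hf c hc _ hmod
    have hlt : mapDig n (c + 1) f e < n ^ (c + 1) :=
      sum_digits_lt fun r hr => hf r (by omega) _ (dig_lt hn0 r e)
    have hsucc : mapDig n (c + 1) f e = mapDig n c f e + f c (dig n c e) * n ^ c :=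
      Finset.sum_range_succ _ _
    have hpc : n ^ (c + 1) ≤ n ^ K := Nat.pow_le_pow_right hn0 hc
    have hcn : c * n + n ≤ K * n := by
      have := Nat.mul_le_mul_right n (show c + 1 ≤ K by omega)
      rwa [add_mul, one_mul] at this
    have hd : e / n ^ c / n ≤ e := (Nat.div_le_self _ _).trans (Nat.div_le_self _ _)
    refine Run.assign_seq (mapDig n (c + 1) f e)
      (by simp [h15, h17, h18, h16, h2', hσm, hval, hsucc]) ?_ ?_
    · simp only [Expr.fits_add, Expr.fits_mul, Expr.fits_mod, Expr.fits_load, Expr.fits_reg,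
        Expr.eval_reg, Expr.eval_mul, Expr.eval_load, Expr.eval_add, Expr.eval_mod, true_and,
        h15, h16, h17, h18, h2', hσm, hval]
      omega
    refine Run.assign_seq (n ^ (c + 1)) (by simp [h17, h2', pow_succ]) ?_ ?_
    · simp only [Expr.fits_mul, Expr.fits_reg, Expr.eval_reg, true_and, State.setReg_reg]
      simp [h17, h2', ← pow_succ]
      omega
    refine Run.assign_seq (e / n ^ (c + 1))
      (by simp [h16, h2', pow_succ, Nat.div_div_eq_div_mul]) (by simp [h16, h2']; omega) ?_
    refine Run.assign (rb + (c + 1) * n) (by simp [h18, h2']; ring) (by simp [h18, h2']; omega) ?_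
    simp [hσm]
  · rintro σ ⟨hσm, h15, -⟩ - -
    exact ⟨hσm, h15⟩

/-- The loop common to the lowest, inner and top levels. A number `e` contributes at most one edge,
that is two words, and possibly none; `hcap` reserves room for the maximum. -/
theorem run_level {w : ℕ} {τ : State} {body : Prog} {D : Tables} {X i b T T' L : ℕ} {m : ℕ → ℕ}
    {l : List ℕ} (hL : L < 2 ^ w) (h7 : τ.reg 7 = D.n ^ D.K) (hm : τ.mem = withList b m l)
    (h9 : τ.reg 9 = b + l.length) (hcap : b + l.length + 2 * D.n ^ D.K + 1 ≤ L)
    (hbody : ∀ e < D.n ^ D.K, ∀ (σ : State) (l' : List ℕ), σ.mem = withList b m l' →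
      σ.reg 9 = b + l'.length → σ.reg 13 = e → b + l'.length + 2 < 2 ^ w →
      (∀ r < 32, r ≠ 13 → body.writes r = false → σ.reg r = τ.reg r) →
      Run w body σ T fun σ' => σ'.mem = withList b m (l' ++ flatten (D.edgeAt X i e)) ∧
        σ'.reg 9 = b + (l' ++ flatten (D.edgeAt X i e)).length)
    (h13 : body.writes 13 = false := by rfl) (h7' : body.writes 7 = false := by rfl)
    (hT : D.n ^ D.K * (T + 5) + 3 ≤ T' := by
      first | omega | (simp; done) | (simp; omega) | (simp; ring_nf; omega)) :
    Run w (forUpTo 13 7 body) τ T' fun σ' =>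
      σ'.mem = withList b m (l ++ flatten (D.levelEdges X i)) ∧
        σ'.reg 9 = b + (l ++ flatten (D.levelEdges X i)).length := by
  have hlen : ∀ j, (flatten ((List.range j).flatMap (D.edgeAt X i))).length ≤ 2 * j := by
    intro j
    rw [length_flatten, List.length_flatMap]
    refine Nat.mul_le_mul_left _ ((List.sum_le_card_nsmul _ 1 ?_).trans (by simp))
    intro x hx
    obtain ⟨e, -, rfl⟩ := List.mem_map.1 hx
    exact D.length_edgeAt_le X i e
  refine Run.forUpTo (fun j σ =>
    σ.mem = withList b m (l ++ flatten ((List.range j).flatMap (D.edgeAt X i))) ∧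
    σ.reg 9 = b + (l ++ flatten ((List.range j).flatMap (D.edgeAt X i))).length) _ T h7 (by omega)
    ?_ ?_ ?_ (hpi := h13) (hpn := h7') (hT := hT)
  · simp [flatten, hm, h9]
  · rintro j hj σ ⟨hσm, h9'⟩ hσj hfr
    have := hlen j
    refine (hbody j hj σ _ hσm h9' hσj ?_ hfr).post ?_
    · rw [List.length_append]
      omega
    · rintro σ' ⟨h₁, h₂⟩
      have : l ++ flatten ((List.range (j + 1)).flatMap (D.edgeAt X i)) =
          l ++ flatten ((List.range j).flatMap (D.edgeAt X i)) ++ flatten (D.edgeAt X i j) := by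
        rw [List.range_succ, List.flatMap_append, flatten_append, List.append_assoc]
        simp
      simp [this, h₁, h₂]
  · rintro σ ⟨h₁, h₂⟩ - -
    exact ⟨h₁, h₂⟩

/-- Appends the edge given by `a` and `e`, provided that the values of `x` and `y` agree. -/
def emitIfEq (x y a e : Expr) : Prog := cond (x - y + (y - x)) .skip (emitEdge a e)

theorem run_emitIfEq {w T : ℕ} {τ : State} {x y a e : Expr} {b : ℕ} {m : ℕ → ℕ} {l : List ℕ}
    (u v p q : ℕ) {D : Tables} {X i ee : ℕ}
    (hw : b + l.length + 2 < 2 ^ w) (hm : τ.mem = withList b m l)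
    (h9 : τ.reg 9 = b + l.length) (hx : x.eval τ = p) (hy : y.eval τ = q) (hfx : x.Fits w τ)
    (hfy : y.Fits w τ) (hp : p < 2 ^ w) (hq : q < 2 ^ w)
    (hu : a.eval τ = u) (hfa : a.Fits w τ)
    (hv : ∀ τ' : State, (∀ r, r ≠ 9 → τ'.reg r = τ.reg r) → e.eval τ' = v ∧ e.Fits w τ')
    (hc : D.EdgeCond X i ee ↔ p = q) (hlo : D.lowEnd X i ee = u) (hhi : D.highEnd X i ee = v)
    (hbx : x.Below 32 := by simp) (hby : y.Below 32 := by simp)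
    (ha : a.Below 32 := by simp) (he : e.Below 32 := by simp)
    (hT : 2 * x.size + 2 * y.size + a.size + e.size + 20 ≤ T := by
      first | omega | (simp; done) | (simp; omega) | (simp; ring_nf; omega)) :
    Run w (emitIfEq x y a e) τ T fun σ' =>
      σ'.mem = withList b m (l ++ flatten (D.edgeAt X i ee)) ∧
        σ'.reg 9 = b + (l ++ flatten (D.edgeAt X i ee)).length := by
  refine Run.cond ?_ (fun h => ?_) (fun h => ?_) (by simp [hbx, hby]) (by simp; omega)
  · simp only [Expr.fits_add, Expr.fits_sub, Expr.eval_sub, hx, hy, hfx, hfy, true_and]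
    omega
  · simp only [Expr.eval_add, Expr.eval_sub, hx, hy] at h
    have hn : ¬ D.EdgeCond X i ee := by rw [hc]; omega
    refine Run.skip ?_ (by simp; omega)
    simp [Tables.edgeAt, hn, flatten, hm, h9]
  · simp only [Expr.eval_add, Expr.eval_sub, hx, hy] at h
    have hn : D.EdgeCond X i ee := by rw [hc]; omega
    refine run_emitEdge u v hw hm h9 hu hfa hv (fun τ' h₁ h₂ => ?_) ha he (by simp; omega)
    simp only [Tables.edgeAt, hn, if_true, flatten, List.flatMap_cons, List.flatMap_nil, hlo, hhi,
      List.append_nil]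
    exact ⟨h₁, h₂⟩

end Emission

end STDiam

namespace STDiam

/-! ### The three kinds of levels -/

section Block

/-- Appends the edges for the coordinate array whose tables are in the memory; register `10` holds
the number of the first inner vertex that has not been used. -/
def emitBlock : Prog :=
  .seq (assign 14 (.reg 4 + .lit 0)) <|
  .seq (forUpTo 13 7 <| .seq evalRows <|
    emitIfEq (.load (.reg 4 + .reg 13 % .reg 2)) (.reg 13 % .reg 2)
      (.reg 15) (.reg 10 + .reg 13 / .reg 2)) <|
  .seq (assign 20 (.lit 1)) <| .seq (assign 21 (.reg 10 + .lit 0)) <|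
  .seq (assign 22 (.reg 1 - .lit 1)) <|
  .seq (forUpTo 23 22 <|
    .seq (assign 24 (.reg 20 * .reg 2)) <|
    .seq (forUpTo 13 7 <|
      emitEdge (.reg 21 + (.reg 13 / .reg 24 * .reg 20 + .reg 13 % .reg 20))
        (.reg 21 + .reg 6 + (.reg 13 / (.reg 24 * .reg 2) * .reg 24 + .reg 13 % .reg 24))) <|
    .seq (assign 20 (.reg 24 + .lit 0)) <| assign 21 (.reg 21 + .reg 6)) <|
  .seq (assign 14 (.reg 5 + .lit 0)) <|
  .seq (forUpTo 13 7 <| .seq evalRows <|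
    emitIfEq (.load (.reg 5 + (.reg 1 - .lit 1) * .reg 2 + .reg 13 / .reg 6)) (.reg 13 / .reg 6)
      (.reg 21 + .reg 13 % .reg 6) (.reg 7 + .reg 15)) <|
  assign 10 (.reg 10 + .reg 1 * .reg 6)

theorem Tables.innerId_add_one (D : Tables) (X i e : ℕ) : D.innerId X (i + 1) e =
    2 * D.n ^ D.K + X * D.K * D.n ^ (D.K - 1) + i * D.n ^ (D.K - 1) + e := by
  rw [innerId, Nat.add_sub_cancel]
  ring

/-- What is known while the edges for the coordinate array number `X` are written: the address `b` of
the output, the memory contents `m` below it, and a bound `L` for all numbers that occur. -/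
structure Emitting (w : ℕ) (D : Tables) (d X L b : ℕ) (m : ℕ → ℕ)
    (one : ℕ → ℕ → ℕ → ℕ → Prop) : Prop where
  ret : D.IsRetraction one
  hL : L < 2 ^ w
  hX : X < D.g
  tab : HasTables D.K D.n d (D.A X) (D.B X) m
  order_le : D.order ≤ L
  b_eq : b = outBase D.K D.n d + 4
  b_le : b ≤ L

namespace Emitting

variable {w d X L b : ℕ} {D : Tables} {m : ℕ → ℕ} {one : ℕ → ℕ → ℕ → ℕ → Prop} {τ : State}
  {l : List ℕ} (h : Emitting w D d X L b m one)

include h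

theorem word_ne_zero : w ≠ 0 := by
  rintro rfl
  have := h.hL
  have := h.b_eq
  have := h.b_le
  omega

theorem two_pow_le : 2 * D.n ^ D.K ≤ L := le_trans (by simp [Tables.order]) h.order_le

theorem base_le : 2 * D.n ^ D.K + X * D.K * D.n ^ (D.K - 1) + D.K * D.n ^ (D.K - 1) ≤ L := by
  refine le_trans ?_ h.order_le
  have := Nat.mul_le_mul_right (D.K * D.n ^ (D.K - 1)) (show X + 1 ≤ D.g from h.hX)
  rw [Tables.order, mul_assoc, mul_assoc D.g]
  rw [add_mul, one_mul] at this
  omega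

theorem load_A {σ : State} {l' : List ℕ} (hσ : σ.mem = withList b m l') {r a : ℕ} (hr : r < D.K)
    (ha : a < D.n) : σ.mem (tableBase D.K D.n d + r * D.n + a) = D.A X r a := by
  have := mul_add_lt_mul hr ha
  have : outBase D.K D.n d = tableBase D.K D.n d + D.K * D.n + D.K * D.n := rfl
  have := h.b_eq
  rw [hσ, withList_of_lt (by omega)]
  exact h.tab.1 r hr a ha

theorem load_B {σ : State} {l' : List ℕ} (hσ : σ.mem = withList b m l') {r a : ℕ} (hr : r < D.K)
    (ha : a < D.n) : σ.mem (tableBase D.K D.n d + D.K * D.n + r * D.n + a) = D.B X r a := by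
  have := mul_add_lt_mul hr ha
  have : outBase D.K D.n d = tableBase D.K D.n d + D.K * D.n + D.K * D.n := rfl
  have := h.b_eq
  rw [hσ, withList_of_lt (by omega)]
  exact h.tab.2 r hr a ha

/-- Removing digit 0 is division by `n`, and register `10` holds the number of the first vertex of
layer 1; the end in `S` is the value left by `evalRows`. -/
theorem run_lowLevel (hs : Setup D.K D.n d τ) (hm : τ.mem = withList b m l)
    (h9 : τ.reg 9 = b + l.length) (h14 : τ.reg 14 = tableBase D.K D.n d)
    (h10 : τ.reg 10 = 2 * D.n ^ D.K + X * D.K * D.n ^ (D.K - 1))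
    (hcap : b + l.length + 2 * D.n ^ D.K + 1 ≤ L) :
    Run w (forUpTo 13 7 <| .seq evalRows <|
      emitIfEq (.load (.reg 4 + .reg 13 % .reg 2)) (.reg 13 % .reg 2)
        (.reg 15) (.reg 10 + .reg 13 / .reg 2)) τ (D.n ^ D.K * (D.K * 30 + 70) + 3) fun σ' =>
      σ'.mem = withList b m (l ++ flatten (D.levelEdges X 0)) ∧
        σ'.reg 9 = b + (l ++ flatten (D.levelEdges X 0)).length := by
  have hn0 := h.ret.n_pos
  have hK0 := h.ret.K_pos
  have hL := h.hL
  have hob : outBase D.K D.n d = tableBase D.K D.n d + D.K * D.n + D.K * D.n := rfl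
  have hb := h.b_eq
  have hbL := h.b_le
  have hKn : D.n ≤ D.K * D.n := Nat.le_mul_of_pos_left _ hK0
  have hpL := h.two_pow_le
  refine run_level hL hs.r7 hm h9 hcap (T := D.K * 30 + 60) ?_ (hT := by ring_nf; omega)
  intro e he σ l' hσm hσ9 hσ13 hcap' hfr
  have hs' : Setup D.K D.n d σ := hs.congr fun r hr => by
    interval_cases r <;> exact hfr _ (by decide) (by decide) rfl
  have h14' : σ.reg 14 = tableBase D.K D.n d := (hfr 14 (by decide) (by decide) rfl).trans h14
  have h10' := (hfr 10 (by decide) (by decide) rfl).trans h10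
  refine Run.call (D.K * 30 + 15) (run_evalRows (K := D.K) (n := D.n) (e := e)
    (rb := tableBase D.K D.n d) (L := L) (f := D.A X) hL hn0 hs'.r1 hs'.r2 hσ13 h14'
    (h.ret.A_lt X h.hX) (fun r hr a ha => h.load_A hσm hr ha) (by omega) (by omega) (by omega)
    (by omega)) ?_
  rintro σ₁ ⟨hσ₁m, h15⟩ hf₁
  have hs₁ : Setup D.K D.n d σ₁ := hs'.congr fun r hr => by
    interval_cases r <;> exact hf₁ _ (by decide) rfl
  have h13₁ := (hf₁ 13 (by decide) rfl).trans hσ13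
  have h10₁ := (hf₁ 10 (by decide) rfl).trans h10'
  have h9₁ := (hf₁ 9 (by decide) rfl).trans hσ9
  have hmod : e % D.n < D.n := Nat.mod_lt _ hn0
  have hlow := h.ret.lowEnd_lt h.hX (Nat.zero_le _) he
  have hhigh := h.ret.highEnd_lt h.hX (Nat.zero_le _) he
  have hord := h.order_le
  have hlo : D.lowEnd X 0 e = mapDig D.n D.K (D.A X) e := by simp [Tables.lowEnd]
  have hhi : D.highEnd X 0 e = 2 * D.n ^ D.K + X * D.K * D.n ^ (D.K - 1) + e / D.n := by
    rw [Tables.highEnd, if_neg (by omega), Tables.innerId_add_one]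
    simp [drop, Nat.mod_one]
  have hA := h.ret.A_lt X h.hX 0 hK0 _ hmod
  have hld := h.load_A (hσ₁m.trans hσm) hK0 hmod
  rw [zero_mul, add_zero] at hld
  refine run_emitIfEq (mapDig D.n D.K (D.A X) e)
    (2 * D.n ^ D.K + X * D.K * D.n ^ (D.K - 1) + e / D.n) (D.A X 0 (e % D.n)) (e % D.n)
    hcap' (hσ₁m.trans hσm) h9₁ (by simp [hs₁.r4, h13₁, hs₁.r2, hld])
    (by simp [h13₁, hs₁.r2]) (by simp [hs₁.r4, h13₁, hs₁.r2]; omega)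
    (by simp [h13₁, hs₁.r2]; omega) (by omega) (by omega) (by simp [h15]) (by simp)
    (fun τ' hr => ?_) ?_ hlo hhi
  · simp [hr 10 (by decide), hr 13 (by decide), hr 2 (by decide), h10₁, h13₁, hs₁.r2]
    omega
  · simp only [Tables.EdgeCond, true_implies, and_iff_left_iff_imp]
    omega

/-- Removing the top digit is reduction modulo `n ^ (K - 1)`, and the top digit itself is the
quotient, without a further remainder. -/
theorem run_highLevel (hs : Setup D.K D.n d τ) (hm : τ.mem = withList b m l)
    (h9 : τ.reg 9 = b + l.length) (h14 : τ.reg 14 = tableBase D.K D.n d + D.K * D.n)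
    (h21 : τ.reg 21 = 2 * D.n ^ D.K + X * D.K * D.n ^ (D.K - 1) + (D.K - 1) * D.n ^ (D.K - 1))
    (hcap : b + l.length + 2 * D.n ^ D.K + 1 ≤ L) :
    Run w (forUpTo 13 7 <| .seq evalRows <|
      emitIfEq (.load (.reg 5 + (.reg 1 - .lit 1) * .reg 2 + .reg 13 / .reg 6)) (.reg 13 / .reg 6)
        (.reg 21 + .reg 13 % .reg 6) (.reg 7 + .reg 15)) τ (D.n ^ D.K * (D.K * 30 + 85) + 3)
      fun σ' => σ'.mem = withList b m (l ++ flatten (D.levelEdges X D.K)) ∧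
        σ'.reg 9 = b + (l ++ flatten (D.levelEdges X D.K)).length := by
  have hn0 := h.ret.n_pos
  have hK0 := h.ret.K_pos
  have hL := h.hL
  have hob : outBase D.K D.n d = tableBase D.K D.n d + D.K * D.n + D.K * D.n := rfl
  have hb := h.b_eq
  have hbL := h.b_le
  have hKn : D.n ≤ D.K * D.n := Nat.le_mul_of_pos_left _ hK0
  have hKn' : D.K ≤ D.K * D.n := Nat.le_mul_of_pos_right _ hn0
  have hpL := h.two_pow_le
  have hw0 := h.word_ne_zero
  refine run_level hL hs.r7 hm h9 hcap (T := D.K * 30 + 75) ?_ (hT := by ring_nf; omega)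
  intro e he σ l' hσm hσ9 hσ13 hcap' hfr
  have hs' : Setup D.K D.n d σ := hs.congr fun r hr => by
    interval_cases r <;> exact hfr _ (by decide) (by decide) rfl
  have h14' := (hfr 14 (by decide) (by decide) rfl).trans h14
  have h21' := (hfr 21 (by decide) (by decide) rfl).trans h21
  refine Run.call (D.K * 30 + 15) (run_evalRows (K := D.K) (n := D.n) (e := e)
    (rb := tableBase D.K D.n d + D.K * D.n) (L := L) (f := D.B X) hL hn0 hs'.r1 hs'.r2 hσ13 h14'
    (h.ret.B_lt X h.hX) (fun r hr a ha => h.load_B hσm hr ha) (by omega) (by omega) (by omega)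
    (by omega)) ?_
  rintro σ₁ ⟨hσ₁m, h15⟩ hf₁
  have hs₁ : Setup D.K D.n d σ₁ := hs'.congr fun r hr => by
    interval_cases r <;> exact hf₁ _ (by decide) rfl
  have h13₁ := (hf₁ 13 (by decide) rfl).trans hσ13
  have h21₁ := (hf₁ 21 (by decide) rfl).trans h21'
  have h9₁ := (hf₁ 9 (by decide) rfl).trans hσ9
  have htop : e / D.n ^ (D.K - 1) < D.n := by
    rw [← dig_top hn0 hK0 he]
    exact dig_lt hn0 _ _
  have hlow := h.ret.lowEnd_lt h.hX le_rfl he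
  have hhigh := h.ret.highEnd_lt h.hX le_rfl he
  have hord := h.order_le
  have hlo : D.lowEnd X D.K e = 2 * D.n ^ D.K + X * D.K * D.n ^ (D.K - 1) +
      (D.K - 1) * D.n ^ (D.K - 1) + e % D.n ^ (D.K - 1) := by
    obtain ⟨K', hK'⟩ : ∃ K', D.K = K' + 1 := ⟨D.K - 1, by omega⟩
    rw [Tables.lowEnd, if_neg (by omega)]
    simp only [hK']
    rw [Tables.innerId_add_one]
    simp only [drop, hK', Nat.add_sub_cancel]
    rw [← hK', Nat.div_eq_of_lt he]
    simp
  have hhi : D.highEnd X D.K e = D.n ^ D.K + mapDig D.n D.K (D.B X) e := by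
    rw [Tables.highEnd, if_pos rfl]
  have hB := h.ret.B_lt X h.hX (D.K - 1) (by omega) _ htop
  have hld := h.load_B (hσ₁m.trans hσm) (show D.K - 1 < D.K by omega) htop
  have hrow := mul_add_lt_mul (show D.K - 1 < D.K by omega) htop
  have hmodle : e % D.n ^ (D.K - 1) ≤ e := Nat.mod_le _ _
  refine run_emitIfEq (2 * D.n ^ D.K + X * D.K * D.n ^ (D.K - 1) +
      (D.K - 1) * D.n ^ (D.K - 1) + e % D.n ^ (D.K - 1))
    (D.n ^ D.K + mapDig D.n D.K (D.B X) e) (D.B X (D.K - 1) (e / D.n ^ (D.K - 1)))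
    (e / D.n ^ (D.K - 1)) hcap' (hσ₁m.trans hσm) h9₁
    (by simp [hs₁.r5, h13₁, hs₁.r2, hs₁.r6, hs₁.r1, hld])
    (by simp [h13₁, hs₁.r6]) ?_
    (by simp [h13₁, hs₁.r6]; omega) (by omega) (by omega) (by simp [h21₁, h13₁, hs₁.r6]) ?_
    (fun τ' hr => ?_) ?_ hlo hhi
  · simp [hs₁.r5, h13₁, hs₁.r2, hs₁.r6, hs₁.r1, hw0]
    generalize e / D.n ^ (D.K - 1) = t at hrow htop ⊢
    generalize (D.K - 1) * D.n = t' at hrow ⊢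
    omega
  · simp [h21₁, h13₁, hs₁.r6]
    omega
  · simp [hr 7 (by decide), hr 15 (by decide), hs₁.r7, h15]
    omega
  · simp only [Tables.EdgeCond, true_implies, and_iff_right_iff_imp]
    omega

/-- Neither tables nor conditions are needed between inner layers. Registers `20` and `24` hold the
place values of the digits `i` and `i + 1`, and register `21` the number of the first vertex of
layer `i + 1`. -/
theorem run_midLevel {i : ℕ} (hi : i + 1 < D.K) (hs : Setup D.K D.n d τ)
    (hm : τ.mem = withList b m l) (h9 : τ.reg 9 = b + l.length)
    (h20 : τ.reg 20 = D.n ^ i) (h24 : τ.reg 24 = D.n ^ (i + 1))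
    (h21 : τ.reg 21 = 2 * D.n ^ D.K + X * D.K * D.n ^ (D.K - 1) + i * D.n ^ (D.K - 1))
    (hcap : b + l.length + 2 * D.n ^ D.K + 1 ≤ L) :
    Run w (forUpTo 13 7 <|
      emitEdge (.reg 21 + (.reg 13 / .reg 24 * .reg 20 + .reg 13 % .reg 20))
        (.reg 21 + .reg 6 + (.reg 13 / (.reg 24 * .reg 2) * .reg 24 + .reg 13 % .reg 24)))
      τ (D.n ^ D.K * 50 + 3) fun σ' =>
      σ'.mem = withList b m (l ++ flatten (D.levelEdges X (i + 1))) ∧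
        σ'.reg 9 = b + (l ++ flatten (D.levelEdges X (i + 1))).length := by
  have hn0 := h.ret.n_pos
  have hL := h.hL
  have hpL := h.two_pow_le
  refine run_level hL hs.r7 hm h9 hcap (T := 45) ?_
  intro e he σ l' hσm hσ9 hσ13 hcap' hfr
  have hs' : Setup D.K D.n d σ := hs.congr fun r hr => by
    interval_cases r <;> exact hfr _ (by decide) (by decide) rfl
  have h20' := (hfr 20 (by decide) (by decide) rfl).trans h20
  have h21' := (hfr 21 (by decide) (by decide) rfl).trans h21
  have h24' := (hfr 24 (by decide) (by decide) rfl).trans h24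
  have hord := h.order_le
  have hlow := h.ret.lowEnd_lt h.hX (show i + 1 ≤ D.K by omega) he
  have hhigh := h.ret.highEnd_lt h.hX (show i + 1 ≤ D.K by omega) he
  have hlo : D.lowEnd X (i + 1) e = 2 * D.n ^ D.K + X * D.K * D.n ^ (D.K - 1) +
      i * D.n ^ (D.K - 1) + (e / D.n ^ (i + 1) * D.n ^ i + e % D.n ^ i) := by
    rw [Tables.lowEnd, if_neg (by omega), Tables.innerId_add_one]
    rfl
  have hhi : D.highEnd X (i + 1) e = 2 * D.n ^ D.K + X * D.K * D.n ^ (D.K - 1) +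
      i * D.n ^ (D.K - 1) + D.n ^ (D.K - 1) +
      (e / D.n ^ (i + 1 + 1) * D.n ^ (i + 1) + e % D.n ^ (i + 1)) := by
    rw [Tables.highEnd, if_neg (by omega), Tables.innerId_add_one, drop]
    ring
  rw [hlo] at hlow
  rw [hhi] at hhigh
  have hc : D.EdgeCond X (i + 1) e := ⟨fun h => by omega, fun h => by omega⟩
  have hp2 : D.n ^ (i + 1) * D.n ≤ D.n ^ D.K := by
    rw [← pow_succ]
    exact Nat.pow_le_pow_right hn0 hi
  have hd₁ : e / D.n ^ (i + 1) ≤ e := Nat.div_le_self _ _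
  have hd₂ : e / D.n ^ (i + 1 + 1) ≤ e := Nat.div_le_self _ _
  refine run_emitEdge (D.lowEnd X (i + 1) e) (D.highEnd X (i + 1) e) hcap' hσm hσ9
    (by simp [hlo, h20', h21', h24', hσ13]) ?_ (fun τ' hr => ⟨?_, ?_⟩) fun τ' h₁ h₂ => ?_
  · simp [h20', h21', h24', hσ13]
    generalize e % D.n ^ i = t₁ at hlow ⊢
    generalize e / D.n ^ (i + 1) * D.n ^ i = t₂ at hlow ⊢
    generalize e / D.n ^ (i + 1) = t₃ at hd₁ ⊢
    omega
  · simp [hhi, hr 21 (by decide), hr 24 (by decide), hr 6 (by decide), hr 2 (by decide),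
      hr 13 (by decide), h21', h24', hs'.r2, hs'.r6, hσ13, ← pow_succ]
  · simp [hr 21 (by decide), hr 24 (by decide), hr 6 (by decide), hr 2 (by decide),
      hr 13 (by decide), h21', h24', hs'.r2, hs'.r6, hσ13, ← pow_succ]
    rw [← pow_succ] at hp2
    generalize e % D.n ^ (i + 1) = t₁ at hhigh ⊢
    generalize e / D.n ^ (i + 1 + 1) * D.n ^ (i + 1) = t₂ at hhigh ⊢
    generalize e / D.n ^ (i + 1 + 1) = t₃ at hd₂ ⊢
    generalize D.n ^ (i + 1 + 1) = t₄ at hp2 ⊢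
    omega
  · simp only [Tables.edgeAt, hc, if_true, flatten, List.flatMap_cons, List.flatMap_nil,
      List.append_nil]
    exact ⟨h₁, h₂⟩

end Emitting

end Block

end STDiam

namespace STDiam

/-! ### All edges for one coordinate array -/

section Block

namespace Emitting

variable {w d X L b : ℕ} {D : Tables} {m : ℕ → ℕ} {one : ℕ → ℕ → ℕ → ℕ → Prop} {τ : State}
  {l : List ℕ} (h : Emitting w D d X L b m one)

/-- The edges between the layers up to `i`. -/
def _root_.STDiam.Tables.lowerEdges (D : Tables) (X i : ℕ) : List (ℕ × ℕ) :=
  (List.range i).flatMap (D.levelEdges X)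

theorem _root_.STDiam.Tables.lowerEdges_succ (D : Tables) (X i : ℕ) :
    D.lowerEdges X (i + 1) = D.lowerEdges X i ++ D.levelEdges X i := by
  simp [Tables.lowerEdges, List.range_succ]

theorem _root_.STDiam.Tables.length_lowerEdges_le (D : Tables) (X : ℕ) {i : ℕ} (hi : i ≤ D.K + 1) :
    (D.lowerEdges X i).length ≤ (D.blockEdges X).length := by
  obtain ⟨c, hc⟩ := Nat.exists_eq_add_of_le hi
  rw [show D.blockEdges X = D.lowerEdges X (D.K + 1) from rfl, hc]
  clear hc hi
  induction c with
  | zero => exact le_rfl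
  | succ c ih => rw [← add_assoc, Tables.lowerEdges_succ, List.length_append]; omega

include h

theorem run_midLevels (hs : Setup D.K D.n d τ)
    (hm : τ.mem = withList b m (l ++ flatten (D.lowerEdges X 1)))
    (h9 : τ.reg 9 = b + (l ++ flatten (D.lowerEdges X 1)).length)
    (h20 : τ.reg 20 = 1) (h21 : τ.reg 21 = 2 * D.n ^ D.K + X * D.K * D.n ^ (D.K - 1))
    (h22 : τ.reg 22 = D.K - 1)
    (hcap : b + l.length + 2 * (D.blockEdges X).length + 2 * D.n ^ D.K + 1 ≤ L) :
    Run w (forUpTo 23 22 <|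
      .seq (assign 24 (.reg 20 * .reg 2)) <|
      .seq (forUpTo 13 7 <|
        emitEdge (.reg 21 + (.reg 13 / .reg 24 * .reg 20 + .reg 13 % .reg 20))
          (.reg 21 + .reg 6 + (.reg 13 / (.reg 24 * .reg 2) * .reg 24 + .reg 13 % .reg 24))) <|
      .seq (assign 20 (.reg 24 + .lit 0)) <| assign 21 (.reg 21 + .reg 6))
      τ ((D.K - 1) * (D.n ^ D.K * 50 + 20) + 3) fun σ' =>
      σ'.mem = withList b m (l ++ flatten (D.lowerEdges X D.K)) ∧
        σ'.reg 9 = b + (l ++ flatten (D.lowerEdges X D.K)).length ∧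
        σ'.reg 21 = 2 * D.n ^ D.K + X * D.K * D.n ^ (D.K - 1) + (D.K - 1) * D.n ^ (D.K - 1) := by
  have hn0 := h.ret.n_pos
  have hK0 := h.ret.K_pos
  have hL := h.hL
  have hbL := h.base_le
  have hpL := h.two_pow_le
  have hKp : D.K - 1 < D.n ^ (D.K - 1) * D.K := by
    have := Nat.le_mul_of_pos_left D.K (h.ret.pow_pos (D.K - 1))
    omega
  rw [mul_comm _ D.K] at hKp
  refine Run.forUpTo (fun i σ =>
    σ.mem = withList b m (l ++ flatten (D.lowerEdges X (i + 1))) ∧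
    σ.reg 9 = b + (l ++ flatten (D.lowerEdges X (i + 1))).length ∧ σ.reg 20 = D.n ^ i ∧
    σ.reg 21 = 2 * D.n ^ D.K + X * D.K * D.n ^ (D.K - 1) + i * D.n ^ (D.K - 1)) (D.K - 1)
    (D.n ^ D.K * 50 + 15) h22 (by omega) (by simp [hm, h9, h20, h21]) ?_ ?_
  · rintro i hi σ ⟨hσm, h9', h20', h21'⟩ - hfr
    have hs' : Setup D.K D.n d σ := hs.congr fun r hr => by
      interval_cases r <;> exact hfr _ (by decide) (by decide) rfl
    have hpi : D.n ^ (i + 1) ≤ D.n ^ D.K := Nat.pow_le_pow_right hn0 (by omega)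
    have hlen := D.length_lowerEdges_le X (show i + 1 ≤ D.K + 1 by omega)
    refine Run.assign_seq (D.n ^ (i + 1)) (by simp [h20', hs'.r2, pow_succ]) ?_ ?_
    · simp only [Expr.fits_mul, Expr.fits_reg, true_and, Expr.eval_reg, h20', hs'.r2]
      rw [← pow_succ]
      omega
    have hq : (i + 1) * D.n ^ (D.K - 1) ≤ D.K * D.n ^ (D.K - 1) := by gcongr; omega
    refine Run.call (D.n ^ D.K * 50 + 3) (h.run_midLevel (i := i) (by omega)
      (hs'.congr fun r hr => by interval_cases r <;> simp)
      (by rw [State.setReg_mem]; exact hσm) (by simpa using h9') (by simp [h20']) (by simp)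
      (by simp [h21']) ?_) ?_
    · rw [List.length_append, length_flatten]
      omega
    rintro σ₁ ⟨hσ₁m, h9₁⟩ hf₁
    have h24₁ : σ₁.reg 24 = D.n ^ (i + 1) := by rw [hf₁ 24 (by decide) rfl]; simp
    have h21₁ : σ₁.reg 21 = 2 * D.n ^ D.K + X * D.K * D.n ^ (D.K - 1) + i * D.n ^ (D.K - 1) := by
      rw [hf₁ 21 (by decide) rfl]; simpa using h21'
    have h6₁ : σ₁.reg 6 = D.n ^ (D.K - 1) := by
      rw [hf₁ 6 (by decide) rfl]; simpa using hs'.r6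
    rw [List.append_assoc, ← flatten_append, ← Tables.lowerEdges_succ] at hσ₁m h9₁
    rw [add_mul, one_mul] at hq
    generalize hP : D.n ^ (i + 1) = P at hpi h24₁ ⊢
    refine Run.assign_seq P (by simp [h24₁]) (by simp [h24₁]; omega) ?_
    refine Run.assign (2 * D.n ^ D.K + X * D.K * D.n ^ (D.K - 1) + (i + 1) * D.n ^ (D.K - 1))
      (by simp [h21₁, h6₁]; ring) (by simp [h21₁, h6₁]; omega) ?_
    simp only [State.setReg_mem, State.setReg_reg]
    exact ⟨hσ₁m, by simpa using h9₁, by simp, by simp⟩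
  · rintro σ ⟨h₁, h₂, -, h₃⟩ - -
    rw [show D.K - 1 + 1 = D.K by omega] at h₁ h₂
    exact ⟨h₁, h₂, h₃⟩

theorem run_emitBlock (hs : Setup D.K D.n d τ) (hm : τ.mem = withList b m l)
    (h9 : τ.reg 9 = b + l.length)
    (h10 : τ.reg 10 = 2 * D.n ^ D.K + X * D.K * D.n ^ (D.K - 1))
    (hcap : b + l.length + 2 * (D.blockEdges X).length + 2 * D.n ^ D.K + 1 ≤ L) :
    Run w emitBlock τ ((D.K + 1) * D.n ^ D.K * 250 + 50) fun τ' =>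
      τ'.mem = withList b m (l ++ flatten (D.blockEdges X)) ∧
      τ'.reg 9 = b + (l ++ flatten (D.blockEdges X)).length ∧
      τ'.reg 10 = 2 * D.n ^ D.K + (X + 1) * D.K * D.n ^ (D.K - 1) := by
  have hK0 := h.ret.K_pos
  have hL := h.hL
  have hbL := h.b_le
  have hb := h.b_eq
  have hob : outBase D.K D.n d = tableBase D.K D.n d + D.K * D.n + D.K * D.n := rfl
  have hpL := h.two_pow_le
  have hbase := h.base_le
  have hw0 := h.word_ne_zero
  have hp0 := h.ret.pow_pos D.K
  have hKq : D.K ≤ D.K * D.n ^ (D.K - 1) := Nat.le_mul_of_pos_right _ (h.ret.pow_pos _)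
  have hTa : D.n ^ D.K * (D.K * 30 + 70) = D.K * D.n ^ D.K * 30 + D.n ^ D.K * 70 := by ring
  have hTb : D.n ^ D.K * (D.K * 30 + 85) = D.K * D.n ^ D.K * 30 + D.n ^ D.K * 85 := by ring
  have hTc : (D.K - 1) * (D.n ^ D.K * 50 + 20) ≤ D.K * D.n ^ D.K * 70 := by
    calc _ ≤ D.K * (D.n ^ D.K * 50 + D.n ^ D.K * 20) := by gcongr <;> omega
      _ = _ := by ring
  have hT : (D.K + 1) * D.n ^ D.K * 250 = D.K * D.n ^ D.K * 250 + D.n ^ D.K * 250 := by ring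
  refine Run.assign_seq (tableBase D.K D.n d) (by simp [hs.r4]) (by simp [hs.r4]; omega) ?_
  have h0len := D.length_lowerEdges_le X (show 0 ≤ D.K + 1 by omega)
  refine Run.call (D.n ^ D.K * (D.K * 30 + 70) + 3) (h.run_lowLevel
    (hs.congr fun r hr => by interval_cases r <;> simp) (by rw [State.setReg_mem]; exact hm)
    (by simpa using h9) (by simp) (by simpa using h10) (by omega)) ?_
  rintro σ₁ ⟨hm₁, h9₁⟩ hf₁
  have hs₁ : Setup D.K D.n d σ₁ := hs.congr fun r hr => by
    interval_cases r <;> (rw [hf₁ _ (by decide) rfl]; simp)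
  have h10₁ : σ₁.reg 10 = 2 * D.n ^ D.K + X * D.K * D.n ^ (D.K - 1) := by
      rw [hf₁ 10 (by decide) rfl]; simpa using h10
  have hl₁ : D.levelEdges X 0 = D.lowerEdges X 1 := by simp [Tables.lowerEdges]
  rw [hl₁] at hm₁ h9₁
  refine Run.assign_seq 1 (by simp) (by simp [hw0]) ?_
  refine Run.assign_seq (2 * D.n ^ D.K + X * D.K * D.n ^ (D.K - 1)) (by simp [h10₁])
    (by simp [h10₁]; omega) ?_
  refine Run.assign_seq (D.K - 1) (by simp [hs₁.r1]) (by simp [hs₁.r1, hw0]; omega) ?_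
  refine Run.call ((D.K - 1) * (D.n ^ D.K * 50 + 20) + 3) (h.run_midLevels (l := l)
    (hs₁.congr fun r hr => by interval_cases r <;> simp) (by simpa using hm₁)
    (by simpa using h9₁) (by simp) (by simp) (by simp) hcap) ?_
  rintro σ₂ ⟨hm₂, h9₂, h21₂⟩ hf₂
  have hs₂ : Setup D.K D.n d σ₂ := hs₁.congr fun r hr => by
    interval_cases r <;> (rw [hf₂ _ (by decide) rfl]; simp)
  have h10₂ : σ₂.reg 10 = 2 * D.n ^ D.K + X * D.K * D.n ^ (D.K - 1) := by
      rw [hf₂ 10 (by decide) rfl]; simpa using h10₁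
  refine Run.assign_seq (tableBase D.K D.n d + D.K * D.n) (by simp [hs₂.r5])
    (by simp [hs₂.r5]; omega) ?_
  have h2len := D.length_lowerEdges_le X (show D.K ≤ D.K + 1 by omega)
  refine Run.call (D.n ^ D.K * (D.K * 30 + 85) + 3) (h.run_highLevel
    (hs₂.congr fun r hr => by interval_cases r <;> simp) (by rw [State.setReg_mem]; exact hm₂)
    (by simpa using h9₂) (by simp) (by simpa using h21₂) ?_) ?_
  · rw [List.length_append, length_flatten]
    omega
  rintro σ₃ ⟨hm₃, h9₃⟩ hf₃
  have hs₃ : Setup D.K D.n d σ₃ := hs₂.congr fun r hr => by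
    interval_cases r <;> (rw [hf₃ _ (by decide) rfl]; simp)
  have h10₃ : σ₃.reg 10 = 2 * D.n ^ D.K + X * D.K * D.n ^ (D.K - 1) := by
      rw [hf₃ 10 (by decide) rfl]; simpa using h10₂
  rw [List.append_assoc, ← flatten_append, ← Tables.lowerEdges_succ] at hm₃ h9₃
  refine Run.assign (2 * D.n ^ D.K + (X + 1) * D.K * D.n ^ (D.K - 1))
    (by simp [h10₃, hs₃.r1, hs₃.r6]; ring) (by simp [h10₃, hs₃.r1, hs₃.r6]; omega) ?_
  rw [show D.blockEdges X = D.lowerEdges X (D.K + 1) from rfl]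
  exact ⟨by simpa using hm₃, by simpa using h9₃, by simp⟩

end Emitting

end Block

end STDiam

namespace STDiam

/-! ### The tables of an instance -/

section Instance

variable (bit : ℕ → ℕ → ℕ → ℕ) (K n d : ℕ)

/-- The good coordinate arrays are used in increasing order; if all lists have only one vector, a
single coordinate at which all of them have ones is used instead. -/
noncomputable def ovTables : Tables where
  n := n
  K := K
  g := if n = 1 then (if ∃ x < d, ∀ j < K + 1, bit j 0 x = 1 then 1 else 0) else
    Nat.count (GoodArray bit K n d K) (d ^ K)
  A := fun X r a => if n = 1 then 0 else
    retract (RowA bit K d (Nat.nth (GoodArray bit K n d K) X) r) n a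
  B := fun X r a => if n = 1 then 0 else
    retract (RowB bit K d (Nat.nth (GoodArray bit K n d K) X) r) n a

@[simp] theorem ovTables_n : (ovTables bit K n d).n = n := rfl
@[simp] theorem ovTables_K : (ovTables bit K n d).K = K := rfl

theorem ovTables_g_le (hd : 0 < d) : (ovTables bit K n d).g ≤ d ^ K := by
  have : 0 < d ^ K := by positivity
  simp only [ovTables]
  split_ifs
  · omega
  · omega
  · exact Nat.count_le _

variable {bit K n d}

theorem exists_count_eq {p : ℕ → Prop} [DecidablePred p] {X N : ℕ} (h : X < Nat.count p N) :
    ∃ y < N, p y ∧ Nat.count p y = X := by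
  induction N with
  | zero => simp at h
  | succ N ih =>
    rw [Nat.count_succ] at h
    by_cases hX : X < Nat.count p N
    · obtain ⟨y, hy, h₁, h₂⟩ := ih hX
      exact ⟨y, by omega, h₁, h₂⟩
    · split_ifs at h with hp
      · exact ⟨N, by omega, hp, by omega⟩
      · omega

/-- The constraint satisfied by the vectors allowed for a coordinate array: at its entry number `m`
the vector `a` in the list number `j` has a one. -/
theorem exists_isRetraction_ovTables (hn : 0 < n) (hK : 0 < K) (hd : 0 < d) :
    ∃ f : ℕ → ℕ → ℕ, (∀ X m, f X m < d) ∧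
      (ovTables bit K n d).IsRetraction fun X m j a => bit j a (f X m) = 1 := by
  by_cases h1 : n = 1
  · by_cases hx : ∃ x < d, ∀ j < K + 1, bit j 0 x = 1
    · obtain ⟨x, hxd, hxj⟩ := hx
      refine ⟨fun _ _ => x, fun _ _ => hxd, hn, hK, ?_, ?_, ?_, ?_, ?_, ?_⟩
      · intro X _ r _ a _; simp [ovTables, h1]
      · intro X _ r _ a _; simp [ovTables, h1]
      · intro X _ r _ a _; simp [ovTables, h1]
      · intro X _ r _ a _; simp [ovTables, h1]
      · intro X _ r hr a _ m hm
        simp only [ovTables, h1, if_true]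
        exact hxj _ (by omega)
      · intro X _ r hr a _ m hm hm'
        simp only [ovTables, h1, if_true]
        exact hxj _ (by omega)
    -- Here no label is in use, and every requirement is vacuous.
    · refine ⟨fun _ _ => 0, fun _ _ => hd, hn, hK, ?_, ?_, ?_, ?_, ?_, ?_⟩ <;>
      · intro X hX
        simp only [ovTables, h1, hx, if_true, if_false] at hX
        omega
  · have good : ∀ X < (ovTables bit K n d).g,
        GoodArray bit K n d K (Nat.nth (GoodArray bit K n d K) X) := by
      intro X hX
      simp only [ovTables, h1, if_false] at hX
      obtain ⟨y, -, hy, rfl⟩ := exists_count_eq hX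
      rwa [Nat.nth_count hy]
    refine ⟨fun X m => Nat.nth (GoodArray bit K n d K) X / d ^ m % d, fun _ _ => Nat.mod_lt _ hd,
      hn, hK, ?_, ?_, ?_, ?_, ?_, ?_⟩
    · intro X _ r _ a ha
      simp only [ovTables, h1, if_false]
      exact retract_lt ha
    · intro X _ r _ a ha
      simp only [ovTables, h1, if_false]
      exact retract_lt ha
    · intro X hX r hr a ha
      simp only [ovTables, h1, if_false]
      exact retract_of_mem (retract_spec (good X hX r hr).1 a)
    · intro X hX r hr a ha
      simp only [ovTables, h1, if_false]
      exact retract_of_mem (retract_spec (good X hX r hr).2 a)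
    · intro X hX r hr a ha m hm
      simp only [ovTables, h1, if_false]
      exact retract_spec (good X hX r hr).1 a m (by omega)
    · intro X hX r hr a ha m hm hm'
      simp only [ovTables, h1, if_false] at hm' ⊢
      have := retract_spec (good X hX r hr).2 a (m - r) (by omega)
      rwa [Nat.div_div_eq_div_mul, ← pow_add, Nat.add_sub_cancel' hm] at this

/-- If there is no solution, then for every pair of tuples some coordinate array is allowed. -/
theorem exists_array_of_no_solution (hn : 0 < n) (hK : 0 < K)
    (h : ∀ a : ℕ → ℕ, (∀ j ≤ K, a j < n) → ∃ x < d, ∀ j ≤ K, bit j (a j) x = 1) {α β : ℕ}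
    (hα : α < n ^ K) (hβ : β < n ^ K) : ∃ X < (ovTables bit K n d).g,
      (∀ r < K, (ovTables bit K n d).A X r (dig n r α) = dig n r α) ∧
      ∀ r < K, (ovTables bit K n d).B X r (dig n r β) = dig n r β := by
  by_cases h1 : n = 1
  · obtain ⟨x, hx, hx'⟩ := h (fun _ => 0) fun _ _ => hn
    have : ∃ x < d, ∀ j < K + 1, bit j 0 x = 1 := ⟨x, hx, fun j hj => hx' j (by omega)⟩
    refine ⟨0, ?_, fun r _ => ?_, fun r _ => ?_⟩
    · simp only [ovTables, h1, this, if_true]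
      omega
    · simp [ovTables, h1, dig, Nat.mod_one]
    · simp [ovTables, h1, dig, Nat.mod_one]
  -- The mixed choice number `m` takes the vectors of `α` from the lists `j ≤ K - 1 - m` and those
  -- of `β` from the later ones; since it is not a solution, all its vectors have a one at some `x
  -- m`.
  · have h' : ∀ m, ∃ x < d, ∀ j ≤ K,
        bit j (if j + m + 1 ≤ K then dig n (K - 1 - j) α else dig n (K - j) β) x = 1 := fun m =>
      h (fun j => if j + m + 1 ≤ K then dig n (K - 1 - j) α else dig n (K - j) β) fun j _ => by
        split_ifs <;> exact dig_lt hn _ _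
    choose x hxd hx using h'
    -- The coordinates of all mixed choices, packed into one array; the digits of `α` and `β`
    -- themselves show that it is good.
    set y := ∑ m ∈ Finset.range K, x m * d ^ m with hy
    have hyd : ∀ m < K, y / d ^ m % d = x m := fun m hm => dig_sum (fun r _ => hxd r) hm
    have hA : ∀ r < K, RowA bit K d y r (dig n r α) := by
      intro r hr m hm
      rw [hyd m (by omega)]
      have := hx m (K - 1 - r) (by omega)
      rwa [if_pos (by omega), show K - 1 - (K - 1 - r) = r by omega] at this
    have hB : ∀ r < K, RowB bit K d y r (dig n r β) := by
      intro r hr m hm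
      rw [Nat.div_div_eq_div_mul, ← pow_add, hyd (r + m) (by omega)]
      have := hx (r + m) (K - r) (by omega)
      rwa [if_neg (by omega), show K - (K - r) = r by omega] at this
    have good : GoodArray bit K n d K y := fun r hr =>
      ⟨⟨_, dig_lt hn _ _, hA r hr⟩, ⟨_, dig_lt hn _ _, hB r hr⟩⟩
    refine ⟨Nat.count (GoodArray bit K n d K) y, ?_, fun r hr => ?_, fun r hr => ?_⟩
    · simp only [ovTables, h1, if_false]
      exact Nat.count_strict_mono good (sum_digits_lt fun r _ => hxd r)
    · simp only [ovTables, h1, if_false, Nat.nth_count good]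
      exact retract_of_mem (hA r hr)
    · simp only [ovTables, h1, if_false, Nat.nth_count good]
      exact retract_of_mem (hB r hr)

end Instance

/-! ### The reduction as a program -/

section Reduction

/-- Reads the parameters and prepares the registers. -/
def prepare : Prog :=
  .seq (assign 1 (.load (.lit 0) - .lit 1)) <| .seq (assign 2 (.load (.lit 1))) <|
  .seq (assign 3 (.load (.lit 2))) <|
  .seq (assign 4 (.lit 3 + .load (.lit 0) * .reg 2 * .reg 3)) <|
  .seq (assign 5 (.reg 4 + .reg 1 * .reg 2)) <| .seq (assign 0 (.reg 5 + .reg 1 * .reg 2)) <|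
  .seq (assign 7 (.lit 1)) <| .seq (assign 8 (.lit 1)) <|
  .seq (forUpTo 13 1 <| .seq (assign 7 (.reg 7 * .reg 2)) <| assign 8 (.reg 8 * .reg 3)) <|
  .seq (assign 6 (.reg 7 / .reg 2)) <| .seq (assign 9 (.reg 0 + .lit 4)) <|
  assign 10 (.reg 7 + .reg 7)

theorem run_prepare {w : ℕ} {τ : State} {K n d L : ℕ} (hL : L < 2 ^ w) (hn : 0 < n) (hd : 0 < d)
    (hK : 0 < K) (h0 : τ.mem 0 = K + 1) (h1 : τ.mem 1 = n) (h2 : τ.mem 2 = d)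
    (hob : outBase K n d + 4 ≤ L) (hp : 2 * n ^ K ≤ L) (hdK : d ^ K ≤ L) :
    Run w prepare τ (K * 20 + 60) fun τ' => τ'.mem = τ.mem ∧ Setup K n d τ' ∧ τ'.reg 8 = d ^ K ∧
      τ'.reg 9 = outBase K n d + 4 ∧ τ'.reg 10 = 2 * n ^ K := by
  have hob' : outBase K n d = tableBase K n d + K * n + K * n := rfl
  have htb : tableBase K n d = 3 + (K + 1) * n * d := rfl
  have hKn : K ≤ K * n := Nat.le_mul_of_pos_right _ hn
  have hKn' : n ≤ K * n := Nat.le_mul_of_pos_left _ hK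
  have hKnd : (K + 1) * n ≤ (K + 1) * n * d := Nat.le_mul_of_pos_right _ hd
  have hKnd' : d ≤ (K + 1) * n * d := Nat.le_mul_of_pos_left _ (by positivity)
  have hw0 : w ≠ 0 := by rintro rfl; simp at hL; omega
  have h2w : 2 < 2 ^ w := by omega
  have h3w : 3 < 2 ^ w := by omega
  have h4w : 4 < 2 ^ w := by omega
  refine Run.assign_seq K (by simp [h0]) (by simp [h0, hw0]; omega) ?_
  refine Run.assign_seq n (by simp [h1]) (by simp [hw0]) ?_
  refine Run.assign_seq d (by simp [h2]) (by simpa using h2w) ?_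
  refine Run.assign_seq (tableBase K n d) (by simp [h0, htb]) (by simp [h0, h3w]; omega) ?_
  refine Run.assign_seq (tableBase K n d + K * n) (by simp) (by simp; omega) ?_
  refine Run.assign_seq (outBase K n d) (by simp [hob']) (by simp; omega) ?_
  refine Run.assign_seq 1 (by simp) (by simp [hw0]) ?_
  refine Run.assign_seq 1 (by simp) (by simp [hw0]) ?_
  refine Run.call (K * (6 + 5) + 3) (Q₁ := fun σ => σ.mem = τ.mem ∧ σ.reg 7 = n ^ K ∧ σ.reg 8 = d ^ K)
    (Run.forUpTo (fun j σ => σ.mem = τ.mem ∧ σ.reg 7 = n ^ j ∧ σ.reg 8 = d ^ j) K 6 (by simp)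
      (by omega) (by simp) ?_ ?_) ?_
  · rintro j hj σ ⟨hm, h7, h8⟩ - hf
    have h2' : σ.reg 2 = n := by rw [hf 2 (by decide) (by decide) rfl]; simp
    have h3' : σ.reg 3 = d := by rw [hf 3 (by decide) (by decide) rfl]; simp
    have e₁ : n ^ (j + 1) ≤ n ^ K := Nat.pow_le_pow_right hn hj
    have e₂ : d ^ (j + 1) ≤ d ^ K := Nat.pow_le_pow_right hd hj
    refine Run.assign_seq (n ^ (j + 1)) (by simp [h7, h2', pow_succ]) ?_ ?_
    · simp only [Expr.fits_mul, Expr.fits_reg, true_and, Expr.eval_reg, h7, h2', ← pow_succ]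
      omega
    · refine Run.assign (d ^ (j + 1)) (by simp [h8, h3', pow_succ]) ?_ ?_
      · simp [h8, h3', ← pow_succ]
        omega
      · simp [hm]
  · rintro σ h - -
    exact h
  · rintro σ ⟨hm, h7, h8⟩ hf
    have hq : n ^ K / n = n ^ (K - 1) := by
      rw [Nat.div_eq_iff_eq_mul_left hn (dvd_pow_self n (by omega)), ← pow_succ,
        show K - 1 + 1 = K by omega]
    have hdiv : n ^ K / n ≤ n ^ K := Nat.div_le_self _ _
    have r0 : σ.reg 0 = outBase K n d := by rw [hf 0 (by decide) rfl]; simp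
    have r1 : σ.reg 1 = K := by rw [hf 1 (by decide) rfl]; simp
    have r2 : σ.reg 2 = n := by rw [hf 2 (by decide) rfl]; simp
    have r3 : σ.reg 3 = d := by rw [hf 3 (by decide) rfl]; simp
    have r4 : σ.reg 4 = tableBase K n d := by rw [hf 4 (by decide) rfl]; simp
    have r5 : σ.reg 5 = tableBase K n d + K * n := by rw [hf 5 (by decide) rfl]; simp
    refine Run.assign_seq (n ^ (K - 1)) (by simp [h7, r2, hq]) (by simp [h7, r2]; omega) ?_
    refine Run.assign_seq (outBase K n d + 4) (by simp [r0]) (by simp [r0, h4w]; omega) ?_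
    refine Run.assign (2 * n ^ K) (by simp [h7]; ring) (by simp [h7]; omega) ?_
    exact ⟨by simpa using hm, ⟨by simpa using r0, by simpa using r1, by simpa using r2,
      by simpa using r3, by simpa using r4, by simpa using r5, by simp, by simpa using h7⟩,
      by simpa using h8, by simp, by simp⟩

end Reduction

end STDiam

namespace STDiam

/-! ### Running through all coordinate arrays -/

section Reduction

variable {w K n d L : ℕ} {bit : ℕ → ℕ → ℕ → ℕ} {τ : State} {m : ℕ → ℕ}

/-- What holds when the edges for the first `c` coordinate arrays have been written. -/
def Emitted (D : Tables) (d c : ℕ) (m : ℕ → ℕ) (τ : State) : Prop :=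
  ∃ m' : ℕ → ℕ, (∀ x, x < tableBase D.K D.n d ∨ (outBase D.K D.n d ≤ x ∧ x < outBase D.K D.n d + 4) →
      m' x = m x) ∧
    τ.mem = withList (outBase D.K D.n d + 4) m' (flatten ((List.range c).flatMap D.blockEdges)) ∧
    τ.reg 9 = outBase D.K D.n d + 4 + (flatten ((List.range c).flatMap D.blockEdges)).length ∧
    τ.reg 10 = 2 * D.n ^ D.K + c * D.K * D.n ^ (D.K - 1)

theorem Emitted.congr {D : Tables} {c : ℕ} {σ : State} (h : Emitted D d c m τ)
    (hm : σ.mem = τ.mem) (h9 : σ.reg 9 = τ.reg 9) (h10 : σ.reg 10 = τ.reg 10) :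
    Emitted D d c m σ := by
  obtain ⟨m', h₁, h₂, h₃, h₄⟩ := h
  exact ⟨m', h₁, hm.trans h₂, h9.trans h₃, h10.trans h₄⟩

theorem length_flatten_blocks_le (D : Tables) (c : ℕ) :
    (flatten ((List.range c).flatMap D.blockEdges)).length ≤ 2 * (c * ((D.K + 1) * D.n ^ D.K)) := by
  rw [length_flatten, List.length_flatMap]
  refine Nat.mul_le_mul_left _
    ((List.sum_le_card_nsmul _ ((D.K + 1) * D.n ^ D.K) ?_).trans (by simp))
  intro x hx
  obtain ⟨X, -, rfl⟩ := List.mem_map.1 hx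
  exact Tables.length_blockEdges_le X

theorem run_emitBlock_of_emitted {D : Tables} {one : ℕ → ℕ → ℕ → ℕ → Prop} {c : ℕ}
    (hL : L < 2 ^ w) (hret : D.IsRetraction one) (hs : Setup D.K D.n d τ) (h : Emitted D d c m τ)
    (htab : HasTables D.K D.n d (D.A c) (D.B c) τ.mem) (hc : c < D.g) (hord : D.order ≤ L)
    (hcap : outBase D.K D.n d + 5 + 2 * (D.g * ((D.K + 1) * D.n ^ D.K)) + 2 * D.n ^ D.K ≤ L) :
    Run w emitBlock τ ((D.K + 1) * D.n ^ D.K * 250 + 50) (Emitted D d (c + 1) m) := by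
  obtain ⟨m', h₁, h₂, h₃, h₄⟩ := h
  have hob : outBase D.K D.n d = tableBase D.K D.n d + D.K * D.n + D.K * D.n := rfl
  have htab' : HasTables D.K D.n d (D.A c) (D.B c) m' := by
    refine ⟨fun r hr a ha => ?_, fun r hr a ha => ?_⟩
    · have := mul_add_lt_mul hr ha
      rw [← htab.1 r hr a ha, h₂, withList_of_lt (by omega)]
    · have := mul_add_lt_mul hr ha
      rw [← htab.2 r hr a ha, h₂, withList_of_lt (by omega)]
  have hE : Emitting w D d c L (outBase D.K D.n d + 4) m' one :=
    ⟨hret, hL, hc, htab', hord, rfl, by omega⟩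
  refine (hE.run_emitBlock hs h₂ h₃ h₄ ?_).post ?_
  · have e₁ := length_flatten_blocks_le D c
    have e₂ : (D.blockEdges c).length ≤ (D.K + 1) * D.n ^ D.K := Tables.length_blockEdges_le c
    have e₃ := Nat.mul_le_mul_right ((D.K + 1) * D.n ^ D.K) (show c + 1 ≤ D.g by omega)
    rw [add_mul, one_mul] at e₃
    omega
  · rintro σ ⟨s₁, s₂, s₃⟩
    rw [← flatten_append] at s₁ s₂
    refine ⟨m', h₁, ?_, ?_, s₃⟩ <;> simp only [List.range_succ, List.flatMap_append,
      List.flatMap_singleton]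
    · exact s₁
    · exact s₂

/-- Goes through all coordinate arrays. -/
def arrayLoop : Prog := forUpTo 11 8 (.seq fillTables (cond (.reg 12) emitBlock .skip))

/-- Before the array `y` is treated, the number of blocks written is the number of good arrays below
`y`. If `y` is good, this number is its label, and `Nat.nth_count` identifies the tables in the
memory with those of the label. -/
theorem run_arrayLoop (hL : L < 2 ^ w) (hs : Setup K n d τ) (h8 : τ.reg 8 = d ^ K) (hd0 : 0 < d)
    (hn : 1 < n) (hK : 0 < K) (hbit : ∀ j a x, bit j a x ≤ 1) (hin : HasInput K n d bit m)
    (h : Emitted (ovTables bit K n d) d 0 m τ) (hord : (ovTables bit K n d).order ≤ L)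
    (hdL : d ^ K ≤ L)
    (hcap : outBase K n d + 5 + 2 * ((ovTables bit K n d).g * ((K + 1) * n ^ K)) + 2 * n ^ K ≤ L) :
    Run w arrayLoop τ (d ^ K * (K * (n * (K * 32 + 120) + 100) + (K + 1) * n ^ K * 250 + 80) + 3)
      (Emitted (ovTables bit K n d) d (ovTables bit K n d).g m) := by
  obtain ⟨f, -, hret⟩ := exists_isRetraction_ovTables (bit := bit) (by omega : 0 < n) hK hd0
  have hn1 : n ≠ 1 := by omega
  have hob : outBase K n d = tableBase K n d + K * n + K * n := rfl
  have hg : (ovTables bit K n d).g = Nat.count (GoodArray bit K n d K) (d ^ K) := by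
    simp [ovTables, hn1]
  refine Run.forUpTo (fun y σ => Emitted (ovTables bit K n d) d
    (Nat.count (GoodArray bit K n d K) y) m σ) (d ^ K)
    (K * (n * (K * 32 + 120) + 100) + (K + 1) * n ^ K * 250 + 70) h8 (by omega) ?_ ?_ ?_
  · rw [Nat.count_zero]
    exact h.congr (by simp) (by simp) (by simp)
  · rintro y hy σ hI h11 hf
    have hs' : Setup K n d σ := hs.congr fun r hr => by
      interval_cases r <;> exact hf _ (by decide) (by decide) rfl
    obtain ⟨m', h₁, h₂, h₃, h₄⟩ := hI
    simp only [ovTables_n, ovTables_K] at h₁ h₂ h₃ h₄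
    have hin' : HasInput K n d bit σ.mem := hin.congr fun x hx => by
      rw [h₂, withList_of_lt (by omega), h₁ x (.inl hx)]
    refine Run.call (K * (n * (K * 32 + 120) + 100) + 10) (run_fillTables hL hs' h11 hd0 (by omega)
      (by omega) hbit hin' (by omega)) ?_
    rintro σ₁ ⟨hm₁, htab, h12⟩ hf₁
    have hs₁ : Setup K n d σ₁ := hs'.congr fun r hr => by
      interval_cases r <;> exact hf₁ _ (by decide) rfl
    -- Refilling the tables touches only the cells between the input and the output, about which
    -- `Emitted` says nothing; so the new memory is itself a witness.
    have hI₁ : Emitted (ovTables bit K n d) d (Nat.count (GoodArray bit K n d K) y) m σ₁ := by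
      refine ⟨σ₁.mem, fun x hx => ?_, ?_, ?_, ?_⟩
      · simp only [ovTables_n, ovTables_K] at hx
        rw [hm₁ x (by omega), h₂, withList_of_lt (by omega), h₁ x hx]
      · funext x
        simp only [ovTables_n, ovTables_K]
        by_cases hxb : x < outBase K n d + 4
        · rw [withList_of_lt hxb]
        · rw [hm₁ x (.inr (by omega)), h₂, withList, withList, if_neg hxb, if_neg hxb]
      · rw [hf₁ 9 (by decide) rfl, h₃]; rfl
      · rw [hf₁ 10 (by decide) rfl, h₄]; rfl
    refine Run.cond (by simp) (fun hne => ?_) (fun he => ?_)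
    · have good : GoodArray bit K n d K y := by
        by_contra hc
        simp [h12, hc] at hne
      have hlt : Nat.count (GoodArray bit K n d K) y < (ovTables bit K n d).g := by
        rw [hg]; exact Nat.count_strict_mono good hy
      refine ((run_emitBlock_of_emitted hL hret hs₁ hI₁ ?_ hlt hord hcap).time ?_).post ?_
      · simpa [ovTables, hn1, Nat.nth_count good] using htab
      · simp; omega
      · intro σ₂ h₂
        rw [Nat.count_succ, if_pos good]
        exact h₂.congr (by simp) (by simp) (by simp)
    · have bad : ¬ GoodArray bit K n d K y := by
        intro hc
        simp [h12, hc] at he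
      refine Run.skip ?_
      rw [Nat.count_succ, if_neg bad]
      exact hI₁.congr (by simp) (by simp) (by simp)
  · rintro σ hσ - -
    rwa [hg]

/-- Treats the case that there is only one vector in each list. -/
def singleBlock : Prog :=
  .seq (assign 12 (.lit 0)) <| .seq (assign 14 (.reg 1 + .lit 1)) <|
  .seq (forUpTo 11 3 <|
    .seq (assign 13 (.lit 1)) <|
    .seq (forUpTo 15 14 <|
      assign 13 (.reg 13 * .load (.lit 3 + .reg 15 * .reg 3 + .reg 11))) <|
    cond (.reg 13) (assign 12 (.lit 1)) .skip) <|
  cond (.reg 12) emitBlock .skip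

/-- With one vector per list all retractions are zero, and the memory behind the input is still
zero; hence the tables are present without being written. -/
theorem run_singleBlock (hL : L < 2 ^ w) (hs : Setup K n d τ) (hd0 : 0 < d)
    (hn : n = 1) (hK : 0 < K) (hbit : ∀ j a x, bit j a x ≤ 1) (hin : HasInput K n d bit m)
    (hm0 : ∀ x, tableBase K n d ≤ x → m x = 0)
    (h : Emitted (ovTables bit K n d) d 0 m τ) (hτm : τ.mem = m)
    (hord : (ovTables bit K n d).order ≤ L)
    (hcap : outBase K n d + 5 + 2 * ((ovTables bit K n d).g * ((K + 1) * n ^ K)) + 2 * n ^ K ≤ L) :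
    Run w singleBlock τ (d * ((K + 1) * 20 + 30) + (K + 1) * n ^ K * 250 + 80)
      (Emitted (ovTables bit K n d) d (ovTables bit K n d).g m) := by
  obtain ⟨f, -, hret⟩ := exists_isRetraction_ovTables (bit := bit) (by omega : 0 < n) hK hd0
  have hob : outBase K n d = tableBase K n d + K * n + K * n := rfl
  have htb : tableBase K n d = 3 + (K + 1) * n * d := rfl
  have hw0 : w ≠ 0 := by rintro rfl; simp at hL; omega
  have h3w : 3 < 2 ^ w := by omega
  have hdle : d ≤ (K + 1) * n * d := by
    subst hn
    exact Nat.le_mul_of_pos_left _ (by omega)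
  have hKle : K + 1 ≤ (K + 1) * n * d := by
    subst hn
    rw [mul_one]
    exact Nat.le_mul_of_pos_right _ hd0
  refine Run.assign_seq 0 (by simp) (by simp) ?_
  refine Run.assign_seq (K + 1) (by simp [hs.r1]) (by simp [hs.r1, hw0]; omega) ?_
  refine Run.call (d * ((K + 1) * 20 + 25) + 3) (Q₁ := fun σ => σ.mem = m ∧
    σ.reg 12 = if ∃ x < d, ∀ j < K + 1, bit j 0 x = 1 then 1 else 0) (Run.forUpTo (fun c σ =>
    σ.mem = m ∧ σ.reg 12 = if ∃ x < c, ∀ j < K + 1, bit j 0 x = 1 then 1 else 0) d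
    ((K + 1) * 20 + 20) (by simp [hs.r3]) (by omega) ?_ ?_ (fun σ hσ _ _ => hσ)) ?_
  · simp [hτm]
  · rintro c hc σ ⟨hσm, h12⟩ h11 hf
    have h14 : σ.reg 14 = K + 1 := by rw [hf 14 (by decide) (by decide) rfl]; simp
    have h3 : σ.reg 3 = d := by rw [hf 3 (by decide) (by decide) rfl]; simp [hs.r3]
    refine Run.assign_seq 1 (by simp) (by simp [hw0]) ?_
    refine Run.call ((K + 1) * (10 + 5) + 3) (Q₁ := fun σ' => σ'.mem = m ∧
      σ'.reg 13 = if ∀ j < K + 1, bit j 0 c = 1 then 1 else 0) (Run.forUpTo (fun i σ' =>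
      σ'.mem = m ∧ σ'.reg 13 = if ∀ j < i, bit j 0 c = 1 then 1 else 0) (K + 1) 10
      (by simp [h14]) (by omega) (by simp [hσm]) ?_ (fun σ hσ _ _ => hσ)) ?_
    · rintro i hi σ₁ ⟨hm₁, h13₁⟩ h15₁ hf₁
      have h3₁ : σ₁.reg 3 = d := by rw [hf₁ 3 (by decide) (by decide) rfl]; simp [h3]
      have h11₁ : σ₁.reg 11 = c := by rw [hf₁ 11 (by decide) (by decide) rfl]; simp [h11]
      have hlt := lt_tableBase (K := K) (n := n) (show i ≤ K by omega) (by omega : 0 < n) hc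
      rw [hn, mul_one, add_zero] at hlt
      have hv := hin i (by omega) 0 (by omega) c hc
      rw [show (i * n + 0) * d = i * d by rw [hn]; ring] at hv
      have hb := hbit i 0 c
      rw [hn] at hob
      refine Run.assign (if ∀ j < i + 1, bit j 0 c = 1 then 1 else 0) ?_ ?_ (by simp [hm₁])
      · simp only [Expr.eval_mul, Expr.eval_reg, Expr.eval_load, Expr.eval_add, Expr.eval_lit,
          h13₁, h15₁, h3₁, h11₁, hm₁, hv]
        by_cases hP : ∀ j < i, bit j 0 c = 1
        · by_cases hQ : bit i 0 c = 1
          · rw [if_pos hP, if_pos, hQ]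
            intro j hj
            rcases Nat.lt_succ_iff_lt_or_eq.1 hj with h | rfl
            exacts [hP j h, hQ]
          · rw [if_pos hP, if_neg, one_mul]
            · omega
            · exact fun hall => hQ (hall i (by omega))
        · rw [if_neg hP, if_neg, zero_mul]
          exact fun hall => hP fun j hj => hall j (by omega)
      · simp only [Expr.fits_mul, Expr.fits_reg, Expr.fits_load, Expr.fits_add, Expr.fits_lit,
          Expr.eval_mul, Expr.eval_reg, Expr.eval_load, Expr.eval_add, Expr.eval_lit,
          h13₁, h15₁, h3₁, h11₁, hm₁, hv, true_and]
        rw [hn] at hcap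
        refine ⟨⟨⟨h3w, ?_, ?_⟩, ?_⟩, ?_⟩
        · omega
        · omega
        · omega
        · split_ifs <;> omega
    · rintro σ₁ ⟨hm₁, h13₁⟩ hf₁
      have h12₁ : σ₁.reg 12 = if ∃ x < c, ∀ j < K + 1, bit j 0 x = 1 then 1 else 0 := by
        rw [hf₁ 12 (by decide) rfl]; simpa using h12
      refine Run.cond (by simp) (fun hne => ?_) (fun he => ?_)
      · have hP : ∀ j < K + 1, bit j 0 c = 1 := by
          by_contra hc
          simp only [Expr.eval_reg, h13₁, if_neg hc] at hne
          exact hne rfl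
        refine Run.assign 1 (by simp) (by simp [hw0]) ?_
        simp only [State.setReg_mem, State.setReg_reg]
        refine ⟨hm₁, ?_⟩
        have hE : ∃ x < c + 1, ∀ j < K + 1, bit j 0 x = 1 := ⟨c, by omega, hP⟩
        rw [if_pos hE]
        simp
      · have hP : ¬ ∀ j < K + 1, bit j 0 c = 1 := by
          intro hc
          simp only [Expr.eval_reg, h13₁, if_pos hc] at he
          omega
        refine Run.skip ?_
        simp only [State.setReg_mem, State.setReg_reg]
        refine ⟨hm₁, ?_⟩
        simp only [show (12 : ℕ) ≠ 11 by decide, if_false, h12₁]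
        congr 1
        simp only [eq_iff_iff]
        constructor
        · rintro ⟨x, hx, hx'⟩
          exact ⟨x, by omega, hx'⟩
        · rintro ⟨x, hx, hx'⟩
          rcases Nat.lt_succ_iff_lt_or_eq.1 hx with h | rfl
          exacts [⟨x, h, hx'⟩, absurd hx' hP]
  · rintro σ ⟨hσm, h12⟩ hf
    have hs' : Setup K n d σ := hs.congr fun r hr => by
      interval_cases r <;> (rw [hf _ (by decide) rfl]; simp)
    have hI : Emitted (ovTables bit K n d) d 0 m σ :=
      h.congr (hσm.trans hτm.symm) (by rw [hf _ (by decide) rfl]; simp)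
        (by rw [hf _ (by decide) rfl]; simp)
    refine Run.cond (by simp) (fun hne => ?_) (fun he => ?_)
    · have hP : ∃ x < d, ∀ j < K + 1, bit j 0 x = 1 := by
        by_contra hc
        simp only [Expr.eval_reg, h12, if_neg hc] at hne
        exact hne rfl
      have hg : (ovTables bit K n d).g = 1 := by simp only [ovTables, if_pos hn, if_pos hP]
      rw [hg]
      refine ((run_emitBlock_of_emitted hL hret hs' hI ?_ (by omega) hord hcap).time ?_)
      · simp only [ovTables_n, ovTables_K]
        refine ⟨fun r hr a ha => ?_, fun r hr a ha => ?_⟩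
        · simp only [hσm, ovTables, if_pos hn]
          exact hm0 _ (by omega)
        · simp only [hσm, ovTables, if_pos hn]
          exact hm0 _ (by omega)
      · have : d * ((K + 1) * 20 + 30) = d * ((K + 1) * 20 + 25) + d * 5 := by ring
        simp; omega
    · have hP : ¬ ∃ x < d, ∀ j < K + 1, bit j 0 x = 1 := by
        intro hc
        simp only [Expr.eval_reg, h12, if_pos hc] at he
        omega
      have hg : (ovTables bit K n d).g = 0 := by simp only [ovTables, if_pos hn, if_neg hP]
      rw [hg]
      exact Run.skip hI (by
        have : d * ((K + 1) * 20 + 30) = d * ((K + 1) * 20 + 25) + d * 5 := by ring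
        simp; omega)

end Reduction

end STDiam

namespace STDiam

/-! ### Header, vertex sets and the whole reduction -/

section Reduction

variable {w K n d L : ℕ} {bit : ℕ → ℕ → ℕ → ℕ} {τ : State} {m : ℕ → ℕ}

theorem withList_cons_update (b : ℕ) (m : ℕ → ℕ) (l : List ℕ) (v : ℕ) :
    (fun x => if x = b then v else withList (b + 1) m l x) = withList b m (v :: l) := by
  funext x
  unfold withList
  rcases lt_trichotomy x b with h | rfl | h
  · rw [if_neg (by omega), if_pos (by omega), if_pos h]
  · simp
  · rw [if_neg (by omega), if_neg (by omega), if_neg (by omega),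
      show x - b = x - (b + 1) + 1 by omega, List.getD_cons_succ]

theorem State.setMem_withList_cons {σ : State} {b : ℕ} {m : ℕ → ℕ} {l : List ℕ}
    (h : σ.mem = withList (b + 1) m l) (v : ℕ) :
    (σ.setMem b v).mem = withList b m (v :: l) := by
  rw [← withList_cons_update]
  funext x
  rw [State.setMem_mem, h]

theorem run_emitRange {T c : ℕ} {e : Expr} {f : ℕ → ℕ} {b : ℕ} {l : List ℕ}
    (h7 : τ.reg 7 = c) (hm : τ.mem = withList b m l) (h9 : τ.reg 9 = b + l.length)
    (hw : b + l.length + c + 1 < 2 ^ w)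
    (he : ∀ σ : State, (∀ r < 32, r ≠ 13 → r ≠ 9 → σ.reg r = τ.reg r) → σ.reg 13 < c →
      e.eval σ = f (σ.reg 13) ∧ e.Fits w σ)
    (hb : e.Below 32 := by simp)
    (hT : c * (e.size + 10) + 3 ≤ T := by
      first | omega | (simp; done) | (simp; omega) | (simp; ring_nf; omega)) 
    (h13 : (emit e).writes 13 = false := by rfl) (h7' : (emit e).writes 7 = false := by rfl)
    (hwr : ∀ r < 32, r ≠ 9 → (emit e).writes r = false := by decide) :
    Run w (forUpTo 13 7 (emit e)) τ T fun τ' =>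
      τ'.mem = withList b m (l ++ (List.range c).map f) ∧
      τ'.reg 9 = b + (l ++ (List.range c).map f).length := by
  refine Run.forUpTo (fun i σ => σ.mem = withList b m (l ++ (List.range i).map f) ∧
    σ.reg 9 = b + (l ++ (List.range i).map f).length) c (e.size + 5) h7 (by omega)
    (by simp [hm, h9]) ?_ (fun σ hσ _ _ => hσ) (hpi := h13) (hpn := h7') (hT := by
      rw [add_assoc]; exact hT)
  rintro i hi σ ⟨hσm, h9'⟩ h13' hf
  have := he σ (fun r hr h₁ h₂ => hf r hr h₁ (hwr r hr h₂)) (by omega)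
  refine run_emit (f i) (by simp; omega) hσm h9' (by rw [this.1, h13']) this.2 ?_ hb le_rfl
  intro σ' h₁ h₂ _
  rw [List.append_assoc] at h₁ h₂
  simp only [State.setReg_mem, State.setReg_reg, show (9 : ℕ) ≠ 13 by decide, if_false,
    List.range_succ, List.map_append]
  exact ⟨h₁, h₂⟩

/-- The encoding of the graph and the two vertex sets. -/
def Tables.output (D : Tables) : List ℕ :=
  D.order :: D.edges.length :: D.n ^ D.K :: D.n ^ D.K :: flatten D.edges ++ List.range (D.n ^ D.K) ++
    (List.range (D.n ^ D.K)).map (D.n ^ D.K + ·)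

theorem Tables.length_output (D : Tables) :
    D.output.length = 4 + 2 * D.edges.length + 2 * D.n ^ D.K := by
  simp [Tables.output, length_flatten]
  ring

/-- Writes the header and the vertex sets. -/
def finish : Prog :=
  .seq (put (.reg 0 + .lit 3) (.reg 7)) <| .seq (put (.reg 0 + .lit 2) (.reg 7)) <|
  .seq (put (.reg 0 + .lit 1) ((.reg 9 - .reg 0 - .lit 4) / .lit 2)) <|
  .seq (put (.reg 0) (.reg 10)) <|
  .seq (forUpTo 13 7 (emit (.reg 13 + .lit 0))) (forUpTo 13 7 (emit (.reg 7 + .reg 13)))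

/-- The numbers of vertices and edges are known only after the last block, so four cells were left
free in front of the edges. They are filled from the highest address downwards, which prolongs the
output list at its head each time. -/
theorem run_finish {D : Tables} (hL : L < 2 ^ w) (hs : Setup D.K D.n d τ)
    (h : Emitted D d D.g m τ)
    (hcap : outBase D.K D.n d + 5 + 2 * (D.g * ((D.K + 1) * D.n ^ D.K)) + 2 * D.n ^ D.K ≤ L) :
    Run w finish τ (D.n ^ D.K * 30 + 50) fun τ' =>
      (∃ m' : ℕ → ℕ, (∀ x < tableBase D.K D.n d, m' x = m x) ∧
        τ'.mem = withList (outBase D.K D.n d) m' D.output) ∧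
      τ'.reg 0 = outBase D.K D.n d ∧ τ'.reg 9 = outBase D.K D.n d + D.output.length := by
  obtain ⟨m', h₁, h₂, h₃, h₄⟩ := h
  change τ.mem = withList _ _ (flatten D.edges) at h₂
  change τ.reg 9 = _ + (flatten D.edges).length at h₃
  change τ.reg 10 = D.order at h₄
  have hle := D.length_edges_le
  have h3w : 3 < 2 ^ w := by omega
  have h4w : 4 < 2 ^ w := by omega
  have h2w : 2 < 2 ^ w := by omega
  have hw0 : w ≠ 0 := by rintro rfl; simp at hL; omega
  rw [length_flatten] at h₃
  have r0 := hs.r0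
  have r7 := hs.r7
  generalize hB : outBase D.K D.n d = B at *
  generalize hp : D.n ^ D.K = p at *
  refine Run.put_seq (B + 3) p (by simp [r0]) (by simp [r7]) (by simp [r0, h3w]; omega) (by simp) ?_
  refine Run.put_seq (B + 2) p (by simp [r0]) (by simp [r7]) (by simp [r0, h2w]; omega) (by simp) ?_
  refine Run.put_seq (B + 1) D.edges.length (by simp [r0]) (by simp [r0, h₃]; omega)
    (by simp [r0, hw0]; omega) (by simp [r0, h₃, h4w, h2w]; omega) ?_
  refine Run.put_seq B D.order (by simp [r0]) (by simp [h₄]) (by simp) (by simp) ?_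
  have key := State.setMem_withList_cons (State.setMem_withList_cons (State.setMem_withList_cons
    (State.setMem_withList_cons (b := B + 3) h₂ p) p) D.edges.length) D.order
  refine Run.call (p * 13 + 3) (run_emitRange (c := p) (f := id) (by simp [r7]) key
    (by simp [h₃, length_flatten]; ring) (by simp [length_flatten]; omega) ?_) ?_
  · intro σ hr h13
    simp [hw0]
    omega
  rintro σ ⟨hm₁, h9₁⟩ hf
  have r7' : σ.reg 7 = p := by rw [hf 7 (by decide) rfl]; simp [r7]
  have r0' : σ.reg 0 = B := by rw [hf 0 (by decide) rfl]; simp [r0]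
  refine Run.conseq (p * 13 + 3) (run_emitRange (c := p) (f := (p + ·)) (by simp [r7']) hm₁ h9₁
    (by simp [length_flatten]; omega) ?_) ?_
  · intro σ' hr h13
    have : σ'.reg 7 = p := by rw [hr 7 (by decide) (by decide) (by decide), r7']
    simp [this]
    omega
  · rintro σ' ⟨hm₂, h9₂⟩ hf'
    have e : D.order :: D.edges.length :: p :: p :: flatten D.edges ++ List.map id (List.range p) ++
        List.map (p + ·) (List.range p) = D.output := by
      rw [Tables.output, hp, List.map_id]
    rw [e] at hm₂ h9₂
    exact ⟨⟨m', fun x hx => h₁ x (.inl hx), hm₂⟩, by rw [hf' 0 (by decide) rfl, r0'], h9₂⟩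

/-- Constructs the graph from an instance of the orthogonal vectors problem. -/
def reduction : Prog :=
  .seq prepare <| .seq (cond (.reg 2 - .lit 1) arrayLoop singleBlock) finish

/-- The tables of one array cost about `K ^ 2 * n` steps, and this bound hides them behind the `(K +
1) * n ^ K` edge candidates with a constant independent of `K`. It fails for `n = 1`, which is the
reason for the separate case. -/
theorem mul_le_pow {n K : ℕ} (hn : 2 ≤ n) (hK : 0 < K) : K * n ≤ n ^ K := by
  obtain ⟨K, rfl⟩ : ∃ j, K = j + 1 := ⟨K - 1, by omega⟩
  rw [pow_succ]
  exact Nat.mul_le_mul_right n (Nat.lt_pow_self hn)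

theorem run_reduction (hL : L < 2 ^ w) (hd : 0 < d) (hn : 0 < n) (hK : 0 < K)
    (hbit : ∀ j a x, bit j a x ≤ 1) (h0 : τ.mem 0 = K + 1) (h1 : τ.mem 1 = n) (h2 : τ.mem 2 = d)
    (hin : HasInput K n d bit τ.mem) (hm0 : ∀ x, tableBase K n d ≤ x → τ.mem x = 0)
    (hord : (ovTables bit K n d).order ≤ L) (hdL : d ^ K ≤ L)
    (hcap : outBase K n d + 5 + 2 * ((ovTables bit K n d).g * ((K + 1) * n ^ K)) + 2 * n ^ K ≤ L) :
    Run w reduction τ ((K + 1) * n ^ K * d ^ K * 1000) fun τ' =>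
      (∃ m' : ℕ → ℕ, τ'.mem = withList (outBase K n d) m' (ovTables bit K n d).output) ∧
      τ'.reg 0 = outBase K n d ∧
      τ'.reg 9 = outBase K n d + (ovTables bit K n d).output.length := by
  have hob : outBase K n d = tableBase K n d + K * n + K * n := rfl
  have hp0 : 0 < n ^ K := by positivity
  have hq0 : 0 < d ^ K := by positivity
  have hP : (K + 1) * n ^ K * 1 ≤ (K + 1) * n ^ K * d ^ K := by gcongr; omega
  have hKP : (K + 1) * 1 ≤ (K + 1) * n ^ K := by gcongr; omega
  have hpP : 2 * n ^ K ≤ (K + 1) * n ^ K := by gcongr; omega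
  have hnK : n ≤ K * n := Nat.le_mul_of_pos_left _ hK
  have hw0 : w ≠ 0 := by rintro rfl; simp at hL; omega
  refine Run.call (K * 20 + 60) (run_prepare hL hn hd hK h0 h1 h2 (by omega) (by omega) hdL) ?_
  rintro σ ⟨hm, hs, h8, h9, h10⟩ hf
  have hI : Emitted (ovTables bit K n d) d 0 τ.mem σ := by
    refine ⟨τ.mem, fun x _ => rfl, ?_, ?_, ?_⟩
    · rw [hm]
      funext x
      by_cases hx : x < outBase K n d + 4
      · simp [withList, hx]
      · rw [hm0 x (by omega), withList]
        simp [flatten, hx]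
    · simpa [flatten] using h9
    · simpa using h10
  refine Run.call ((K + 1) * n ^ K * d ^ K * 850) (Q₁ := Emitted (ovTables bit K n d) d
    (ovTables bit K n d).g τ.mem) (Run.cond (by simp [hs.r2, hw0]; omega) (fun hne => ?_)
    (fun he => ?_) (hT := ?_)) ?_ ?_
  · simp only [Expr.eval_sub, Expr.eval_reg, hs.r2, Expr.eval_lit] at hne
    refine (run_arrayLoop hL hs h8 hd (by omega) hK hbit hin hI hord hdL hcap).time ?_
    have hKn := mul_le_pow (show 2 ≤ n by omega) hK
    have e₁ : K * (n * (K * 32 + 120) + 100) + (K + 1) * n ^ K * 250 + 80 ≤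
        (K + 1) * n ^ K * 800 := by
      have : K * (n * (K * 32 + 120) + 100) = (K * n) * (K * 32 + 120) + K * 100 := by ring
      have h₂ : (K * n) * (K * 32 + 120) ≤ n ^ K * (K * 32 + 120) := by gcongr
      have h₃ : n ^ K * (K * 32 + 120) ≤ (K + 1) * n ^ K * 120 := by
        calc _ ≤ n ^ K * ((K + 1) * 120) := by gcongr; omega
          _ = _ := by ring
      omega
    have e₂ := Nat.mul_le_mul_left (d ^ K) e₁
    have e₃ : d ^ K * ((K + 1) * n ^ K * 800) = (K + 1) * n ^ K * d ^ K * 800 := by ring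
    rw [e₃] at e₂
    simp only [Expr.size_sub, Expr.size_reg, Expr.size_lit]
    generalize d ^ K * (K * (n * (K * 32 + 120) + 100) + (K + 1) * n ^ K * 250 + 80) = Y at e₂ ⊢
    generalize (K + 1) * n ^ K * d ^ K = Z at *
    omega
  · simp only [Expr.eval_sub, Expr.eval_reg, hs.r2, Expr.eval_lit] at he
    refine (run_singleBlock hL hs hd (by omega) hK hbit hin hm0 hI hm hord hcap).time ?_
    have hdd : d ≤ d ^ K := Nat.le_self_pow (by omega) d
    have e₁ : d * ((K + 1) * 20 + 30) ≤ (K + 1) * n ^ K * d ^ K * 50 := by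
      calc _ ≤ d ^ K * ((K + 1) * n ^ K * 50) := by gcongr; omega
        _ = _ := by ring
    simp only [Expr.size_sub, Expr.size_reg, Expr.size_lit]
    generalize d * ((K + 1) * 20 + 30) = Y at e₁ ⊢
    generalize (K + 1) * n ^ K * d ^ K = Z at *
    omega
  · simp
    omega
  · intro σ₁ hE hf₁
    have hs₁ : Setup K n d σ₁ := hs.congr fun r hr => by
      interval_cases r <;> exact hf₁ _ (by decide) rfl
    refine (run_finish (D := ovTables bit K n d) hL hs₁ hE hcap).mono ?_ ?_
    · simp only [ovTables_n, ovTables_K]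
      omega
    · rintro σ₂ ⟨⟨m', -, hm'⟩, h₀, h₉⟩
      exact ⟨⟨m', hm'⟩, h₀, h₉⟩
  · omega

end Reduction

end STDiam

namespace STDiam

/-! ### The graph of an instance -/

section Encoding

namespace Tables

variable (D : Tables) (N : ℕ)

/-- The vertex set `S`. -/
def first : Finset (Fin N) := {v | (v : ℕ) < D.n ^ D.K}

/-- The vertex set `T`. -/
def last : Finset (Fin N) := {v | D.n ^ D.K ≤ (v : ℕ) ∧ (v : ℕ) < 2 * D.n ^ D.K}

variable {D N}

@[simp] theorem mem_first {v : Fin N} : v ∈ D.first N ↔ (v : ℕ) < D.n ^ D.K := by simp [first]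

@[simp] theorem mem_last {v : Fin N} :
    v ∈ D.last N ↔ D.n ^ D.K ≤ (v : ℕ) ∧ (v : ℕ) < 2 * D.n ^ D.K := by simp [last]

variable {one : ℕ → ℕ → ℕ → ℕ → Prop} (h : D.IsRetraction one)

include h

theorem IsRetraction.lt_order_of_mem_edges {e : ℕ × ℕ} (he : e ∈ D.edges) :
    e.1 < D.order ∧ e.2 < D.order := by
  obtain ⟨u, v⟩ := e
  obtain ⟨X, hX, i, hi, e, he', -, rfl, rfl⟩ := mem_edges.1 he
  exact ⟨h.lowEnd_lt hX hi he', h.highEnd_lt hX hi he'⟩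

theorem IsRetraction.layer_le (v : ℕ) : D.layer v ≤ D.K + 1 := by
  have := Nat.mod_lt ((v - 2 * D.n ^ D.K) / D.n ^ (D.K - 1)) h.K_pos
  unfold layer
  split_ifs <;> omega

theorem IsRetraction.mem_first_iff_layer {v : Fin N} : v ∈ D.first N ↔ D.layer v = 0 := by
  rw [mem_first, layer]
  split_ifs <;> simp <;> omega

theorem IsRetraction.mem_last_iff_layer {v : Fin N} : v ∈ D.last N ↔ D.layer v = D.K + 1 := by
  have := Nat.mod_lt (((v : ℕ) - 2 * D.n ^ D.K) / D.n ^ (D.K - 1)) h.K_pos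
  rw [mem_last, layer]
  generalize ((v : ℕ) - 2 * D.n ^ D.K) / D.n ^ (D.K - 1) % D.K = r at *
  split_ifs
  · exact ⟨fun _ => by omega, fun h0 => h0.elim⟩
  · exact ⟨fun _ => rfl, fun _ => by omega⟩
  · exact ⟨fun _ => by omega, fun _ => by omega⟩

/-- Additional vertices are isolated and lie in neither of the two sets, so that they change nothing
but the first number of the encoding. -/
theorem IsRetraction.encodesST (hN : D.order ≤ N) :
    EncodesST (D.graph N) (D.first N) (D.last N) (N :: D.output.tail) ∧
      numEdges (D.graph N) = D.edges.length := by
  have h2 : 2 * D.n ^ D.K ≤ D.order := by simp [order]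
  set E : List (Fin N × Fin N) := D.edges.pmap (fun e he => (⟨e.1, he.1⟩, ⟨e.2, he.2⟩))
    (fun e he => ⟨(h.lt_order_of_mem_edges he).1.trans_le hN,
      (h.lt_order_of_mem_edges he).2.trans_le hN⟩ : ∀ e ∈ D.edges, e.1 < N ∧ e.2 < N) with hE
  have hmap : E.map (fun e => ((e.1 : ℕ), (e.2 : ℕ))) = D.edges := by
    rw [hE, List.map_pmap]
    simp
  have hmem : ∀ e : Fin N × Fin N, e ∈ E ↔ ((e.1 : ℕ), (e.2 : ℕ)) ∈ D.edges := by
    intro e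
    rw [← hmap, List.mem_map]
    constructor
    · intro he
      exact ⟨e, he, rfl⟩
    · rintro ⟨e', he', h'⟩
      have : e' = e := by
        simp only [Prod.mk.injEq] at h'
        exact Prod.ext (Fin.ext h'.1) (Fin.ext h'.2)
      rwa [← this]
  have hEnd : E.Nodup := by
    apply List.Nodup.of_map (fun e => ((e.1 : ℕ), (e.2 : ℕ)))
    rw [hmap]
    exact h.nodup_edges
  have hnd : (E.map fun e => s(e.1, e.2)).Nodup := by
    refine hEnd.map_on ?_
    intro e he e' he' heq
    rw [Sym2.eq_iff] at heq
    rcases heq with ⟨h₁, h₂⟩ | ⟨h₁, h₂⟩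
    · exact Prod.ext h₁ h₂
    -- Two listed pairs cannot be reversals of each other, because the layer increases from the
    -- first to the second component.
    · have e₁ := h.layer_of_mem_edges ((hmem e).1 he)
      have e₂ := h.layer_of_mem_edges ((hmem e').1 he')
      rw [h₁, h₂] at e₁
      omega
  have hset : ∀ e : Sym2 (Fin N), e ∈ (E.map fun e => s(e.1, e.2)) ↔ e ∈ (D.graph N).edgeSet := by
    intro e
    induction e with | _ u v
    rw [SimpleGraph.mem_edgeSet, List.mem_map]
    constructor
    · rintro ⟨e, he, h'⟩
      rw [Sym2.eq_iff] at h'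
      have := h.graph_adj_of_mem ((hmem e).1 he)
      rcases h' with ⟨rfl, rfl⟩ | ⟨rfl, rfl⟩
      exacts [this, this.symm]
    · intro huv
      rcases (graph_adj.1 huv).2 with h' | h'
      · exact ⟨(u, v), (hmem _).2 h', rfl⟩
      · exact ⟨(v, u), (hmem _).2 h', Sym2.eq_swap⟩
  have hlen : E.length = D.edges.length := by rw [hE, List.length_pmap]
  set S : List (Fin N) := (List.range (D.n ^ D.K)).pmap (fun v hv => ⟨v, hv⟩)
    (fun v hv => by rw [List.mem_range] at hv; omega) with hS
  set T : List (Fin N) := (List.range (D.n ^ D.K)).pmap (fun v hv => ⟨D.n ^ D.K + v, hv⟩)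
    (fun v hv => by rw [List.mem_range] at hv; omega) with hT
  have hs : S.map Fin.val = List.range (D.n ^ D.K) := by
    rw [hS, List.map_pmap]
    simp
  have ht : T.map Fin.val = (List.range (D.n ^ D.K)).map (D.n ^ D.K + ·) := by
    rw [hT, List.map_pmap]
    simp
  refine ⟨⟨E, S, T, hnd, hset, .of_map Fin.val (by rw [hs]; exact List.nodup_range),
    fun v => ?_, .of_map Fin.val (by
      rw [ht]; exact List.nodup_range.map (add_right_injective _)), fun v => ?_, ?_⟩, ?_⟩
  · simp [hS, Fin.ext_iff]
  · simp only [hT, List.mem_pmap, List.mem_range, Fin.ext_iff, mem_last]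
    constructor
    · rintro ⟨i, hi, h'⟩
      omega
    · rintro ⟨h₁, h₂⟩
      exact ⟨v - D.n ^ D.K, by omega, by omega⟩
  · have hsl := congrArg List.length hs
    have htl := congrArg List.length ht
    simp only [List.length_map, List.length_range] at hsl htl
    -- In `EncodesST` the lists of vertices are coerced to lists of numbers by a monadic bind before
    -- the map; the result is the plain image.
    have hbind : ∀ l : List (Fin N), (List.map (fun v => v) do let a ← l; pure (a : ℕ)) =
        l.map Fin.val := by
      intro l
      rw [List.map_id', List.map_eq_flatMap]
      rfl
    rw [hbind, hbind, hs, ht, hsl, htl, hlen, output, flatten, ← hmap, List.flatMap_map]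
    simp
  · have : (D.graph N).edgeSet = ((E.map fun e => s(e.1, e.2)).toFinset : Set (Sym2 (Fin N))) := by
      ext e
      rw [← hset e]
      simp
    rw [numEdges, this, Set.ncard_coe_finset, List.toFinset_card_of_nodup hnd, List.length_map, hlen]

end Tables

end Encoding

/-! ### Tuples as numbers -/

section Tuples

variable {K n : ℕ}

/-- The number with the digits given by the tuple, in reverse order. -/
def tupleIndex (u : Fin K → Fin n) : ℕ :=
  ∑ r ∈ Finset.range K, (if h : r < K then (u ⟨K - 1 - r, by omega⟩ : ℕ) else 0) * n ^ r

theorem tupleIndex_lt (u : Fin K → Fin n) : tupleIndex u < n ^ K :=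
  sum_digits_lt fun r hr => by rw [dif_pos hr]; exact Fin.is_lt _

theorem dig_tupleIndex (u : Fin K → Fin n) {r : ℕ} (hr : r < K) :
    dig n r (tupleIndex u) = u ⟨K - 1 - r, by omega⟩ := by
  rw [tupleIndex, dig_sum _ hr, dif_pos hr]
  exact fun r hr => by rw [dif_pos hr]; exact Fin.is_lt _

theorem tupleIndex_injective : Function.Injective (tupleIndex : (Fin K → Fin n) → ℕ) := by
  intro u v huv
  funext i
  have h₁ := dig_tupleIndex u (r := K - 1 - i) (by omega)
  have h₂ := dig_tupleIndex v (r := K - 1 - i) (by omega)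
  have hi : (⟨K - 1 - (K - 1 - i), by omega⟩ : Fin K) = i := by ext; simp; omega
  rw [huv, h₂, hi] at h₁
  exact Fin.ext h₁.symm

theorem exists_tupleIndex_eq (hn : 0 < n) {e : ℕ} (he : e < n ^ K) :
    ∃ u : Fin K → Fin n, tupleIndex u = e := by
  refine ⟨fun i => ⟨dig n (K - 1 - i) e, dig_lt hn _ _⟩, eq_of_dig_eq (tupleIndex_lt _) he ?_⟩
  intro r hr
  rw [dig_tupleIndex _ hr]
  simp only
  congr 1
  omega

end Tuples

/-! ### Distances in the graph of an instance -/

section Instance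

variable {K n d : ℕ}

/-- The entries of the vectors, as numbers, and zero outside of the lists. -/
def ovBit (W : OVInstance (K + 1) n d) (j a x : ℕ) : ℕ :=
  if h : j < K + 1 ∧ a < n ∧ x < d then (W ⟨j, h.1⟩ ⟨a, h.2.1⟩ ⟨x, h.2.2⟩).toNat else 0

theorem ovBit_le_one (W : OVInstance (K + 1) n d) (j a x : ℕ) : ovBit W j a x ≤ 1 := by
  unfold ovBit
  split_ifs
  · exact Bool.toNat_le _
  · omega

theorem ovBit_val (W : OVInstance (K + 1) n d) (j : Fin (K + 1)) (a : Fin n) (x : Fin d) :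
    ovBit W j a x = (W j a x).toNat := dif_pos ⟨j.2, a.2, x.2⟩

theorem isSolution_iff {W : OVInstance (K + 1) n d} {a : Fin (K + 1) → Fin n} :
    W.IsSolution a ↔ ∀ x, ∃ i, W i (a i) x = false := by
  simp [OVInstance.IsSolution, Finset.prod_eq_zero_iff]

/-- The tables of the graph constructed from the instance. -/
noncomputable def OVInstance.tables (W : OVInstance (K + 1) n d) : Tables := ovTables (ovBit W) K n d

@[simp] theorem OVInstance.tables_n (W : OVInstance (K + 1) n d) : W.tables.n = n := rfl
@[simp] theorem OVInstance.tables_K (W : OVInstance (K + 1) n d) : W.tables.K = K := rfl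

theorem OVInstance.exists_isRetraction (W : OVInstance (K + 1) n d) (hn : 0 < n) (hK : 0 < K)
    (hd : 0 < d) : ∃ one, W.tables.IsRetraction one := by
  obtain ⟨f, -, h⟩ := exists_isRetraction_ovTables (bit := ovBit W) hn hK hd
  exact ⟨_, h⟩

variable {W : OVInstance (K + 1) n d}

/-- At the coordinate belonging to any entry of any label some vector of the solution is zero, which
is what the bound for digit-layered graphs requires. Digits count backwards, so agreement with `a`
except in the last `s₁` entries of `α` means agreement in the digits from `s₁` on. -/
theorem le_edist_of_isSolution (hd : 0 < d) (hK : 0 < K) {a : Fin (K + 1) → Fin n}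
    (ha : W.IsSolution a) {N s₁ s₂ : ℕ} {α β : Fin K → Fin n} {u v : Fin N}
    (hu : (u : ℕ) = tupleIndex α) (hv : (v : ℕ) = n ^ K + tupleIndex β)
    (hα : ∀ i : Fin K, (i : ℕ) + s₁ < K → α i = a i.castSucc)
    (hβ : ∀ i : Fin K, s₂ ≤ (i : ℕ) → β i = a i.succ) :
    ((3 * K + 1 - 2 * s₁ - 2 * s₂ : ℕ) : ℕ∞) ≤ (W.tables.graph N).edist u v := by
  have hn : 0 < n := (a 0).pos
  obtain ⟨f, hf, hret⟩ := exists_isRetraction_ovTables (bit := ovBit W) hn hK hd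
  refine hret.le_edist (a := fun j => (a (Fin.ofNat (K + 1) j) : ℕ)) ?_ (tupleIndex_lt α)
    (tupleIndex_lt β) hu hv (fun r hr hs => ?_) fun r hr => ?_
  · intro X m _
    obtain ⟨i, hi⟩ := isSolution_iff.1 ha ⟨f X m, hf X m⟩
    refine ⟨i, Nat.lt_succ_iff.1 i.2, ?_⟩
    have := ovBit_val W i (a i) ⟨f X m, hf X m⟩
    simp only at this
    rw [hi] at this
    simp [this]
  · simp only [ovTables_n, ovTables_K] at hr ⊢
    rw [dig_tupleIndex _ hr, hα _ (by simp only; omega)]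
    congr 2
    ext
    simp only [Fin.val_castSucc, Fin.ofNat]
    rw [Nat.mod_eq_of_lt (by omega)]
  · simp only [ovTables_n, ovTables_K] at hr ⊢
    rw [dig_tupleIndex _ (by omega), hβ _ (by simp only; omega)]
    congr 2
    ext
    simp only [Fin.val_succ, Fin.ofNat]
    rw [Nat.mod_eq_of_lt (by omega)]
    omega

theorem edist_eq_of_no_solution (hn : 0 < n) (hd : 0 < d) (hK : 0 < K)
    (h : ¬ ∃ a, W.IsSolution a) {N : ℕ} (hN : W.tables.order ≤ N) {u v : Fin N}
    (hu : u ∈ W.tables.first N) (hv : v ∈ W.tables.last N) :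
    (W.tables.graph N).edist u v = (K + 1 : ℕ) := by
  obtain ⟨f, hf, hret⟩ := exists_isRetraction_ovTables (bit := ovBit W) hn hK hd
  rw [Tables.mem_first] at hu
  rw [Tables.mem_last] at hv
  have hβ : (v : ℕ) - n ^ K < n ^ K := by
    simp only [OVInstance.tables_n, OVInstance.tables_K] at hv
    omega
  have hex : ∀ a : ℕ → ℕ, (∀ j ≤ K, a j < n) → ∃ x < d, ∀ j ≤ K, ovBit W j (a j) x = 1 := by
    intro a ha
    by_contra hc
    push Not at hc
    refine h ⟨fun i => ⟨a i, ha i (Nat.lt_succ_iff.1 i.2)⟩, isSolution_iff.2 fun x => ?_⟩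
    obtain ⟨j, hj, hne⟩ := hc x x.2
    refine ⟨⟨j, by omega⟩, ?_⟩
    have := ovBit_val W ⟨j, by omega⟩ ⟨a j, ha j hj⟩ x
    rw [this] at hne
    simpa using hne
  obtain ⟨X, hX, hA, hB⟩ := exists_array_of_no_solution hn hK hex hu hβ
  exact hret.edist_eq hN hu hβ rfl (Nat.add_sub_cancel' hv.1).symm hX hA hB

theorem le_stDiam_of_isSolution (hd : 0 < d) (hK : 0 < K) {a : Fin (K + 1) → Fin n}
    (ha : W.IsSolution a) {N : ℕ} (hN : W.tables.order ≤ N) :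
    ((3 * K + 1 : ℕ) : ℕ∞) ≤ stDiam (W.tables.graph N) (W.tables.first N) (W.tables.last N) := by
  have h2 : 2 * n ^ K ≤ N := le_trans (by simp [Tables.order]) hN
  set α : Fin K → Fin n := fun i => a i.castSucc with hα
  set β : Fin K → Fin n := fun i => a i.succ with hβ
  have h₁ := tupleIndex_lt α
  have h₂ := tupleIndex_lt β
  refine (le_edist_of_isSolution hd hK ha (N := N) (s₁ := 0) (s₂ := 0) (α := α) (β := β)
    (u := ⟨tupleIndex α, by omega⟩) (v := ⟨n ^ K + tupleIndex β, by omega⟩) rfl rfl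
    (fun _ _ => rfl) fun _ _ => rfl).trans ?_
  refine le_iSup₂_of_le _ ?_ (le_iSup₂_of_le _ ?_ le_rfl)
  · simpa using h₁
  · simp
    omega

theorem stDiam_eq_of_no_solution (hn : 0 < n) (hd : 0 < d) (hK : 0 < K)
    (h : ¬ ∃ a, W.IsSolution a) {N : ℕ} (hN : W.tables.order ≤ N) :
    stDiam (W.tables.graph N) (W.tables.first N) (W.tables.last N) = (K + 1 : ℕ) := by
  have h2 : 2 * n ^ K ≤ N := le_trans (by simp [Tables.order]) hN
  have hp : 0 < n ^ K := by positivity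
  apply le_antisymm
  · exact iSup₂_le fun u hu => iSup₂_le fun v hv => (edist_eq_of_no_solution hn hd hK h hN hu hv).le
  · have hu : (⟨0, by omega⟩ : Fin N) ∈ W.tables.first N := by simpa using hp
    have hv : (⟨n ^ K, by omega⟩ : Fin N) ∈ W.tables.last N := by
      simp
      omega
    rw [← edist_eq_of_no_solution hn hd hK h hN hu hv]
    exact le_iSup₂_of_le _ hu (le_iSup₂_of_le _ hv le_rfl)

end Instance

end STDiam

namespace STDiam

/-! ### The reduction -/

section Input

theorem getElem?_flatMap_of_length_eq {α β : Type*} {f : α → List β} {L : ℕ}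
    (hf : ∀ a, (f a).length = L) {i : ℕ} (hi : i < L) :
    ∀ (l : List α) (j : ℕ), (l.flatMap f)[j * L + i]? = l[j]?.bind fun a => (f a)[i]?
  | [], j => by simp
  | a :: l, 0 => by
      rw [List.flatMap_cons, List.getElem?_append_left (by rw [hf]; omega)]
      simp
  | a :: l, j + 1 => by
      rw [List.flatMap_cons, List.getElem?_append_right (by rw [hf, add_mul]; omega), hf,
        show (j + 1) * L + i - L = j * L + i by rw [add_mul]; omega,
        getElem?_flatMap_of_length_eq hf hi l j]
      simp

theorem length_flatMap_of_length_eq {α β : Type*} {f : α → List β} {L : ℕ}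
    (hf : ∀ a, (f a).length = L) (l : List α) : (l.flatMap f).length = l.length * L := by
  rw [List.length_flatMap]
  simp [hf]

variable {K n d : ℕ} (W : OVInstance (K + 1) n d)

theorem OVInstance.length_encode : W.encode.length = tableBase K n d := by
  have h₁ : ∀ i : Fin (K + 1), ∀ j : Fin n,
      ((List.finRange d).map fun x => (W i j x).toNat).length = d := by simp
  have h₂ : ∀ i : Fin (K + 1), ((List.finRange n).flatMap fun j => (List.finRange d).map fun x =>
      (W i j x).toNat).length = n * d := fun i => by
    rw [length_flatMap_of_length_eq (h₁ i), List.length_finRange]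
  rw [OVInstance.encode, List.length_cons, List.length_cons, List.length_cons,
    length_flatMap_of_length_eq h₂, List.length_finRange, tableBase]
  ring

theorem OVInstance.hasInput : HasInput K n d (ovBit W) fun i => W.encode.getD i 0 := by
  intro j hj a ha x hx
  have h₁ : ∀ i : Fin (K + 1), ∀ j : Fin n,
      ((List.finRange d).map fun x => (W i j x).toNat).length = d := by simp
  have h₂ : ∀ i : Fin (K + 1), ((List.finRange n).flatMap fun j => (List.finRange d).map fun x =>
      (W i j x).toNat).length = n * d := fun i => by
    rw [length_flatMap_of_length_eq (h₁ i), List.length_finRange]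
  have hax := mul_add_lt_mul ha hx
  change W.encode.getD _ 0 = _
  rw [List.getD_eq_getElem?_getD, OVInstance.encode,
    show 3 + (j * n + a) * d + x = j * (n * d) + (a * d + x) + 1 + 1 + 1 by ring,
    List.getElem?_cons_succ, List.getElem?_cons_succ, List.getElem?_cons_succ,
    getElem?_flatMap_of_length_eq h₂ hax, List.getElem?_eq_getElem (by simpa using by omega),
    Option.bind_some, getElem?_flatMap_of_length_eq (h₁ _) hx,
    List.getElem?_eq_getElem (by simpa using ha), Option.bind_some,
    List.getElem?_eq_getElem (by simpa using hx)]
  simp only [List.getElem_map, List.getElem_finRange, Option.getD_some]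
  rw [← ovBit_val]
  rfl

variable {W} {w : ℕ} {τ : State}

theorem outBase_le (hn : 0 < n) (hd : 0 < d) (hK : 0 < K) :
    outBase K n d ≤ 3 + 3 * ((K + 1) * (n * d) ^ K) := by
  have e : n * d ≤ (n * d) ^ K := Nat.le_self_pow (by omega) _
  have e₁ := Nat.mul_le_mul_left (K + 1) e
  have e₂ : K * n ≤ (K + 1) * (n * d) :=
    Nat.mul_le_mul (by omega) (Nat.le_mul_of_pos_right n hd)
  rw [outBase, tableBase, mul_assoc (K + 1)]
  omega

theorem OVInstance.tables_g_le (W : OVInstance (K + 1) n d) (hd : 0 < d) : W.tables.g ≤ d ^ K :=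
  ovTables_g_le _ _ _ _ hd

theorem OVInstance.order_le (W : OVInstance (K + 1) n d) (hd : 0 < d) :
    W.tables.order ≤ 2 * n ^ K + K * n ^ (K - 1) * d ^ K := by
  have := Nat.mul_le_mul_right (K * n ^ (K - 1)) (W.tables_g_le hd)
  have e : d ^ K * (K * n ^ (K - 1)) = K * n ^ (K - 1) * d ^ K := by ring
  simp only [Tables.order, tables_n, tables_K, mul_assoc W.tables.g]
  omega

theorem OVInstance.length_edges_le (W : OVInstance (K + 1) n d) (hd : 0 < d) :
    W.tables.edges.length ≤ (K + 1) * n ^ K * d ^ K := by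
  have := Nat.mul_le_mul_right ((K + 1) * n ^ K) (W.tables_g_le hd)
  have e : d ^ K * ((K + 1) * n ^ K) = (K + 1) * n ^ K * d ^ K := by ring
  have h := W.tables.length_edges_le
  simp only [tables_n, tables_K] at h
  omega

theorem order_bound (hn : 0 < n) (hd : 0 < d) :
    2 * n ^ K + K * n ^ (K - 1) * d ^ K ≤ 3 * ((K + 1) * (n * d) ^ K) := by
  have e₁ : n ^ K * 1 ≤ n ^ K * d ^ K := by gcongr; exact Nat.pow_pos hd
  have e₂ : 1 * (n ^ K * d ^ K) ≤ (K + 1) * (n ^ K * d ^ K) := by gcongr; omega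
  have e₃ : K * n ^ (K - 1) * d ^ K ≤ (K + 1) * (n ^ K * d ^ K) := by
    rw [mul_assoc]
    gcongr <;> omega
  rw [mul_pow]
  omega

/-- The reduction, started with the encoding of the instance in the memory. -/
theorem run_reduction_encode (hn : 0 < n) (hd : 0 < d) (hK : 0 < K)
    (hw : 16 * ((K + 1) * (n * d) ^ K) < 2 ^ w) (hτ : τ.mem = fun i => W.encode.getD i 0) :
    Run w reduction τ ((K + 1) * n ^ K * d ^ K * 1000) fun τ' =>
      (∃ m' : ℕ → ℕ, τ'.mem = withList (outBase K n d) m' W.tables.output) ∧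
      τ'.reg 0 = outBase K n d ∧ τ'.reg 9 = outBase K n d + W.tables.output.length := by
  have hM : (K + 1) * 1 ≤ (K + 1) * (n * d) ^ K := by gcongr; exact Nat.pow_pos (by positivity)
  have hob := outBase_le hn hd hK
  have hord := W.order_le hd
  have hb := order_bound (K := K) hn hd
  have hp : n ^ K ≤ (K + 1) * (n * d) ^ K := by
    have e : n ^ K * 1 ≤ n ^ K * d ^ K := by gcongr; exact Nat.pow_pos hd
    have e' : 1 * (n ^ K * d ^ K) ≤ (K + 1) * (n ^ K * d ^ K) := by gcongr; omega
    rw [mul_pow]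
    omega
  have hdp : d ^ K ≤ (K + 1) * (n * d) ^ K := by
    have e : 1 * d ^ K ≤ n ^ K * d ^ K := by gcongr; exact Nat.pow_pos hn
    have e' : 1 * (n ^ K * d ^ K) ≤ (K + 1) * (n ^ K * d ^ K) := by gcongr; omega
    rw [mul_pow]
    omega
  have hg : W.tables.g * ((K + 1) * n ^ K) ≤ (K + 1) * (n * d) ^ K := by
    have := Nat.mul_le_mul_right ((K + 1) * n ^ K) (W.tables_g_le hd)
    have e : d ^ K * ((K + 1) * n ^ K) = (K + 1) * (n * d) ^ K := by rw [mul_pow]; ring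
    omega
  refine run_reduction hw hd hn hK (ovBit_le_one W) ?_ ?_ ?_ ?_ ?_ ?_ ?_ ?_
  · rw [hτ]; rfl
  · rw [hτ]; rfl
  · rw [hτ]; rfl
  · rw [hτ]; exact W.hasInput
  · intro x hx
    rw [hτ]
    exact List.getD_eq_default _ _ (by rw [W.length_encode]; exact hx)
  · exact hord.trans (by omega)
  · omega
  · change outBase K n d + 5 + 2 * (W.tables.g * ((K + 1) * n ^ K)) + 2 * n ^ K ≤ _
    omega

theorem OVInstance.mem_encode_le (W : OVInstance (K + 1) n d) (hn : 0 < n) (hd : 0 < d)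
    (hK : 0 < K) : ∀ x ∈ W.encode, x ≤ (K + 1) * (n * d) ^ K := by
  have hM : (K + 1) * 1 ≤ (K + 1) * (n * d) ^ K := by gcongr; exact Nat.pow_pos (by positivity)
  have e : n * d ≤ (n * d) ^ K := Nat.le_self_pow (by omega) _
  have e₁ : 1 * (n * d) ^ K ≤ (K + 1) * (n * d) ^ K := by gcongr; omega
  have e₂ : n ≤ n * d := Nat.le_mul_of_pos_right n hd
  have e₃ : d ≤ n * d := Nat.le_mul_of_pos_left d hn
  intro x hx
  simp only [encode, List.mem_cons, List.mem_flatMap, List.mem_map] at hx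
  rcases hx with rfl | rfl | rfl | ⟨i, -, j, -, x, -, rfl⟩
  · omega
  · omega
  · omega
  · have := Bool.toNat_le (W i j x)
    omega

end Input

/-- The first part of the theorem, for `K + 1` lists. -/
theorem exists_reduction {K : ℕ} (hK : 0 < K) {n d : ℕ} (hn : 0 < n) (hd : 0 < d)
    (W : OVInstance (K + 1) n d) :
    Computes reduction (1000 * Nat.size ((K + 1) * (n * d) ^ K))
      ((1000 * ((K + 1) * n ^ K * d ^ K) : ℕ) : ℝ) W.encode W.tables.output := by
  set M := (K + 1) * (n * d) ^ K with hM
  have hM2 : 2 ≤ M := by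
    have : 2 * 1 ≤ (K + 1) * (n * d) ^ K := by
      gcongr
      · omega
      · exact Nat.pow_pos (by positivity)
    omega
  have hsize : 1 ≤ Nat.size M := Nat.size_pos.2 (by omega)
  have hw : 16 * M < 2 ^ (1000 * Nat.size M) := by
    calc 16 * M < 2 ^ 4 * 2 ^ Nat.size M := by
          have := Nat.lt_size_self M
          omega
      _ = 2 ^ (4 + Nat.size M) := (pow_add _ _ _).symm
      _ ≤ _ := Nat.pow_le_pow_right (by norm_num) (by omega)
  refine ⟨fun x hx => ?_, ?_⟩
  · have := W.mem_encode_le hn hd hK x hx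
    omega
  · obtain ⟨t, σ', τ', h₁, h₂, h₃, ⟨m', hm⟩, h0, -⟩ := run_reduction_encode (W := W) hn hd hK hw
      (τ := initState W.encode) rfl (initState W.encode) ⟨rfl, fun _ _ => rfl⟩
    refine ⟨t, σ', h₁, ?_, fun i hi => ?_⟩
    · exact_mod_cast h₂.trans (by rw [mul_comm])
    · rw [h₃.1, h₃.2 0 (by norm_num), h0, hm, withList_add, List.getD_eq_getElem _ _ hi]

end STDiam

namespace STDiam

/-! ### From satisfiability to orthogonal vectors -/

section Formula

/-- The formula in the memory consists of `M` clauses; the clause number `x` is at the address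
`off x`, has the length `len x` and the literals `lit x 0, lit x 1, …`. -/
structure HasFormula (M : ℕ) (off len : ℕ → ℕ) (lit : ℕ → ℕ → ℕ) (mem : ℕ → ℕ) : Prop where
  off_zero : off 0 = 2
  off_succ : ∀ x < M, off (x + 1) = off x + 1 + len x
  mem_off : ∀ x < M, mem (off x) = len x
  mem_lit : ∀ x < M, ∀ l < len x, mem (off x + 1 + l) = lit x l

theorem HasFormula.off_mono {M : ℕ} {off len : ℕ → ℕ} {lit : ℕ → ℕ → ℕ} {mem : ℕ → ℕ}
    (h : HasFormula M off len lit mem) {x y : ℕ} (hxy : x ≤ y) (hy : y ≤ M) : off x + (y - x) ≤ off y := by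
  induction y, hxy using Nat.le_induction with
  | base => simp
  | succ y hxy ih =>
    have := h.off_succ y (by omega)
    have := ih (by omega)
    omega

/-- The literal `v` is satisfied by the assignment `a` to the block number `i` of `h` variables. -/
def SatLit (h i a v : ℕ) : Prop := v / 2 / h = i ∧ a / 2 ^ (v / 2 % h) % 2 = v % 2

instance (h i a v : ℕ) : Decidable (SatLit h i a v) := by unfold SatLit; infer_instance

/-- The entry `x` of the vector for the assignment `a` to the block number `i` of the variables:
whether the clause number `x` is not satisfied by the assignment. -/
def clauseBit (h M : ℕ) (len : ℕ → ℕ) (lit : ℕ → ℕ → ℕ) (i a x : ℕ) : ℕ :=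
  if x < M ∧ ∀ l < len x, ¬ SatLit h i a (lit x l) then 1 else 0

/-- Appends the entry for the clause at the address in register `5` to the output. -/
def writeEntry : Prog :=
  .seq (assign 13 (.lit 1)) <| .seq (assign 14 (.load (.reg 5))) <|
  .seq (assign 5 (.reg 5 + .lit 1)) <|
  .seq (forUpTo 15 14 <|
    .seq (assign 16 (.load (.reg 5))) <| .seq (assign 5 (.reg 5 + .lit 1)) <|
    .seq (assign 17 (.reg 16 / .lit 2)) <|
    .seq (assign 18 (.reg 11 / .op .shl (.lit 1) (.reg 17 % .reg 1) % .lit 2)) <|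
    cond (.reg 17 / .reg 1 - .reg 10 + (.reg 10 - .reg 17 / .reg 1) +
        (.reg 18 - .reg 16 % .lit 2 + (.reg 16 % .lit 2 - .reg 18))) .skip
      (assign 13 (.lit 0))) <|
  emit (.reg 13)

variable {w : ℕ} {τ : State} {M L b h i a n R : ℕ} {off len : ℕ → ℕ} {lit : ℕ → ℕ → ℕ} {m : ℕ → ℕ}
  {l : List ℕ}

theorem run_writeEntry {x : ℕ} (hL : L < 2 ^ w) (hf : HasFormula M off len lit m) (hb : off M = b)
    (hx : x < M) (hlen : ∀ x < M, len x ≤ R) (hlit : ∀ x < M, ∀ l < len x, lit x l ≤ L)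
    (hh : 0 < h) (hhL : 2 ^ h ≤ L) (hiL : i < L) (haL : a ≤ L)
    (h1 : τ.reg 1 = h) (h5 : τ.reg 5 = off x) (h9 : τ.reg 9 = b + l.length) (h10 : τ.reg 10 = i)
    (h11 : τ.reg 11 = a) (hm : τ.mem = withList b m l) (hcap : b + l.length + 1 ≤ L) :
    Run w writeEntry τ (R * 60 + 30) fun τ' =>
      τ'.mem = withList b m (l ++ [clauseBit h M len lit i a x]) ∧
      τ'.reg 9 = b + (l ++ [clauseBit h M len lit i a x]).length ∧ τ'.reg 5 = off (x + 1) := by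
  have hoff := hf.off_mono (Nat.zero_le x) hx.le
  have hoff' := hf.off_mono (show x + 1 ≤ M from hx) le_rfl
  have hs := hf.off_succ x hx
  have h0 := hf.off_zero
  have hw0 : w ≠ 0 := by rintro rfl; simp at hL; omega
  have h2w : 2 < 2 ^ w := by omega
  have hhL' : h < 2 ^ h := Nat.lt_two_pow_self
  have hlR := hlen x hx
  have hmx : τ.mem (off x) = len x := by
    rw [hm, withList_of_lt (by omega)]
    exact hf.mem_off x hx
  have hT : len x * (54 + 5) ≤ R * 60 := by gcongr; omega
  refine Run.assign_seq 1 (by simp) (by simp [hw0]) ?_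
  refine Run.assign_seq (len x) (by simp [h5, hmx]) (by simp) ?_
  refine Run.assign_seq (off x + 1) (by simp [h5]) (by simp [h5, hw0]; omega) ?_
  refine Run.call (len x * (54 + 5) + 3) (Q₁ := fun σ => σ.mem = withList b m l ∧
    σ.reg 5 = off (x + 1) ∧ σ.reg 13 = clauseBit h M len lit i a x) (Run.forUpTo (fun c σ =>
    σ.mem = withList b m l ∧ σ.reg 5 = off x + 1 + c ∧
    σ.reg 13 = if x < M ∧ ∀ j < c, ¬ SatLit h i a (lit x j) then 1 else 0) (len x) 54 (by simp)
    (by omega) (by simp [hm, hx]) ?_ ?_) ?_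
  · rintro c hc σ ⟨hσm, h5', h13⟩ - hfr
    have e1 : σ.reg 1 = h := by rw [hfr 1 (by decide) (by decide) rfl]; simpa using h1
    have e10 : σ.reg 10 = i := by rw [hfr 10 (by decide) (by decide) rfl]; simpa using h10
    have e11 : σ.reg 11 = a := by rw [hfr 11 (by decide) (by decide) rfl]; simpa using h11
    have hml : σ.mem (off x + 1 + c) = lit x c := by
      rw [hσm, withList_of_lt (by omega)]
      exact hf.mem_lit x hx c hc
    have hlv := hlit x hx c hc
    generalize hv : lit x c = v at hml hlv
    have hmod : v / 2 % h < h := Nat.mod_lt _ hh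
    have hpow : 2 ^ (v / 2 % h) ≤ 2 ^ h := Nat.pow_le_pow_right (by norm_num) hmod.le
    have hdh : v / 2 / h ≤ v / 2 := Nat.div_le_self _ _
    have hda : a / 2 ^ (v / 2 % h) ≤ a := Nat.div_le_self _ _
    refine Run.assign_seq v (by simp [h5', hml]) (by simp) ?_
    refine Run.assign_seq (off x + 1 + c + 1) (by simp [h5']) (by simp [h5', hw0]; omega) ?_
    refine Run.assign_seq (v / 2) (by simp) (by simp [h2w]; omega) ?_
    have hP : 1 <<< (v / 2 % h) = 2 ^ (v / 2 % h) := by rw [Nat.shiftLeft_eq, one_mul]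
    refine Run.assign_seq (a / 2 ^ (v / 2 % h) % 2) (by simp [e1, e11, hP]) ?_ ?_
    · simp only [Expr.fits_mod, Expr.fits_div, Expr.fits_reg, Expr.fits_shl, Expr.fits_lit,
        Expr.eval_shl, Expr.eval_lit, Expr.eval_mod, Expr.eval_div, Expr.eval_reg,
        State.setReg_reg, true_and]
      simp only [show (17 : ℕ) ≠ 16 by decide, show (1 : ℕ) ≠ 17 by decide,
        show (1 : ℕ) ≠ 16 by decide, show (1 : ℕ) ≠ 5 by decide, show (11 : ℕ) ≠ 17 by decide,
        show (11 : ℕ) ≠ 16 by decide, show (11 : ℕ) ≠ 5 by decide, if_true, if_false, e1, e11, hP]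
      generalize v / 2 % h = q at *
      generalize 2 ^ q = Q at *
      generalize a / Q = A at *
      omega
    generalize hA : a / 2 ^ (v / 2 % h) % 2 = A
    have hA2 : A < 2 := by omega
    generalize hD : v / 2 / h = D at hdh
    have hsat : SatLit h i a (lit x c) ↔ D = i ∧ A = v % 2 := by rw [SatLit, hv, hD, hA]
    have hsucc : (x < M ∧ ∀ j < c + 1, ¬ SatLit h i a (lit x j)) ↔
        (x < M ∧ ∀ j < c, ¬ SatLit h i a (lit x j)) ∧ ¬ SatLit h i a (lit x c) := by
      simp only [Nat.lt_succ_iff_lt_or_eq, or_imp, forall_and, forall_eq, and_assoc]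
    -- A sum of truncated differences in both directions vanishes exactly if both equations hold, so
    -- this value is zero precisely for satisfied literals.
    have hev : (Expr.reg 17 / .reg 1 - .reg 10 + (.reg 10 - .reg 17 / .reg 1) +
        (.reg 18 - .reg 16 % .lit 2 + (.reg 16 % .lit 2 - .reg 18))).eval
        ((((σ.setReg 16 v).setReg 5 (off x + 1 + c + 1)).setReg 17 (v / 2)).setReg 18 A) =
        D - i + (i - D) + (A - v % 2 + (v % 2 - A)) := by
      simp [e1, e10, hD]
    refine Run.cond ?_ (fun hne => ?_) (fun he => ?_)
    · simp [e1, e10, hD, h2w]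
      omega
    · rw [hev] at hne
      refine Run.skip ?_
      simp only [State.setReg_mem, State.setReg_reg]
      refine ⟨hσm, rfl, ?_⟩
      simp only [hsucc, show (13 : ℕ) ≠ 15 by decide, show (13 : ℕ) ≠ 18 by decide,
        show (13 : ℕ) ≠ 17 by decide, show (13 : ℕ) ≠ 5 by decide, show (13 : ℕ) ≠ 16 by decide,
        if_false, h13]
      have : ¬ SatLit h i a (lit x c) := by rw [hsat]; omega
      simp only [this, not_false_eq_true, and_true]
    · rw [hev] at he
      refine Run.assign 0 (by simp) (by simp) ?_
      simp only [State.setReg_mem, State.setReg_reg]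
      refine ⟨hσm, rfl, ?_⟩
      have : SatLit h i a (lit x c) := by rw [hsat]; omega
      simp only [hsucc, this, not_true_eq_false, and_false, if_false]
      simp
  · rintro σ ⟨h₁, h₂, h₃⟩ - -
    exact ⟨h₁, by omega, h₃⟩
  · rintro σ ⟨hσm, h5', h13⟩ hfr
    have h9' : σ.reg 9 = b + l.length := by rw [hfr 9 (by decide) rfl]; simpa using h9
    refine run_emit _ (by omega) hσm h9' (by simpa using h13) (by simp) ?_
    intro σ' h₁ h₂ h₃
    exact ⟨h₁, h₂, by rw [h₃ 5 (by decide), h5']⟩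

/-- Appends all vectors of all lists to the output. -/
def writeVectors : Prog :=
  forUpTo 10 4 <| forUpTo 11 3 <|
    .seq (assign 5 (.lit 2)) <| .seq (forUpTo 12 2 writeEntry) (emit (.lit 0))

/-- The entries of the vectors in the list number `i`. -/
def listEntries (bit : ℕ → ℕ → ℕ → ℕ) (n d i : ℕ) : List ℕ :=
  (List.range n).flatMap fun a => (List.range d).map (bit i a)

theorem length_listEntries (bit : ℕ → ℕ → ℕ → ℕ) (n d i : ℕ) :
    (listEntries bit n d i).length = n * d := by
  rw [listEntries, length_flatMap_of_length_eq (L := d) (by simp), List.length_range]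

theorem run_writeVectors {k : ℕ} (hL : L < 2 ^ w) (hf : HasFormula M off len lit m) (hb : off M = b)
    (hlen : ∀ x < M, len x ≤ R) (hlit : ∀ x < M, ∀ l < len x, lit x l ≤ L)
    (hh : 0 < h) (hhL : 2 ^ h ≤ L) (hkL : k ≤ L)
    (h1 : τ.reg 1 = h) (h2 : τ.reg 2 = M) (h3 : τ.reg 3 = 2 ^ h) (h4 : τ.reg 4 = k)
    (h9 : τ.reg 9 = b + l.length) (hm : τ.mem = withList b m l)
    (hcap : b + l.length + k * (2 ^ h * (M + 1)) + 1 ≤ L) :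
    Run w writeVectors τ (k * (2 ^ h * (M * (R * 60 + 35) + 25) + 20) + 3) fun τ' =>
      τ'.mem = withList b m (l ++ (List.range k).flatMap
        (listEntries (clauseBit h M len lit) (2 ^ h) (M + 1))) ∧
      τ'.reg 9 = b + (l ++ (List.range k).flatMap
        (listEntries (clauseBit h M len lit) (2 ^ h) (M + 1))).length := by
  have hw0 : w ≠ 0 := by
    rintro rfl
    simp at hL
    omega
  have hoff := hf.off_mono (Nat.zero_le M) le_rfl
  have h0 := hf.off_zero
  have h2w : 2 < 2 ^ w := by omega
  set bit := clauseBit h M len lit with hbit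
  refine Run.forUpTo (fun i σ => σ.mem = withList b m (l ++ (List.range i).flatMap
      (listEntries bit (2 ^ h) (M + 1))) ∧
    σ.reg 9 = b + (l ++ (List.range i).flatMap (listEntries bit (2 ^ h) (M + 1))).length) k
    (2 ^ h * (M * (R * 60 + 35) + 25) + 10) h4 (by omega) (by simp [hm, h9]) ?_
    (fun σ hσ _ _ => hσ)
  rintro i hi σ ⟨hσm, hσ9⟩ hσ10 hfr
  have hle : i * (2 ^ h * (M + 1)) + 2 ^ h * (M + 1) ≤ k * (2 ^ h * (M + 1)) := by
    have := Nat.mul_le_mul_right (2 ^ h * (M + 1)) (show i + 1 ≤ k by omega)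
    rwa [add_mul, one_mul] at this
  have hlen₁ : ((List.range i).flatMap (listEntries bit (2 ^ h) (M + 1))).length =
      i * (2 ^ h * (M + 1)) := by
    rw [length_flatMap_of_length_eq (length_listEntries bit _ _), List.length_range]
  refine Run.conseq (2 ^ h * (M * (R * 60 + 35) + 20 + 5) + 3) (Q₁ := fun σ' =>
    σ'.mem = withList b m (l ++ (List.range i).flatMap (listEntries bit (2 ^ h) (M + 1)) ++
      listEntries bit (2 ^ h) (M + 1) i) ∧
    σ'.reg 9 = b + (l ++ (List.range i).flatMap (listEntries bit (2 ^ h) (M + 1)) ++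
      listEntries bit (2 ^ h) (M + 1) i).length) ?_ ?_
  · refine Run.forUpTo (fun a σ' => σ'.mem = withList b m
        (l ++ (List.range i).flatMap (listEntries bit (2 ^ h) (M + 1)) ++
          listEntries bit a (M + 1) i) ∧
      σ'.reg 9 = b + (l ++ (List.range i).flatMap (listEntries bit (2 ^ h) (M + 1)) ++
          listEntries bit a (M + 1) i).length) (2 ^ h) (M * (R * 60 + 35) + 20)
      (by rw [hfr 3 (by decide) (by decide) rfl, h3]) (by omega) (by simp [hσm, hσ9, listEntries])
      ?_ (fun σ hσ _ _ => hσ)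
    rintro a ha ρ ⟨hρm, hρ9⟩ hρ11 hfr'
    generalize hl' : l ++ (List.range i).flatMap (listEntries bit (2 ^ h) (M + 1)) ++
          listEntries bit a (M + 1) i = l' at hρm hρ9
    have hle' : a * (M + 1) + (M + 1) ≤ 2 ^ h * (M + 1) := by
      have := Nat.mul_le_mul_right (M + 1) (show a + 1 ≤ 2 ^ h by omega)
      rwa [add_mul, one_mul] at this
    have hlen₂ : l'.length = l.length + i * (2 ^ h * (M + 1)) + a * (M + 1) := by
      rw [← hl', List.length_append, List.length_append, hlen₁, length_listEntries]
    have e1 : ρ.reg 1 = h := by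
      rw [hfr' 1 (by decide) (by decide) rfl, hfr 1 (by decide) (by decide) rfl, h1]
    have e2 : ρ.reg 2 = M := by
      rw [hfr' 2 (by decide) (by decide) rfl, hfr 2 (by decide) (by decide) rfl, h2]
    have e10 : ρ.reg 10 = i := by rw [hfr' 10 (by decide) (by decide) rfl, hσ10]
    refine Run.assign_seq 2 (by simp) (by simp [h2w]) ?_
    refine Run.call (M * (R * 60 + 30 + 5) + 3) (Run.forUpTo (fun x σ' =>
      σ'.mem = withList b m (l' ++ (List.range x).map (bit i a)) ∧
      σ'.reg 9 = b + (l' ++ (List.range x).map (bit i a)).length ∧ σ'.reg 5 = off x) M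
      (R * 60 + 30) (by simp [e2]) (by omega) (by simp [hρm, hρ9, h0]) ?_ (fun σ hσ _ _ => hσ)) ?_
    · rintro x hx σ₁ ⟨hm₁, h9₁, h5₁⟩ - hfr₁
      have e1₁ : σ₁.reg 1 = h := by rw [hfr₁ 1 (by decide) (by decide) rfl]; simpa using e1
      have e10₁ : σ₁.reg 10 = i := by rw [hfr₁ 10 (by decide) (by decide) rfl]; simpa using e10
      have e11₁ : σ₁.reg 11 = a := by rw [hfr₁ 11 (by decide) (by decide) rfl]; simpa using hρ11
      refine (run_writeEntry hL hf hb hx hlen hlit hh hhL (by omega) (by omega) e1₁ h5₁ h9₁ e10₁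
        e11₁ hm₁ ?_).post ?_
      · simp only [List.length_append, List.length_map, List.length_range]
        omega
      · rintro σ₂ ⟨s₁, s₂, s₃⟩
        rw [List.append_assoc, ← hbit] at s₁ s₂
        simp only [State.setReg_mem, State.setReg_reg, List.range_succ, List.map_append,
          List.map_cons, List.map_nil]
        exact ⟨s₁, s₂, s₃⟩
    · rintro σ₁ ⟨hm₁, h9₁, -⟩ hfr₁
      refine run_emit 0 ?_ hm₁ h9₁ (by simp) (by simp) ?_
      · simp only [List.length_append, List.length_map, List.length_range]
        omega
      · intro σ₂ s₁ s₂ _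
        have e : l ++ (List.range i).flatMap (listEntries bit (2 ^ h) (M + 1)) ++
            listEntries bit (a + 1) (M + 1) i = l' ++ (List.range M).map (bit i a) ++ [0] := by
          -- The extra coordinate `M` is zero in all vectors; it excludes no solution and keeps the
          -- dimension positive for a formula without clauses.
          have h0 : bit i a M = 0 := by simp [hbit, clauseBit]
          rw [← hl', listEntries, List.range_succ (n := a), List.flatMap_append, ← listEntries,
            List.flatMap_singleton, List.range_succ, List.map_append, List.map_singleton, h0]
          simp only [List.append_assoc]
        rw [e]
        exact ⟨s₁, s₂⟩
  · rintro σ' ⟨s₁, s₂⟩ -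
    rw [List.append_assoc] at s₁ s₂
    simp only [State.setReg_mem, State.setReg_reg, List.range_succ, List.flatMap_append,
      List.flatMap_singleton]
    exact ⟨s₁, s₂⟩

end Formula

end STDiam

namespace STDiam

section Formula

theorem getElem?_flatMap_take {α β : Type*} (f : α → List β) {l : List α} {x i : ℕ}
    (hx : x < l.length) (hi : i < (f l[x]).length) :
    (l.flatMap f)[((l.take x).flatMap f).length + i]? = (f l[x])[i]? := by
  have e : l.flatMap f = (l.take x).flatMap f ++ (f l[x] ++ (l.drop (x + 1)).flatMap f) := by
    have e₀ : l = l.take x ++ l[x] :: l.drop (x + 1) := by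
      rw [← List.drop_eq_getElem_cons hx, List.take_append_drop]
    exact (congrArg (List.flatMap f) e₀).trans (by rw [List.flatMap_append, List.flatMap_cons])
  rw [e, List.getElem?_append_right (Nat.le_add_right _ _), Nat.add_sub_cancel_left,
    List.getElem?_append_left hi]

end Formula

/-! ### From formulas to vectors, and restoring an initial state -/

section Programs

variable {w : ℕ} {τ : State} {L : ℕ}

/-- Writes the instance of the orthogonal vectors problem with `k` lists for a formula. -/
def formulaToVectors (k : ℕ) : Prog :=
  .seq (assign 2 (.load (.lit 1))) <| .seq (assign 1 (.load (.lit 0) / .lit k + .lit 1)) <|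
  .seq (assign 3 (.op .shl (.lit 1) (.reg 1))) <| .seq (assign 4 (.lit k)) <|
  .seq (assign 5 (.lit 2)) <|
  .seq (forUpTo 6 2 (assign 5 (.reg 5 + .load (.reg 5) + .lit 1))) <|
  .seq (assign 0 (.reg 5 + .lit 0)) <| .seq (assign 9 (.reg 5 + .lit 0)) <|
  .seq (emit (.reg 4)) <| .seq (emit (.reg 3)) <| .seq (emit (.reg 2 + .lit 1)) writeVectors

/-- Clauses vary in length, so the end `b` of the input is found by walking through them; the output
starts there, in cells that are still zero. -/
theorem run_formulaToVectors {k N M R b h : ℕ} {off len : ℕ → ℕ} {lit : ℕ → ℕ → ℕ}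
    (hL : L < 2 ^ w) (hf : HasFormula M off len lit τ.mem) (hb : off M = b)
    (hlen : ∀ x < M, len x ≤ R) (hlit : ∀ x < M, ∀ l < len x, lit x l ≤ L) (hk : 0 < k)
    (hkL : k ≤ L) (hN : τ.mem 0 = N) (hM : τ.mem 1 = M) (hNL : N ≤ L) (hh : h = N / k + 1)
    (hm0 : ∀ x, b ≤ x → τ.mem x = 0) (hhL : 2 ^ h ≤ L)
    (hcap : b + 3 + k * (2 ^ h * (M + 1)) + 1 ≤ L) :
    Run w (formulaToVectors k) τ
      (M * 15 + k * (2 ^ h * (M * (R * 60 + 35) + 25) + 20) + 100) fun τ' =>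
      τ'.mem = withList b τ.mem (k :: 2 ^ h :: (M + 1) :: (List.range k).flatMap
        (listEntries (clauseBit h M len lit) (2 ^ h) (M + 1))) ∧ τ'.reg 0 = b ∧
      τ'.reg 9 = b + (k :: 2 ^ h :: (M + 1) :: (List.range k).flatMap
        (listEntries (clauseBit h M len lit) (2 ^ h) (M + 1))).length := by
  have hw0 : w ≠ 0 := by
    rintro rfl
    simp at hL
    omega
  have hoff := hf.off_mono (Nat.zero_le M) le_rfl
  have h0 := hf.off_zero
  have h2w : 2 < 2 ^ w := by omega
  have hkw : k < 2 ^ w := by omega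
  have hP : 1 <<< h = 2 ^ h := by rw [Nat.shiftLeft_eq, one_mul]
  have hhL' : h < 2 ^ h := Nat.lt_two_pow_self
  refine Run.assign_seq M (by simp [hM]) (by simp [hw0]) ?_
  refine Run.assign_seq h (by simp [hN, hh]) (by simp [hN, hw0, hkw]; omega) ?_
  refine Run.assign_seq (2 ^ h) (by simp [hP]) (by simp [hP, hw0]; omega) ?_
  refine Run.assign_seq k (by simp) (by simpa using hkw) ?_
  refine Run.assign_seq 2 (by simp) (by simpa using h2w) ?_
  refine Run.call (M * (6 + 5) + 3) (Q₁ := fun σ => σ.mem = τ.mem ∧ σ.reg 5 = b)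
    (Run.forUpTo (fun x σ => σ.mem = τ.mem ∧ σ.reg 5 = off x) M 6 (by simp) (by omega)
      (by simp [h0]) ?_ ?_) ?_
  · rintro x hx σ ⟨hσm, h5⟩ - -
    have hmx := hf.mem_off x hx
    have hs := hf.off_succ x hx
    have h₂ := hf.off_mono (show x + 1 ≤ M from hx) le_rfl
    refine Run.assign (off (x + 1)) (by simp [hσm, h5, hmx]; omega)
      (by simp [hσm, h5, hmx, hw0]; omega) (by simp [hσm])
  · rintro σ ⟨h₁, h₂⟩ - -
    exact ⟨h₁, h₂.trans hb⟩
  rintro σ ⟨hσm, h5⟩ hfr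
  have e1 : σ.reg 1 = h := by rw [hfr 1 (by decide) rfl]; simp
  have e2 : σ.reg 2 = M := by rw [hfr 2 (by decide) rfl]; simp
  have e3 : σ.reg 3 = 2 ^ h := by rw [hfr 3 (by decide) rfl]; simp
  have e4 : σ.reg 4 = k := by rw [hfr 4 (by decide) rfl]; simp
  have hσl : σ.mem = withList b τ.mem [] := by
    rw [hσm]
    funext x
    by_cases hx : x < b
    · simp [withList, hx]
    · simp [withList, hx, hm0 x (by omega)]
  refine Run.assign_seq b (by simp [h5]) (by simp [h5]; omega) ?_
  refine Run.assign_seq b (by simp [h5]) (by simp [h5]; omega) ?_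
  refine Run.seq 6 (run_emit (b := b) k (by simp; omega) hσl (by simp) (by simp [e4]) (by simp) ?_)
  intro σ₁ hm₁ h9₁ hr₁
  refine Run.seq 6 (run_emit (2 ^ h) (by simp; omega) hm₁ h9₁ (by simp [hr₁, e3]) (by simp) ?_)
  intro σ₂ hm₂ h9₂ hr₂
  refine Run.seq 8 (run_emit (M + 1) (by simp; omega) hm₂ h9₂ (by simp [hr₁, hr₂, e2])
    (by simp [hr₁, hr₂, e2, hw0]; omega) ?_)
  intro σ₃ hm₃ h9₃ hr₃
  refine Run.conseq (k * (2 ^ h * (M * (R * 60 + 35) + 25) + 20) + 3) (run_writeVectors hL ?_ hb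
    hlen hlit (by rw [hh]; exact Nat.succ_pos _) hhL hkL (by simp [hr₁, hr₂, hr₃, e1]) (by simp [hr₁, hr₂, hr₃, e2])
    (by simp [hr₁, hr₂, hr₃, e3]) (by simp [hr₁, hr₂, hr₃, e4]) h9₃ hm₃ (by simp; omega)) ?_
  · exact hf
  · rintro σ₄ ⟨s₁, s₂⟩ hr₄
    exact ⟨s₁, by rw [hr₄ 0 (by decide) rfl, hr₃ 0 (by decide), hr₂ 0 (by decide),
      hr₁ 0 (by decide)]; simp, s₂⟩

/-- Moves the memory block between the addresses in the registers `0` and `9` to the beginning of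
the memory, and clears the memory behind it. -/
def relocate : Prog :=
  .seq (assign 14 (.reg 9 - .reg 0)) <|
  .seq (forUpTo 13 14 (put (.reg 13) (.load (.reg 0 + .reg 13)))) <|
  forUpTo 13 0 (put (.reg 14 + .reg 13) (.lit 0))

/-- Copying downwards in increasing order is safe even if the blocks overlap, since the cell `b + c`
is read before any cell beyond `c` is written. The old contents end at `b + l.length`, so clearing
`b` cells behind the copy leaves exactly the memory of an initial state. -/
theorem run_relocate {b : ℕ} {m : ℕ → ℕ} {l : List ℕ} (hL : L < 2 ^ w)
    (hm : τ.mem = withList b m l) (h0 : τ.reg 0 = b) (h9 : τ.reg 9 = b + l.length)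
    (hcap : b + l.length ≤ L) :
    Run w relocate τ ((b + l.length) * 20 + 20) fun τ' => τ'.mem = fun i => l.getD i 0 := by
  refine Run.assign_seq l.length (by simp [h0, h9]) (by simp [h0, h9]; omega) ?_
  refine Run.call (l.length * (10 + 5) + 3) (Q₁ := fun σ => ∀ y, σ.mem y = if y < l.length then
    l.getD y 0 else withList b m l y) (Run.forUpTo (fun c σ => ∀ y, σ.mem y = if y < c then
    l.getD y 0 else withList b m l y) l.length 10 (by simp) (by omega) (by simp [hm]) ?_
    (fun σ hσ _ _ => hσ)) ?_
  · rintro c hc σ hσ h13 hfr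
    have e0 : σ.reg 0 = b := by rw [hfr 0 (by decide) (by decide) rfl]; simpa using h0
    have hv : σ.mem (b + c) = l.getD c 0 := by
      rw [hσ, if_neg (by omega), withList_add]
    refine Run.put c (l.getD c 0) (by simp [h13]) (by simp [e0, h13, hv]) (by simp)
      (by simp [e0, h13]; omega) ?_
    intro y
    simp only [State.setReg_mem, State.setMem_mem, hσ]
    rcases lt_trichotomy y c with h | rfl | h
    · rw [if_neg (by omega), if_pos h, if_pos (by omega)]
    · rw [if_pos rfl, if_pos (by omega)]
    · rw [if_neg (by omega), if_neg (by omega), if_neg (by omega)]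
  · rintro σ hσ hfr
    have e0 : σ.reg 0 = b := by rw [hfr 0 (by decide) rfl]; simpa using h0
    have e14 : σ.reg 14 = l.length := by rw [hfr 14 (by decide) rfl]; simp
    refine Run.forUpTo (fun c σ => ∀ y, σ.mem y = if y < l.length then
      l.getD y 0 else if y < l.length + c then 0 else withList b m l y) b 10 e0 (by omega) ?_ ?_ ?_
    · intro y
      simp only [State.setReg_mem, hσ, add_zero]
      split_ifs <;> rfl
    · rintro c hc ρ hρ h13 hfr'
      have e14' : ρ.reg 14 = l.length := by rw [hfr' 14 (by decide) (by decide) rfl, e14]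
      have hw0 : 0 < 2 ^ w := by positivity
      refine Run.put (l.length + c) 0 (by simp [h13, e14']) (by simp) (by simp [h13, e14']; omega)
        (by simp) ?_
      intro y
      simp only [State.setReg_mem, State.setMem_mem, hρ]
      split_ifs <;> first | rfl | omega
    · intro ρ hρ _ _
      funext y
      rw [hρ]
      split_ifs with h₁ h₂
      · rfl
      · rw [List.getD_eq_default _ _ (by omega)]
      · rw [withList_of_ge (by omega), List.getD_eq_default _ _ (by omega)]

/-- Sets all registers below `r` to zero. -/
def clearRegs : ℕ → Prog
  | 0 => .skip
  | r + 1 => .seq (clearRegs r) (.const r 0)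

theorem exec_clearRegs (w : ℕ) (r : ℕ) (σ : State) :
    Exec w (clearRegs r) σ (r + 1) { σ with reg := fun x => if x < r then 0 else σ.reg x } := by
  induction r with
  | zero => simpa [clearRegs] using Exec.skip σ
  | succ r ih =>
    have h := Exec.const (w := w) r 0 { σ with reg := fun x => if x < r then 0 else σ.reg x }
      (by positivity)
    have e : State.setReg { σ with reg := fun x => if x < r then 0 else σ.reg x } r 0 =
        { σ with reg := fun x => if x < r + 1 then 0 else σ.reg x } := by
      simp only [State.setReg, State.mk.injEq, and_true]
      funext x
      simp only [Function.update_apply]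
      split_ifs <;> first | rfl | omega
    rw [e] at h
    exact ih.seq h

end Programs

end STDiam

namespace STDiam

/-! ### Formulas and their vectors -/

section Formula

variable {N : ℕ}

/-- The code of a clause. -/
def clauseCode (c : List (Fin N × Bool)) : List ℕ :=
  c.length :: c.map fun l => 2 * (l.1 : ℕ) + l.2.toNat

theorem length_clauseCode (c : List (Fin N × Bool)) : (clauseCode c).length = c.length + 1 := by
  simp [clauseCode]

namespace CNF

variable (φ : CNF N)

def off (x : ℕ) : ℕ := 2 + ((List.take x φ).flatMap clauseCode).length

def len (x : ℕ) : ℕ := (List.getD φ x []).length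

def lit (x l : ℕ) : ℕ := ((List.getD φ x []).map fun l => 2 * (l.1 : ℕ) + l.2.toNat).getD l 0

theorem encode_eq : φ.encode = N :: List.length φ :: List.flatMap clauseCode φ := rfl

theorem off_length : φ.off (List.length φ) = φ.encode.length := by
  rw [off, encode_eq, List.take_length]
  simp
  ring

theorem getD_eq {x : ℕ} (hx : x < List.length φ) : List.getD φ x [] = φ[x] :=
  List.getD_eq_getElem _ _ hx

theorem hasFormula : HasFormula (List.length φ) φ.off φ.len φ.lit fun i => φ.encode.getD i 0 where
  off_zero := by simp [off]
  off_succ x hx := by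
    rw [off, off, List.take_succ_eq_append_getElem hx, List.flatMap_append, List.flatMap_singleton,
      List.length_append, length_clauseCode, len, φ.getD_eq hx]
    ring
  mem_off x hx := by
    have h := getElem?_flatMap_take clauseCode hx (i := 0) (by simp [clauseCode])
    simp only [encode_eq, off]
    rw [add_comm 2, List.getD_cons_succ, List.getD_cons_succ, List.getD_eq_getElem?_getD, ← add_zero
      (List.length _), h, len, φ.getD_eq hx]
    simp [clauseCode]
  mem_lit x hx l hl := by
    rw [len, φ.getD_eq hx] at hl
    have h := getElem?_flatMap_take clauseCode hx (i := 1 + l) (by rw [length_clauseCode]; omega)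
    simp only [encode_eq, off]
    rw [add_assoc, add_comm 2, add_right_comm, List.getD_cons_succ, List.getD_cons_succ,
      List.getD_eq_getElem?_getD, h, lit, φ.getD_eq hx, List.getD_eq_getElem?_getD, clauseCode,
      add_comm 1 l, List.getElem?_cons_succ]

theorem lit_lt {x : ℕ} (hx : x < List.length φ) {l : ℕ} (hl : l < φ.len x) : φ.lit x l < 2 * N := by
  rw [len, φ.getD_eq hx] at hl
  rw [lit, φ.getD_eq hx, List.getD_eq_getElem _ _ (by simpa using hl), List.getElem_map]
  have := φ[x][l].1.2
  have := Bool.toNat_le φ[x][l].2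
  omega

/-- The instance of the orthogonal vectors problem with `k` lists for the formula; the vectors in
each of the lists correspond to the assignments to a block of `h` variables. -/
def vectors (k h : ℕ) : OVInstance k (2 ^ h) (List.length φ + 1) :=
  fun i a x => decide (clauseBit h (List.length φ) φ.len φ.lit i a x = 1)

theorem flatMap_finRange {β : Type*} (k : ℕ) (f : ℕ → List β) :
    ((List.finRange k).flatMap fun i : Fin k => f i) = (List.range k).flatMap f := by
  rw [← List.map_coe_finRange_eq_range, List.flatMap_map]

theorem encode_vectors (k h : ℕ) : (φ.vectors k h).encode =
    k :: 2 ^ h :: (List.length φ + 1) :: (List.range k).flatMap (listEntries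
      (clauseBit h (List.length φ) φ.len φ.lit) (2 ^ h) (List.length φ + 1)) := by
  rw [OVInstance.encode, ← flatMap_finRange]
  have e : ∀ i : Fin k, ((List.finRange (2 ^ h)).flatMap fun a => (List.finRange
      (List.length φ + 1)).map fun x => (φ.vectors k h i a x).toNat) = listEntries
      (clauseBit h (List.length φ) φ.len φ.lit) (2 ^ h) (List.length φ + 1) i := by
    intro i
    rw [listEntries, ← flatMap_finRange]
    refine congrArg (List.flatMap · _) (funext fun a => ?_)
    rw [← List.map_coe_finRange_eq_range, List.map_map]
    refine List.map_congr_left fun x _ => ?_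
    simp only [vectors, Function.comp, clauseBit]
    split_ifs <;> rfl
  simp only [e]

variable {φ}

/-- The variable `v` is bit `v % h` of the vector chosen for block `v / h`, so choices of vectors
and assignments correspond; `N < (K + 1) * h` makes the blocks cover all variables. A zero at a
clause coordinate means that the block satisfies the clause, and orthogonality asks for one such
block per clause. -/
theorem exists_isSolution_iff {K h : ℕ} (hh : h = N / (K + 1) + 1) :
    (∃ a, (φ.vectors (K + 1) h).IsSolution a) ↔ φ.Satisfiable := by
  have hh0 : 0 < h := by rw [hh]; exact Nat.succ_pos _
  have hN : N < (K + 1) * h := by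
    rw [hh]
    exact Nat.lt_mul_div_succ N (Nat.succ_pos K)
  have hlt : ∀ v : Fin N, (v : ℕ) / h < K + 1 := fun v =>
    Nat.div_lt_of_lt_mul (by rw [mul_comm]; exact v.2.trans hN)
  have hlit : ∀ (x : ℕ) (hx : x < List.length φ) (l : ℕ) (hl : l < φ[x].length) (i a : ℕ),
      SatLit h i a (φ.lit x l) ↔ ((φ[x][l].1 : ℕ) / h = i ∧
        a / 2 ^ ((φ[x][l].1 : ℕ) % h) % 2 = φ[x][l].2.toNat) := by
    intro x hx l hl i a
    have h2 := Bool.toNat_le φ[x][l].2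
    rw [lit, φ.getD_eq hx, List.getD_eq_getElem _ _ (by simpa using hl), List.getElem_map, SatLit,
      show (2 * (φ[x][l].1 : ℕ) + φ[x][l].2.toNat) / 2 = φ[x][l].1 by omega,
      show (2 * (φ[x][l].1 : ℕ) + φ[x][l].2.toNat) % 2 = φ[x][l].2.toNat by omega]
  have hvec : ∀ (i : Fin (K + 1)) (a : Fin (2 ^ h)) (x : Fin (List.length φ + 1)),
      φ.vectors (K + 1) h i a x = false ↔ ((x : ℕ) < List.length φ →
        ∃ l < φ.len x, SatLit h i a (φ.lit x l)) := by
    intro i a x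
    have e : clauseBit h (List.length φ) φ.len φ.lit i a x = 1 ↔
        (x : ℕ) < List.length φ ∧ ∀ l < φ.len x, ¬ SatLit h i a (φ.lit x l) := by
      rw [clauseBit]
      split_ifs with hc
      · simpa using hc
      · simpa using hc
    rw [vectors, decide_eq_false_iff_not, e]
    push Not
    rfl
  constructor
  · rintro ⟨a, ha⟩
    refine ⟨fun v => decide ((a ⟨v / h, hlt v⟩ : ℕ) / 2 ^ ((v : ℕ) % h) % 2 = 1), fun c hc => ?_⟩
    obtain ⟨x, hx, rfl⟩ := List.getElem_of_mem hc
    obtain ⟨i, hi⟩ := isSolution_iff.1 ha ⟨x, by omega⟩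
    obtain ⟨l, hl, hs⟩ := (hvec _ _ _).1 hi hx
    simp only [len, φ.getD_eq hx] at hl
    rw [hlit x hx l hl] at hs
    refine ⟨φ[x][l], List.getElem_mem hl, ?_⟩
    have hi' : (⟨(φ[x][l].1 : ℕ) / h, hlt _⟩ : Fin (K + 1)) = i := Fin.ext hs.1
    simp only [hi', hs.2]
    cases φ[x][l].2 <;> rfl
  · rintro ⟨f, hf⟩
    let c : ℕ → ℕ → ℕ := fun i j => if hv : i * h + j < N then (f ⟨i * h + j, hv⟩).toNat else 0
    have hc : ∀ i j, c i j < 2 := by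
      intro i j
      simp only [c]
      split_ifs
      · have := Bool.toNat_le (f ⟨i * h + j, ‹_›⟩)
        omega
      · omega
    refine ⟨fun i => ⟨∑ j ∈ Finset.range h, c i j * 2 ^ j, sum_digits_lt fun j _ => hc i j⟩,
      isSolution_iff.2 fun x => ?_⟩
    by_cases hx : (x : ℕ) < List.length φ
    · obtain ⟨l, hl, hfl⟩ := hf _ (List.getElem_mem hx)
      obtain ⟨j, hj, rfl⟩ := List.getElem_of_mem hl
      refine ⟨⟨(φ[(x : ℕ)][j].1 : ℕ) / h, hlt _⟩, (hvec _ _ _).2 fun _ => ⟨j, ?_, ?_⟩⟩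
      · rw [len, φ.getD_eq hx]
        exact hj
      · rw [hlit x hx j hj]
        refine ⟨rfl, ?_⟩
        have := dig_sum (n := 2) (fun r (_ : r < h) => hc ((φ[(x : ℕ)][j].1 : ℕ) / h) r)
          (Nat.mod_lt (φ[(x : ℕ)][j].1 : ℕ) hh0)
        rw [dig] at this
        simp only
        rw [this]
        have e := Nat.div_add_mod' (φ[(x : ℕ)][j].1 : ℕ) h
        simp only [c, e, Fin.is_lt, dif_pos]
        rw [← hfl]
    -- The extra coordinate, at which every vector is zero.
    · exact ⟨0, (hvec _ _ _).2 fun h' => absurd h' hx⟩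

end CNF

end Formula

end STDiam

namespace STDiam

/-! ### From satisfiability to the diameter -/

section

/-- Constructs a graph from a formula. -/
def formulaToGraph (k : ℕ) : Prog :=
  .seq (formulaToVectors k) <| .seq relocate <| .seq reduction <| .seq relocate <|
  put (.lit 0) (.load (.lit 0) + .load (.lit 1))

variable {w N K R : ℕ} {φ : CNF N}

namespace CNF

/-- The graph has this number of additional isolated vertices, which makes it sparse. -/
noncomputable def graphSize (φ : CNF N) (K : ℕ) : ℕ :=
  (φ.vectors (K + 1) (N / (K + 1) + 1)).tables.order +
    (φ.vectors (K + 1) (N / (K + 1) + 1)).tables.edges.length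

/-- Isolated vertices are added just by raising the first number of the encoding; the program adds
the number of edges to it. -/
noncomputable def graphCode (φ : CNF N) (K : ℕ) : List ℕ :=
  φ.graphSize K :: (φ.vectors (K + 1) (N / (K + 1) + 1)).tables.output.tail

/-- A bound for the sizes of the objects that are constructed. -/
def volume (φ : CNF N) (K : ℕ) : ℕ :=
  (K + 1) * (2 ^ (N / (K + 1) + 1) * (List.length φ + 1)) ^ K

theorem length_encode_le (hφ : ∀ c ∈ φ, c.length ≤ R) :
    φ.encode.length ≤ 2 + List.length φ * (R + 1) := by
  have : (List.flatMap clauseCode φ).length ≤ List.length φ * (R + 1) := by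
    rw [List.length_flatMap]
    refine (List.sum_le_card_nsmul _ (R + 1) ?_).trans (by simp)
    intro x hx
    obtain ⟨c, hc, rfl⟩ := List.mem_map.1 hx
    rw [length_clauseCode]
    have := hφ c hc
    omega
  rw [encode_eq, List.length_cons, List.length_cons]
  omega

theorem len_le (hφ : ∀ c ∈ φ, c.length ≤ R) {x : ℕ} (hx : x < List.length φ) : φ.len x ≤ R := by
  rw [len, φ.getD_eq hx]
  exact hφ _ (List.getElem_mem hx)

theorem volume_bounds (hK : 0 < K) :
    (K + 1) * (2 ^ (N / (K + 1) + 1) * (List.length φ + 1)) ≤ φ.volume K ∧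
      4 ≤ φ.volume K ∧ K + 1 ≤ φ.volume K ∧ N ≤ φ.volume K ∧ List.length φ + 1 ≤ φ.volume K ∧
      2 ^ (N / (K + 1) + 1) ≤ φ.volume K ∧
      2 ^ (N / (K + 1) + 1) ≤ 2 ^ (N / (K + 1) + 1) * (List.length φ + 1) := by
  have hN : N < (K + 1) * (N / (K + 1) + 1) := Nat.lt_mul_div_succ N (Nat.succ_pos K)
  have hh : N / (K + 1) + 1 < 2 ^ (N / (K + 1) + 1) := Nat.lt_two_pow_self
  have h2 : 2 ^ 1 ≤ 2 ^ (N / (K + 1) + 1) := Nat.pow_le_pow_right (by norm_num) (Nat.succ_le_succ (Nat.zero_le _))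
  rw [volume]
  generalize hd : List.length φ + 1 = d at *
  generalize N / (K + 1) + 1 = h at *
  generalize 2 ^ h = n at *
  have hd1 : 1 ≤ d := by omega
  have e₀ : n * d ≤ (n * d) ^ K := Nat.le_self_pow (by omega) _
  have e₁ := Nat.mul_le_mul_left (K + 1) e₀
  have e₂ : (K + 1) * n ≤ (K + 1) * (n * d) := Nat.mul_le_mul_left _ (Nat.le_mul_of_pos_right n hd1)
  have e₃ : (K + 1) * h ≤ (K + 1) * n := Nat.mul_le_mul_left _ hh.le
  have e₄ : 2 * 2 ≤ (K + 1) * n := Nat.mul_le_mul (by omega) h2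
  have e₅ : (K + 1) * 1 ≤ (K + 1) * n := Nat.mul_le_mul_left _ (by omega)
  have e₆ : 1 * n ≤ (K + 1) * n := Nat.mul_le_mul_right _ (by omega)
  have e₇ : d ≤ n * d := Nat.le_mul_of_pos_left d (by omega)
  have e₈ : 1 * (n * d) ≤ (K + 1) * (n * d) := Nat.mul_le_mul_right _ (by omega)
  have e₉ : n ≤ n * d := Nat.le_mul_of_pos_right n hd1
  refine ⟨e₁, ?_, ?_, ?_, ?_, ?_, e₉⟩ <;> omega

theorem graphSize_le (hK : 0 < K) : φ.graphSize K ≤ 4 * φ.volume K := by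
  have h₁ := (φ.vectors (K + 1) (N / (K + 1) + 1)).order_le (Nat.succ_pos _)
  have h₂ := (φ.vectors (K + 1) (N / (K + 1) + 1)).length_edges_le (Nat.succ_pos _)
  have h₃ := order_bound (K := K) (n := 2 ^ (N / (K + 1) + 1)) (d := List.length φ + 1)
    (by positivity) (Nat.succ_pos _)
  rw [graphSize, volume]
  rw [mul_assoc, ← mul_pow] at h₂
  omega

theorem mem_encode_lt (hK : 0 < K) (hφ : ∀ c ∈ φ, c.length ≤ R) (x : ℕ) (hx : x ∈ φ.encode) :
    x ≤ φ.volume K * (R + 40) := by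
  obtain ⟨-, h₂, -, h₄, h₅, -⟩ := volume_bounds (φ := φ) hK
  have hmul : φ.volume K * (R + 40) = φ.volume K * R + φ.volume K * 40 := mul_add _ _ _
  rw [encode_eq] at hx
  simp only [List.mem_cons, List.mem_flatMap] at hx
  rcases hx with rfl | rfl | ⟨c, hc, hx⟩
  · omega
  · omega
  · rw [clauseCode, List.mem_cons, List.mem_map] at hx
    rcases hx with rfl | ⟨l, -, rfl⟩
    · have h₁ := hφ c hc
      have : 1 * R ≤ φ.volume K * R := Nat.mul_le_mul_right _ (by omega)
      omega
    · have := l.1.2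
      have := Bool.toNat_le l.2
      omega

theorem run_formulaToGraph {τ : State} (hK : 0 < K) (hφ : ∀ c ∈ φ, c.length ≤ R)
    (hw : φ.volume K * (R + 40) < 2 ^ w) (hτ : τ.mem = fun i => φ.encode.getD i 0) :
    Run w (formulaToGraph (K + 1)) τ (φ.volume K * (80 * R + 1600)) fun τ' =>
      τ'.mem = fun i => (φ.graphCode K).getD i 0 := by
  obtain ⟨hV, hV4, hVk, hVN, hVd, hVn, hnd⟩ := volume_bounds (φ := φ) hK
  have hb := length_encode_le hφ
  have hVR : List.length φ * (R + 1) ≤ φ.volume K * (R + 1) := Nat.mul_le_mul_right _ (by omega)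
  have hsize := graphSize_le (φ := φ) hK
  have hVe : φ.volume K = (K + 1) * (2 ^ (N / (K + 1) + 1) * (List.length φ + 1)) ^ K := rfl
  have henc := φ.encode_vectors (K + 1) (N / (K + 1) + 1)
  have hob := outBase_le (n := 2 ^ (N / (K + 1) + 1)) (d := List.length φ + 1) (K := K)
    (by positivity) (Nat.succ_pos _) hK
  have hol := (φ.vectors (K + 1) (N / (K + 1) + 1)).tables.length_output
  have hlenW := (φ.vectors (K + 1) (N / (K + 1) + 1)).length_encode
  have hgc : φ.graphCode K = φ.graphSize K ::
    (φ.vectors (K + 1) (N / (K + 1) + 1)).tables.output.tail := rfl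
  have hgs : φ.graphSize K = (φ.vectors (K + 1) (N / (K + 1) + 1)).tables.order +
    (φ.vectors (K + 1) (N / (K + 1) + 1)).tables.edges.length := rfl
  have hn0 : 0 < 2 ^ (N / (K + 1) + 1) := by positivity
  have hd0 : 0 < List.length φ + 1 := Nat.succ_pos _
  have hh : N / (K + 1) + 1 = N / (K + 1) + 1 := rfl
  have hp : 2 * (2 ^ (N / (K + 1) + 1)) ^ K ≤
      (φ.vectors (K + 1) (N / (K + 1) + 1)).tables.order := by simp [Tables.order]
  have hTV : (K + 1) * (2 ^ (N / (K + 1) + 1) * (List.length φ * (R * 60 + 35) + 25) + 20) ≤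
      φ.volume K * (60 * R + 80) := by
    calc _ ≤ (K + 1) * (2 ^ (N / (K + 1) + 1) * ((List.length φ + 1) * (R * 60 + 35) +
          (List.length φ + 1) * 25) + 2 ^ (N / (K + 1) + 1) * (List.length φ + 1) * 20) := by
          gcongr
          · omega
          · omega
          · have := Nat.mul_le_mul hn0 (Nat.succ_pos (List.length φ))
            omega
      _ = (K + 1) * (2 ^ (N / (K + 1) + 1) * (List.length φ + 1)) * (60 * R + 80) := by ring
      _ ≤ _ := Nat.mul_le_mul_right _ hV
  have hmul₁ : φ.volume K * (R + 40) = φ.volume K * R + φ.volume K * 40 := mul_add _ _ _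
  have hmul₂ : φ.volume K * (R + 1) = φ.volume K * R + φ.volume K := by ring
  have hmul₃ : φ.volume K * (60 * R + 80) = φ.volume K * R * 60 + φ.volume K * 80 := by ring
  have hmul₄ : φ.volume K * (80 * R + 1600) = φ.volume K * R * 80 + φ.volume K * 1600 := by ring
  have hred : (K + 1) * (2 ^ (N / (K + 1) + 1)) ^ K * (List.length φ + 1) ^ K * 1000 =
      φ.volume K * 1000 := by rw [hVe, mul_pow]; ring
  have hw0 : w ≠ 0 := by
    rintro rfl
    rw [pow_zero] at hw
    omega
  have hlW : φ.encode.length + (φ.vectors (K + 1) (N / (K + 1) + 1)).encode.length ≤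
      5 + φ.volume K * R + 2 * φ.volume K := by
    rw [hlenW, tableBase, mul_assoc (K + 1)]
    omega
  rw [OVInstance.tables_n, OVInstance.tables_K] at hol
  rw [← hVe] at hob
  generalize φ.volume K = V at *
  generalize V * R = VR at *
  refine Run.call (List.length φ * 15 + (K + 1) * (2 ^ (N / (K + 1) + 1) *
    (List.length φ * (R * 60 + 35) + 25) + 20) + 100) (run_formulaToVectors (k := K + 1) hw
    (hτ ▸ φ.hasFormula) φ.off_length (fun x => len_le hφ)
    (fun x hx l hl => (φ.lit_lt hx hl).le.trans (by omega)) (Nat.succ_pos _) (by omega)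
    (by rw [hτ]; rfl) (by rw [hτ]; rfl) (by omega) hh ?_ (by omega) ?_) ?_ (by omega)
  · intro x hx
    rw [hτ]
    exact List.getD_eq_default _ _ hx
  · rw [← mul_assoc] at hV ⊢
    omega
  rw [← henc]
  rintro σ₁ ⟨hm₁, h0₁, h9₁⟩ -
  refine Run.call _ (run_relocate hw hm₁ h0₁ h9₁ (by omega)) ?_ (by omega)
  rintro σ₂ hm₂ -
  refine Run.call _ (run_reduction_encode hn0 hd0 hK (by omega) hm₂) ?_ (by omega)
  rintro σ₃ ⟨⟨m', hm₃⟩, h0₃, h9₃⟩ -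
  refine Run.call _ (run_relocate hw hm₃ h0₃ h9₃ (by omega)) ?_ (by omega)
  rintro σ₄ hm₄ -
  refine Run.put 0 (φ.graphSize K) (by simp) ?_ (by simp) ?_ ?_ (hT := ?_)
  · simp only [Expr.eval_add, Expr.eval_load, Expr.eval_lit, hm₄]
    rfl
  · have e : σ₄.mem 0 + σ₄.mem 1 = φ.graphSize K := by rw [hm₄]; rfl
    simp [hw0, e]
    omega
  · funext i
    rw [State.setMem_mem, hm₄, hgc]
    cases i with
    | zero => rfl
    | succ i => rfl
  · simp
    omega

end CNF

end

end STDiam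

namespace STDiam

/-! ### Contradicting SETH -/

section

theorem Computes.mono {P : Prog} {w w' : ℕ} {T T' : ℝ} {input output : List ℕ}
    (h : Computes P w T input output) (hw : w ≤ w') (hT : T ≤ T') :
    Computes P w' T' input output := by
  obtain ⟨h₁, t, σ, h₂, h₃, h₄⟩ := h
  exact ⟨fun x hx => (h₁ x hx).trans_le (Nat.pow_le_pow_right (by norm_num) hw), t, σ,
    h₂.mono_word hw, h₃.trans hT, h₄⟩

/-- Decides satisfiability with an algorithm for the diameter. -/
def satSolver (k : ℕ) (A : Prog) : Prog :=
  .seq (formulaToGraph k) (.seq (clearRegs (formulaToGraph k).regBound) A)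

namespace CNF

variable {w N K R : ℕ} {φ : CNF N}

/-- The behaviour of `A` is known only on initial states. The construction leaves exactly the
encoding in the memory, and the registers it may have used are cleared; all others were never
written. -/
theorem computes_satSolver {A : Prog} {wA : ℕ} {T : ℝ} {out : List ℕ} (hK : 0 < K)
    (hφ : ∀ c ∈ φ, c.length ≤ R) (hw : φ.volume K * (R + 40) < 2 ^ w) (hwA : wA ≤ w)
    (hA : Computes A wA T (φ.graphCode K) out) :
    Computes (satSolver (K + 1) A) w ((φ.volume K * (80 * R + 1600) : ℕ) +
      ((formulaToGraph (K + 1)).regBound + 1 : ℕ) + T) φ.encode out := by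
  obtain ⟨-, t₂, σ₂, h₂, hT₂, hout⟩ := hA.mono hwA le_rfl
  obtain ⟨t₁, σ₁, τ₁, h₁, hT₁, hs, hm⟩ := run_formulaToGraph hK hφ hw (τ := initState φ.encode) rfl
    (initState φ.encode) ⟨rfl, fun _ _ => rfl⟩
  refine ⟨fun x hx => (mem_encode_lt hK hφ x hx).trans_lt hw, _, σ₂,
    h₁.seq ((exec_clearRegs w _ σ₁).seq (?_ : Exec w A _ t₂ σ₂)), ?_, hout⟩
  · have e : State.mk (fun x => if x < (formulaToGraph (K + 1)).regBound then 0 else σ₁.reg x)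
        σ₁.mem = initState (φ.graphCode K) := by
      simp only [initState, State.mk.injEq]
      refine ⟨funext fun x => ?_, by rw [hs.1, hm]⟩
      split_ifs with hx
      · rfl
      · rw [h₁.frame x (Prog.writes_of_regBound_le _ _ (not_lt.1 hx))]
        rfl
    rw [e]
    exact h₂
  · have : (t₁ : ℝ) ≤ (φ.volume K * (80 * R + 1600) : ℕ) := by exact_mod_cast hT₁
    push_cast at this ⊢
    linarith

theorem computes_graphCode {A : Prog} {c b : ℕ} {C e : ℝ} (hK : 0 < K)
    (hA : Distinguishes A (K + 1) c C e) (hb : b = 1 ∧ φ.Satisfiable ∨ b = 0 ∧ ¬ φ.Satisfiable) :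
    Computes A (c * Nat.size (φ.graphSize K)) (C * (φ.graphSize K : ℝ) ^ e) (φ.graphCode K) [b] := by
  set W := φ.vectors (K + 1) (N / (K + 1) + 1) with hW
  have hn0 : 0 < 2 ^ (N / (K + 1) + 1) := by positivity
  have hd0 : 0 < List.length φ + 1 := Nat.succ_pos _
  have hN : W.tables.order ≤ φ.graphSize K := Nat.le_add_right _ _
  obtain ⟨one, hret⟩ := W.exists_isRetraction hn0 hK hd0
  obtain ⟨henc, hnum⟩ := hret.encodesST hN
  have hsat : (∃ a, W.IsSolution a) ↔ φ.Satisfiable := exists_isSolution_iff rfl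
  obtain ⟨h₁, h₂⟩ := hA _ _ _ _ _ henc (by rw [hnum]; exact Nat.le_add_left _ _)
  rcases hb with ⟨rfl, h⟩ | ⟨rfl, h⟩
  · obtain ⟨a, ha⟩ := hsat.2 h
    refine h₂ ?_
    rw [show 3 * (K + 1) - 2 = 3 * K + 1 by omega]
    exact le_stDiam_of_isSolution hd0 hK ha hN
  · rw [← hsat] at h
    exact h₁ (stDiam_eq_of_no_solution hn0 hd0 hK h hN)

theorem volume_le_two_pow :
    φ.volume K ≤ 2 ^ (K * (N + Nat.size (List.length φ) + 2)) := by
  have h₁ : N / (K + 1) + 1 ≤ N + 1 := Nat.succ_le_succ (Nat.div_le_self _ _)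
  have h₂ : List.length φ + 1 ≤ 2 ^ Nat.size (List.length φ) := Nat.lt_size_self _
  calc φ.volume K ≤ 2 ^ K * (2 ^ (N + 1) * 2 ^ Nat.size (List.length φ)) ^ K := by
        rw [volume]
        gcongr
        · exact Nat.lt_two_pow_self
        · norm_num
    _ = _ := by
        rw [← pow_add, ← pow_mul, ← pow_add]
        congr 1
        ring

theorem volume_mul_lt {c : ℕ} (hc : 2 * K + R + 40 ≤ c) :
    φ.volume K * (R + 40) < 2 ^ (c * (N + Nat.size (List.length φ) + 1)) := by
  have h : R + 40 < 2 ^ (R + 40) := Nat.lt_two_pow_self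
  calc φ.volume K * (R + 40)
      < 2 ^ (K * (N + Nat.size (List.length φ) + 2)) * 2 ^ (R + 40) :=
        Nat.mul_lt_mul_of_le_of_lt volume_le_two_pow h (by positivity)
    _ = 2 ^ (K * (N + Nat.size (List.length φ) + 2) + (R + 40)) := (pow_add _ _ _).symm
    _ ≤ _ := by
        refine Nat.pow_le_pow_right (by norm_num) ?_
        refine le_trans ?_ (Nat.mul_le_mul_right _ hc)
        nlinarith [Nat.zero_le (K * (N + Nat.size (List.length φ))),
          Nat.zero_le ((R + 40) * (N + Nat.size (List.length φ)))]

theorem size_graphSize_le (hK : 0 < K) {c c' : ℕ} (hc : c * (2 * K + 3) ≤ c') :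
    c * Nat.size (φ.graphSize K) ≤ c' * (N + Nat.size (List.length φ) + 1) := by
  have h : Nat.size (φ.graphSize K) ≤ 3 + K * (N + Nat.size (List.length φ) + 2) := by
    rw [Nat.size_le, pow_add]
    have h₁ := graphSize_le (φ := φ) hK
    have h₂ := volume_le_two_pow (φ := φ) (K := K)
    have : 0 < 2 ^ (K * (N + Nat.size (List.length φ) + 2)) := by positivity
    omega
  calc c * Nat.size (φ.graphSize K)
      ≤ c * ((2 * K + 3) * (N + Nat.size (List.length φ) + 1)) := by
        gcongr
        refine h.trans ?_
        nlinarith [Nat.zero_le (K * (N + Nat.size (List.length φ)))]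
    _ = c * (2 * K + 3) * (N + Nat.size (List.length φ) + 1) := by ring
    _ ≤ _ := Nat.mul_le_mul_right _ hc

/-- The volume is `2 ^ (N * K / (K + 1))` up to constants and a power of the number of clauses,
hence its power `t` has exponent `t * (K / (K + 1))` in `N`. Rounding up the block length costs a
factor `2 ^ (K * t)`, at most `4 ^ K`; the bound `t ≤ 2` also caps the other factors. -/
theorem volume_rpow_le {t δ : ℝ} (ht : 0 ≤ t) (ht' : t ≤ 2) (hδ : t * (K / (K + 1)) ≤ δ) :
    ((4 * φ.volume K : ℕ) : ℝ) ^ t ≤ 16 * (K + 1) ^ 2 * 4 ^ K * (2 : ℝ) ^ (δ * (N : ℝ)) *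
      ((N : ℝ) + List.length φ + 1) ^ (2 * K) := by
  have hN0 : (0 : ℝ) ≤ N := Nat.cast_nonneg N
  have hM0 : (0 : ℝ) ≤ List.length φ := Nat.cast_nonneg _
  have hK0 : (0 : ℝ) ≤ K := Nat.cast_nonneg K
  have e : ((4 * φ.volume K : ℕ) : ℝ) = (4 * (K + 1)) *
      (2 : ℝ) ^ (((N / (K + 1) + 1 : ℕ) : ℝ) * K) * ((List.length φ : ℝ) + 1) ^ K := by
    rw [Real.rpow_mul (by norm_num), Real.rpow_natCast, Real.rpow_natCast, volume]
    push_cast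
    rw [mul_pow]
    ring
  rw [e, Real.mul_rpow (by positivity) (by positivity), Real.mul_rpow (by positivity) (by positivity)]
  have h₁ : (4 * ((K : ℝ) + 1)) ^ t ≤ 16 * (K + 1) ^ 2 := by
    calc (4 * ((K : ℝ) + 1)) ^ t ≤ (4 * ((K : ℝ) + 1)) ^ (2 : ℝ) :=
          Real.rpow_le_rpow_of_exponent_le (by linarith) ht'
      _ = _ := by rw [Real.rpow_two]; ring
  have h₂ : ((2 : ℝ) ^ (((N / (K + 1) + 1 : ℕ) : ℝ) * K)) ^ t ≤ 4 ^ K * (2 : ℝ) ^ (δ * (N : ℝ)) := by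
    have e₄ : (4 : ℝ) ^ K = (2 : ℝ) ^ (2 * (K : ℝ)) := by
      rw [Real.rpow_mul (by norm_num), Real.rpow_natCast]
      norm_num
    rw [e₄, ← Real.rpow_mul (by norm_num), ← Real.rpow_add (by norm_num)]
    refine Real.rpow_le_rpow_of_exponent_le (by norm_num) ?_
    have hdiv : ((N / (K + 1) : ℕ) : ℝ) ≤ N / (K + 1) := by
      have := Nat.cast_div_le (α := ℝ) (m := N) (n := K + 1)
      push_cast at this
      exact this
    push_cast
    calc ((N / (K + 1) : ℕ) + 1 : ℝ) * K * t ≤ (N / (K + 1) + 1) * K * t := by gcongr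
      _ = N * (t * (K / (K + 1))) + K * t := by ring
      _ ≤ N * δ + K * 2 := by gcongr
      _ = _ := by ring
  have h₃ : (((List.length φ : ℝ) + 1) ^ K) ^ t ≤ ((N : ℝ) + List.length φ + 1) ^ (2 * K) := by
    calc (((List.length φ : ℝ) + 1) ^ K) ^ t ≤ (((List.length φ : ℝ) + 1) ^ K) ^ (2 : ℝ) :=
          Real.rpow_le_rpow_of_exponent_le (one_le_pow₀ (by linarith)) ht'
      _ = ((List.length φ : ℝ) + 1) ^ (2 * K) := by rw [Real.rpow_two, ← pow_mul, mul_comm]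
      _ ≤ _ := by gcongr; linarith
  calc _ ≤ 16 * ((K : ℝ) + 1) ^ 2 * (4 ^ K * (2 : ℝ) ^ (δ * (N : ℝ))) *
        ((N : ℝ) + List.length φ + 1) ^ (2 * K) := by gcongr
    _ = _ := by ring

end CNF

theorem SETH.not_distinguishes (h : SETH) {K : ℕ} (hK : 0 < K) {ε : ℝ} (hε : 0 < ε) {A : Prog}
    {c : ℕ} {C : ℝ} : ¬ Distinguishes A (K + 1) c C (1 + 1 / K - ε) := by
  intro hA
  have hK' : (0 : ℝ) < K := by exact_mod_cast hK
  -- Keeps the exponent `1 + 1 / K - ε₁` nonnegative, so the power is monotone in the size of the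
  -- graph.
  set ε₁ := min ε 1 with hε₁
  have hε₁0 : 0 < ε₁ := lt_min hε one_pos
  -- The first term pays for the construction, which is linear in the volume and thus has exponent
  -- `K / (K + 1) = 1 - 1 / (K + 1)`. The second one is what remains for `A`, because `(1 + 1 / K -
  -- ε₁) * (K / (K + 1)) = 1 - ε₁ * (K / (K + 1))`.
  set ε' := min (1 / ((K : ℝ) + 1)) (ε₁ * (K / (K + 1))) with hε'
  have hε'0 : 0 < ε' := lt_min (by positivity) (by positivity)
  have hle₁ : ε' ≤ 1 / ((K : ℝ) + 1) := min_le_left _ _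
  have hle₂ : ε' ≤ ε₁ * (K / (K + 1)) := min_le_right _ _
  obtain ⟨R, hR⟩ := h ε' hε'0
  refine hR ⟨satSolver (K + 1) A, ?_⟩
  set B := (formulaToGraph (K + 1)).regBound + 1 with hB
  set E : ℝ := 16 * (K + 1) ^ 2 * 4 ^ K with hE
  have hE0 : 0 ≤ E := by positivity
  -- One constant for all purposes: the coefficient of the running time, the exponent of the
  -- polynomial, the word length needed by the construction, and that needed by `A`.
  refine ⟨⌈E * (80 * R + 1600) + E * |C| + B⌉₊ + 2 * K + (2 * K + R + 40) + c * (2 * K + 3),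
    fun N φ hφ b hb => ?_⟩
  refine (CNF.computes_satSolver hK hφ (CNF.volume_mul_lt (by omega))
    (CNF.size_graphSize_le hK (by omega)) (CNF.computes_graphCode hK hA hb)).mono le_rfl ?_
  generalize hc' : ⌈E * (80 * R + 1600) + E * |C| + B⌉₊ + 2 * K + (2 * K + R + 40) +
    c * (2 * K + 3) = c'
  have hc'D : E * (80 * R + 1600) + E * |C| + B ≤ c' := by
    refine (Nat.le_ceil _).trans ?_
    rw [← hc']
    push_cast
    have : (0 : ℝ) ≤ (c : ℝ) * (2 * K + 3) := by positivity
    linarith [(Nat.cast_nonneg R : (0 : ℝ) ≤ R)]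
  have hc'K : 2 * K ≤ c' := by omega
  clear hc'
  set X : ℝ := (2 : ℝ) ^ ((1 - ε') * (N : ℝ)) with hX
  set Y : ℝ := (N : ℝ) + List.length φ + 1 with hY
  have hdiv1 : 1 / ((K : ℝ) + 1) ≤ 1 := by
    rw [div_le_one (by positivity)]
    linarith
  have hX1 : 1 ≤ X := Real.one_le_rpow (by norm_num)
    (mul_nonneg (by linarith) (Nat.cast_nonneg N))
  have hY1 : 1 ≤ Y := by
    have : (0 : ℝ) ≤ List.length φ := Nat.cast_nonneg _
    have : (0 : ℝ) ≤ N := Nat.cast_nonneg _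
    linarith
  have hXY : 1 ≤ X * Y ^ (2 * K) := by
    exact one_le_mul_of_one_le_of_one_le hX1 (one_le_pow₀ hY1)
  have hV : (φ.volume K : ℝ) ≤ E * X * Y ^ (2 * K) := by
    have h₁ := CNF.volume_rpow_le (φ := φ) (K := K) (t := 1) (δ := 1 - ε') (by norm_num)
      (by norm_num) (by
        have : (K : ℝ) / (K + 1) = 1 - 1 / (K + 1) := by field_simp; ring
        linarith)
    rw [Real.rpow_one] at h₁
    push_cast at h₁
    have : (0 : ℝ) ≤ φ.volume K := Nat.cast_nonneg _
    linarith
  have hT : C * (φ.graphSize K : ℝ) ^ (1 + 1 / (K : ℝ) - ε) ≤ |C| * (E * X * Y ^ (2 * K)) := by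
    have hone : (1 : ℝ) ≤ φ.graphSize K := by
      have : 0 < φ.graphSize K := by
        have : 0 < (2 ^ (N / (K + 1) + 1)) ^ K := by positivity
        simp only [CNF.graphSize, Tables.order, OVInstance.tables_n, OVInstance.tables_K]
        omega
      exact_mod_cast this
    have hinv : 1 / (K : ℝ) ≤ 1 := by
      rw [div_le_one hK']
      exact_mod_cast hK
    have hinv0 : 0 < 1 / (K : ℝ) := by positivity
    have hε₁1 : ε₁ ≤ 1 := min_le_right _ _
    have hsz : (φ.graphSize K : ℝ) ≤ (4 * φ.volume K : ℕ) := by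
      exact_mod_cast CNF.graphSize_le hK
    calc C * (φ.graphSize K : ℝ) ^ (1 + 1 / (K : ℝ) - ε)
        ≤ |C| * (φ.graphSize K : ℝ) ^ (1 + 1 / (K : ℝ) - ε) := by
          exact mul_le_mul_of_nonneg_right (le_abs_self C)
            (Real.rpow_nonneg (Nat.cast_nonneg _) _)
      _ ≤ |C| * (φ.graphSize K : ℝ) ^ (1 + 1 / (K : ℝ) - ε₁) := by
          refine mul_le_mul_of_nonneg_left (Real.rpow_le_rpow_of_exponent_le hone ?_) (abs_nonneg C)
          linarith [min_le_left ε 1]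
      _ ≤ |C| * ((4 * φ.volume K : ℕ) : ℝ) ^ (1 + 1 / (K : ℝ) - ε₁) := by
          exact mul_le_mul_of_nonneg_left (Real.rpow_le_rpow (by linarith) hsz (by linarith))
            (abs_nonneg C)
      _ ≤ |C| * (E * X * Y ^ (2 * K)) := by
          refine mul_le_mul_of_nonneg_left (CNF.volume_rpow_le (by linarith) (by linarith) ?_)
            (abs_nonneg C)
          have : (1 + 1 / (K : ℝ) - ε₁) * (K / (K + 1)) = 1 - ε₁ * (K / (K + 1)) := by
            field_simp
          linarith
  have hYp : Y ^ (2 * K) ≤ Y ^ c' := pow_le_pow_right₀ hY1 hc'K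
  calc ((φ.volume K * (80 * R + 1600) : ℕ) : ℝ) + (B : ℕ) +
        C * (φ.graphSize K : ℝ) ^ (1 + 1 / (K : ℝ) - ε)
      ≤ E * X * Y ^ (2 * K) * (80 * R + 1600) + B * (X * Y ^ (2 * K)) +
        |C| * (E * X * Y ^ (2 * K)) := by
        push_cast
        gcongr
        exact le_mul_of_one_le_right (Nat.cast_nonneg B) hXY
    _ = (E * (80 * R + 1600) + E * |C| + B) * X * Y ^ (2 * K) := by ring
    _ ≤ c' * X * Y ^ c' := by gcongr

end

end STDiam


/-! ### Assembling the theorem -/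

theorem theorem3p1 :
    -- the reduction; `C` is an absolute constant
    (∃ C : ℕ, ∀ k : ℕ, 2 ≤ k → ∃ P : Prog, ∀ n d : ℕ, 0 < n → 0 < d → ∀ W : OVInstance k n d,
      ∃ (N : ℕ) (G : SimpleGraph (Fin N)) (S T : Finset (Fin N)) (l : List ℕ)
        (layer : Fin N → ℕ) (sTup tTup : (Fin (k - 1) → Fin n) → Fin N),
        -- computing it, on a word-RAM with words of `O(log (k * (n * d) ^ (k - 1)))` bits
        EncodesST G S T l ∧
        Computes P (C * Nat.size (k * (n * d) ^ (k - 1)))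
          ((C * (k * n ^ (k - 1) * d ^ (k - 1)) : ℕ) : ℝ) W.encode l ∧
        -- size
        N ≤ C * (n ^ (k - 1) + k * n ^ (k - 2) * d ^ (k - 1)) ∧
        numEdges G ≤ C * (k * n ^ (k - 1) * d ^ (k - 1)) ∧
        -- layers
        (∀ v, layer v ≤ k) ∧
        (∀ u v, G.Adj u v → layer u + 1 = layer v ∨ layer v + 1 = layer u) ∧
        (∀ v, v ∈ S ↔ layer v = 0) ∧
        (∀ v, v ∈ T ↔ layer v = k) ∧
        Disjoint S T ∧ S.card = n ^ (k - 1) ∧ T.card = n ^ (k - 1) ∧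
        (∀ i, 1 ≤ i → i ≤ k - 1 →
          {v : Fin N | layer v = i}.ncard ≤ n ^ (k - 2) * d ^ (k - 1)) ∧
        -- `S` consists of the tuples `(a₀, …, a_{k-2})`, and `T` of the tuples `(b₁, …, b_{k-1})`
        (Function.Injective sTup ∧ ∀ v, v ∈ S ↔ ∃ u, sTup u = v) ∧
        (Function.Injective tTup ∧ ∀ v, v ∈ T ↔ ∃ u, tTup u = v) ∧
        -- no solution
        ((¬ ∃ a, W.IsSolution a) →
          stDiam G S T ≤ k ∧ ∀ u ∈ S, ∀ v ∈ T, G.edist u v = k) ∧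
        -- a solution
        (∀ a, W.IsSolution a →
          ((3 * k - 2 : ℕ) : ℕ∞) ≤ stDiam G S T ∧
          ((3 * k - 2 : ℕ) : ℕ∞) ≤ G.edist (sTup (front a)) (tTup (back a)) ∧
          ∀ s, s ≤ k - 2 →
            -- `(a₀, …, a_{t-s}, b_{t-s+1}, …, b_t)` and `(a₁, …, a_{t+1})`, where `t = k - 2`
            (∀ α : Fin (k - 1) → Fin n, (∀ i : Fin (k - 1), (i : ℕ) ≤ k - 2 - s → α i = front a i) →
              ((3 * (k - 2) - 2 * s + 4 : ℕ) : ℕ∞) ≤ G.edist (sTup α) (tTup (back a))) ∧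
            -- `(a₀, …, a_t)` and `(c₁, …, c_s, a_{s+1}, …, a_{t+1})`
            (∀ β : Fin (k - 1) → Fin n, (∀ i : Fin (k - 1), s ≤ (i : ℕ) → β i = back a i) →
              ((3 * (k - 2) - 2 * s + 4 : ℕ) : ℕ∞) ≤ G.edist (sTup (front a)) (tTup β))) ∧
        -- inner vertices have neighbours in both adjacent layers
        (∀ v, 1 ≤ layer v → layer v ≤ k - 1 →
          (∃ u, G.Adj u v ∧ layer u + 1 = layer v) ∧ ∃ u, G.Adj v u ∧ layer u = layer v + 1)) ∧
    -- the consequence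
    (SETH → ∀ k : ℕ, 2 ≤ k → ∀ ε : ℝ, 0 < ε →
      ¬ ∃ (A : Prog) (c : ℕ) (C : ℝ), Distinguishes A k c C (1 + 1 / ((k : ℝ) - 1) - ε)) := by
  -- The coefficient of the running time in `exists_reduction`; it is more than enough for the other
  -- bounds.
  refine ⟨⟨1000, fun k hk => ?_⟩, ?_⟩
  · obtain ⟨K, rfl⟩ : ∃ K, k = K + 1 := ⟨k - 1, by omega⟩
    have hK : 0 < K := by omega
    refine ⟨reduction, fun n d hn hd W => ?_⟩
    obtain ⟨one, hret⟩ := W.exists_isRetraction hn hK hd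
    have h2 : 2 * n ^ K ≤ W.tables.order := by simp [Tables.order]
    have hord := W.order_le hd
    have hedge := W.length_edges_le hd
    obtain ⟨henc, hnum⟩ := hret.encodesST le_rfl
    have hlt : ∀ u : Fin K → Fin n, tupleIndex u < n ^ K := tupleIndex_lt
    have hlayer : ∀ v : Fin W.tables.order, W.tables.layer v ≤ K + 1 ∧
        (v ∈ W.tables.first W.tables.order ↔ W.tables.layer v = 0) ∧
        (v ∈ W.tables.last W.tables.order ↔ W.tables.layer v = K + 1) := by
      intro v
      exact ⟨hret.layer_le v, hret.mem_first_iff_layer, hret.mem_last_iff_layer⟩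
    have hcard₁ : (W.tables.first W.tables.order).card = n ^ K := by
      have : (W.tables.first W.tables.order).card = (Finset.univ : Finset (Fin K → Fin n)).card := by
        symm
        refine Finset.card_bij (fun u _ => ⟨tupleIndex u, by have := hlt u; omega⟩) ?_ ?_ ?_
        · intro u _
          simpa using hlt u
        · intro u _ v _ huv
          exact tupleIndex_injective (Fin.mk.inj huv)
        · intro v hv
          obtain ⟨u, hu⟩ := exists_tupleIndex_eq hn (Tables.mem_first.1 hv)
          exact ⟨u, Finset.mem_univ _, Fin.ext hu⟩
      simpa using this
    have hcard₂ : (W.tables.last W.tables.order).card = n ^ K := by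
      have : (W.tables.last W.tables.order).card = (Finset.univ : Finset (Fin K → Fin n)).card := by
        symm
        refine Finset.card_bij (fun u _ => ⟨n ^ K + tupleIndex u, by have := hlt u; omega⟩) ?_ ?_ ?_
        · intro u _
          have := hlt u
          simp
          omega
        · intro u _ v _ huv
          exact tupleIndex_injective (by have := Fin.mk.inj huv; omega)
        · intro v hv
          have hv' := Tables.mem_last.1 hv
          simp only [OVInstance.tables_n, OVInstance.tables_K] at hv'
          obtain ⟨u, hu⟩ := exists_tupleIndex_eq hn (show (v : ℕ) - n ^ K < n ^ K by omega)
          exact ⟨u, Finset.mem_univ _, Fin.ext (by simp only; omega)⟩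
      simpa using this
    refine ⟨W.tables.order, W.tables.graph _, W.tables.first _, W.tables.last _, W.tables.output,
      fun v => W.tables.layer v, fun u => ⟨tupleIndex u, (hlt u).trans_le (by omega)⟩,
      fun u => ⟨n ^ K + tupleIndex u, by have := hlt u; omega⟩, henc, exists_reduction hK hn hd W,
      ?_, ?_, fun v => (hlayer v).1, fun u v => hret.layer_of_adj, fun v => (hlayer v).2.1,
      fun v => (hlayer v).2.2, ?_, hcard₁, hcard₂, ?_, ⟨?_, ?_⟩, ⟨?_, ?_⟩, ?_, ?_, ?_⟩
    · rw [show K + 1 - 2 = K - 1 by omega, Nat.add_sub_cancel, add_mul, add_mul, mul_add, mul_add]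
      omega
    · rw [hnum, Nat.add_sub_cancel]
      omega
    · rw [Finset.disjoint_left]
      intro v hv hv'
      rw [Tables.mem_first] at hv
      rw [Tables.mem_last] at hv'
      omega
    · intro i hi hi'
      rw [show K + 1 - 2 = K - 1 by omega, Nat.add_sub_cancel]
      exact (hret.ncard_layer_le hi hi').trans (Nat.mul_le_mul_left _ (W.tables_g_le hd))
    · intro u v huv
      exact tupleIndex_injective (Fin.mk.inj huv)
    · intro v
      rw [Tables.mem_first]
      constructor
      · intro hv
        obtain ⟨u, hu⟩ := exists_tupleIndex_eq hn hv
        exact ⟨u, Fin.ext hu⟩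
      · rintro ⟨u, rfl⟩
        exact hlt u
    · intro u v huv
      exact tupleIndex_injective (by have := Fin.mk.inj huv; omega)
    · intro v
      rw [Tables.mem_last]
      simp only [OVInstance.tables_n, OVInstance.tables_K]
      constructor
      · intro hv
        obtain ⟨u, hu⟩ := exists_tupleIndex_eq hn (show (v : ℕ) - n ^ K < n ^ K by omega)
        exact ⟨u, Fin.ext (by simp only; omega)⟩
      · rintro ⟨u, rfl⟩
        have := hlt u
        simp only
        omega
    · intro h
      exact ⟨(stDiam_eq_of_no_solution hn hd hK h le_rfl).le,
        fun u hu v hv => edist_eq_of_no_solution hn hd hK h le_rfl hu hv⟩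
    · intro a ha
      have e₁ : 3 * (K + 1) - 2 = 3 * K + 1 := by omega
      refine ⟨?_, ?_, fun s hs => ⟨fun α hα => ?_, fun β hβ => ?_⟩⟩
      · rw [e₁]
        exact le_stDiam_of_isSolution hd hK ha le_rfl
      · rw [e₁]
        exact le_edist_of_isSolution hd hK ha (s₁ := 0) (s₂ := 0) rfl rfl (fun _ _ => rfl)
          fun _ _ => rfl
      -- With `t = K - 1` the bound `3t - 2s + 4` is `3K + 1 - 2s`: the last `s` entries are free at
      -- the source and none at the target. The symmetric case exchanges the two roles.
      · rw [show 3 * (K + 1 - 2) - 2 * s + 4 = 3 * K + 1 - 2 * s - 2 * 0 by omega]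
        exact le_edist_of_isSolution hd hK ha rfl rfl
          (fun i hi => hα i (by omega)) fun _ _ => rfl
      · rw [show 3 * (K + 1 - 2) - 2 * s + 4 = 3 * K + 1 - 2 * 0 - 2 * s by omega]
        exact le_edist_of_isSolution hd hK ha rfl rfl (fun _ _ => rfl) fun i hi => hβ i hi
    · intro v hv hv'
      exact ⟨hret.exists_adj_lower le_rfl v.2 hv hv', hret.exists_adj_upper le_rfl v.2 hv hv'⟩
  · rintro hS k hk ε hε ⟨A, c, C, hA⟩
    obtain ⟨K, rfl⟩ : ∃ K, k = K + 1 := ⟨k - 1, by omega⟩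
    refine hS.not_distinguishes (K := K) (by omega) hε (A := A) (c := c) (C := C) ?_
    rwa [Nat.cast_add_one, add_sub_cancel_right] at hA
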